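/- **Definitions.** Let $\Sigma$ be an alphabet (a finite non-empty set) and let $w\ge 1$. A *$(\Sigma,w)$-layer* is a tuple $B=(\ell,r,T,I,F,\iota,\phi)$ with $\ell,r\subseteq\{0,\dots,w-1\}$ (left and right states), $T\subseteq \ell\times\Sigma\times r$ (transitions), $I\subseteq \ell$ (initial states), $F\subseteq r$ (final states), and flags $\iota,\phi\in\{0,1\}$ such that $I=\emptyset$ if $\iota=0$, and $F=\emptyset$ if $\phi=0$. The layer is *deterministic* if ($\iota=1$ implies $I=\ell$ and $|\ell|=1$) and for all $p\in \ell$, $a\in\Sigma$ there is at most one $q\in r$ with $(p,a,q)\in T$; it is *complete* if ($\iota=1$ implies $I\ne\emptyset$) and for all $p\in \ell$, $a\in\Sigma$ there is at least one $q\in r$ with $(p,a,q)\in T$. An *ODD* of length $k\ge1$ is a sequence $B_1\cdots B_k$ of $(\Sigma,w)$-layers such that $\ell(B_{i+1})=r(B_i)$ for $1\le i<k$, exactly $B_1$ has $\iota=1$, and exactly $B_k$ has $\phi=1$. It computes the function $f:\Sigma^k\to\{0,1\}$ with $f(s_1\cdots s_k)=1$ if and only if there are transitions $(p_i,s_i,q_i)\in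 T(B_i)$, $1\le i\le k$, with $p_{i+1}=q_i$ for $1\le i<k$, $p_1\in I(B_1)$ and $q_k\in F(B_k)$. For a set $S$ of $(\Sigma,w)$-layers, let $N_S(k)$ be the number of functions $f:\Sigma^k\to\{0,1\}$ computed by some ODD of length $k$ all of whose layers are in $S$. Time is measured on a random access machine with logarithmic cost (each operation is charged one plus the number of bits of its operands). The input consists of the numbers $|\Sigma|$, $w$, $k$ in binary, and of a list without repetitions of the layers in $S$, each described by the characteristic bits of its components with respect to some numbering of $\Sigma$. **Statement.** 1. There are an algorithm and a constant $c$ such that for all alphabets $\Sigma$, all $w\ge1$, all sets $S$ of $(\Sigma,w)$-layers and all $k\ge1$, the algorithm computes $N_S(k)$ in time at most $2^{2^{c\cdot|\Sigma|\cdot w\cdot 2^w}}\cdot k^2$. 2. There are an algorithm and a constant $c$ such that for all alphabets $\Sigma$, all $w\ge1$, all sets $S$ of deterministic, complete $(\Sigma,w)$-layers and all $k\ge1$, the algorithm computes $N_S(k)$ in time at most $2^{2^{c\cdot|\Sigma|\cdot w\cdot\lfloor\log_2(w+1)\rfloor}}\cdot k^2$. 3. In particular, for every fixed alphabet $\Sigma$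 and $w\ge1$, the number of functions $\Sigma^k\to\{0,1\}$ computed by some ODD of length $k$ with $(\Sigma,w)$-layers, and the number of those computed by some such ODD all of whose layers are deterministic and complete (for $\Sigma=\{0,1\}$: by OBDDs of width at most $w$ with a fixed variable order), can each be computed from $k\ge 1$ in time $O(k^2)$, where the hidden constant depends only on $\Sigma$ and $w$. -/

import Mathlib

universe u

/-! ## Layers and ordered decision diagrams (ODDs) -/

/-- A `(A, w)`-layer: left and right states in `{0, …, w-1}`, transitions labelled by symbols of the
alphabet `A`, initial (left) and final (right) states, and two Boolean flags; there are no initial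
(final) states when the initial (final) flag is off. -/
@[ext]
structure Layer (A : Type*) (w : ℕ) where
  leftStates : Set (Fin w)
  rightStates : Set (Fin w)
  transitions : Set (Fin w × A × Fin w)
  initialStates : Set (Fin w)
  finalStates : Set (Fin w)
  initialFlag : Bool
  finalFlag : Bool
  transitions_subset : ∀ p a q, (p, a, q) ∈ transitions → p ∈ leftStates ∧ q ∈ rightStates
  initialStates_subset : initialStates ⊆ leftStates
  finalStates_subset : finalStates ⊆ rightStates
  initialStates_eq_empty : initialFlag = false → initialStates = ∅
  finalStates_eq_empty : finalFlag = false → finalStates = ∅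

namespace Layer

variable {A : Type*} {w : ℕ}

/-- Deterministic layers. -/
def Deterministic (B : Layer A w) : Prop :=
  (B.initialFlag = true → B.initialStates = B.leftStates ∧ B.leftStates.ncard = 1) ∧
  ∀ p ∈ B.leftStates, ∀ a : A, ∀ q ∈ B.rightStates, ∀ q' ∈ B.rightStates,
    (p, a, q) ∈ B.transitions → (p, a, q') ∈ B.transitions → q = q'

/-- Complete layers. -/
def Complete (B : Layer A w) : Prop :=
  (B.initialFlag = true → B.initialStates.Nonempty) ∧
  ∀ p ∈ B.leftStates, ∀ a : A, ∃ q ∈ B.rightStates, (p, a, q) ∈ B.transitions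

end Layer

/-- `D = D₀ ⋯ D_{k-1}` is a `(A, w)`-ODD of length `k` (which is positive): consecutive frontiers
agree, exactly the first layer has its initial flag on, and exactly the last layer has its final
flag on. -/
def IsODD {A : Type*} {w k : ℕ} (D : Fin k → Layer A w) : Prop :=
  0 < k ∧
  (∀ i j : Fin k, (j : ℕ) = i + 1 → (D j).leftStates = (D i).rightStates) ∧
  (∀ i : Fin k, (D i).initialFlag = true ↔ (i : ℕ) = 0) ∧
  (∀ i : Fin k, (D i).finalFlag = true ↔ (i : ℕ) + 1 = k)

/-- The string `s` of length `k` has an accepting sequence of transitions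
`(p₀, s₀, q₀), …, (p_{k-1}, s_{k-1}, q_{k-1})` in `D`. -/
def ODDAccepts {A : Type*} {w k : ℕ} (D : Fin k → Layer A w) (s : Fin k → A) : Prop :=
  ∃ p q : Fin k → Fin w,
    (∀ i, (p i, s i, q i) ∈ (D i).transitions) ∧
    (∀ i j : Fin k, (j : ℕ) = i + 1 → p j = q i) ∧
    (∀ i : Fin k, (i : ℕ) = 0 → p i ∈ (D i).initialStates) ∧
    (∀ i : Fin k, (i : ℕ) + 1 = k → q i ∈ (D i).finalStates)

/-- The functions `A^k → {0, 1}` computed by the ODDs of length `k` all of whose layers are in `S`. -/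
def computableFunctions {A : Type*} {w : ℕ} (S : Set (Layer A w)) (k : ℕ) :
    Set ((Fin k → A) → Bool) :=
  {f | ∃ D : Fin k → Layer A w, IsODD D ∧ (∀ i, D i ∈ S) ∧
    ∀ s, f s = true ↔ ODDAccepts D s}

/-! ## Random access machines with logarithmic cost

A state consists of registers, which a program addresses by fixed names, and of a memory, which it
addresses through the content of a register. Registers and memory cells hold natural numbers of
arbitrary size; every operation is charged the total number of bits of its operands (memory
addresses included), plus one. -/

structure RAMState where
  reg : ℕ → ℕ
  mem : ℕ → ℕ

/-- Writing a value to a register. -/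
def RAMState.setReg (s : RAMState) (i v : ℕ) : RAMState :=
  { s with reg := Function.update s.reg i v }

/-- Writing a value to a memory cell. -/
def RAMState.setMem (s : RAMState) (a v : ℕ) : RAMState :=
  { s with mem := Function.update s.mem a v }

/-- Programs of the random access machine. -/
inductive RAMProgram where
  /-- `rᵢ := c` -/
  | const (i c : ℕ)
  /-- `rᵢ := rⱼ` -/
  | copy (i j : ℕ)
  /-- `rᵢ := rⱼ + rₗ` -/
  | add (i j l : ℕ)
  /-- `rᵢ := max (rⱼ - rₗ) 0` -/
  | sub (i j l : ℕ)
  /-- `rᵢ := ⌊rⱼ / 2⌋` -/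
  | half (i j : ℕ)
  /-- `rᵢ := mem[rⱼ]` -/
  | load (i j : ℕ)
  /-- `mem[rᵢ] := rⱼ` -/
  | store (i j : ℕ)
  /-- run `P`, then `Q` -/
  | seq (P Q : RAMProgram)
  /-- if `rᵢ ≠ 0` then run `P`, else run `Q` -/
  | cond (i : ℕ) (P Q : RAMProgram)
  /-- while `rᵢ ≠ 0`, run `P` -/
  | loop (i : ℕ) (P : RAMProgram)

/-- `RAMRuns P s t s'`: started in state `s`, the program `P` halts in state `s'`, and the execution
takes time exactly `t`. Here `Nat.size x` is the number of binary digits of `x`. -/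
inductive RAMRuns : RAMProgram → RAMState → ℕ → RAMState → Prop
  | const (i c : ℕ) (s : RAMState) :
      RAMRuns (.const i c) s (1 + c.size) (s.setReg i c)
  | copy (i j : ℕ) (s : RAMState) :
      RAMRuns (.copy i j) s (1 + (s.reg j).size) (s.setReg i (s.reg j))
  | add (i j l : ℕ) (s : RAMState) :
      RAMRuns (.add i j l) s (1 + (s.reg j).size + (s.reg l).size)
        (s.setReg i (s.reg j + s.reg l))
  | sub (i j l : ℕ) (s : RAMState) :
      RAMRuns (.sub i j l) s (1 + (s.reg j).size + (s.reg l).size)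
        (s.setReg i (s.reg j - s.reg l))
  | half (i j : ℕ) (s : RAMState) :
      RAMRuns (.half i j) s (1 + (s.reg j).size) (s.setReg i (s.reg j / 2))
  | load (i j : ℕ) (s : RAMState) :
      RAMRuns (.load i j) s (1 + (s.reg j).size + (s.mem (s.reg j)).size)
        (s.setReg i (s.mem (s.reg j)))
  | store (i j : ℕ) (s : RAMState) :
      RAMRuns (.store i j) s (1 + (s.reg i).size + (s.reg j).size)
        (s.setMem (s.reg i) (s.reg j))
  | seq (P Q : RAMProgram) (s s' s'' : RAMState) (t t' : ℕ) :
      RAMRuns P s t s' → RAMRuns Q s' t' s'' → RAMRuns (.seq P Q) s (t + t') s''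
  | cond_true (i : ℕ) (P Q : RAMProgram) (s s' : RAMState) (t : ℕ) :
      s.reg i ≠ 0 → RAMRuns P s t s' → RAMRuns (.cond i P Q) s (1 + (s.reg i).size + t) s'
  | cond_false (i : ℕ) (P Q : RAMProgram) (s s' : RAMState) (t : ℕ) :
      s.reg i = 0 → RAMRuns Q s t s' → RAMRuns (.cond i P Q) s (1 + t) s'
  | loop_true (i : ℕ) (P : RAMProgram) (s s' s'' : RAMState) (t t' : ℕ) :
      s.reg i ≠ 0 → RAMRuns P s t s' → RAMRuns (.loop i P) s' t' s'' →
      RAMRuns (.loop i P) s (1 + (s.reg i).size + t + t') s''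
  | loop_false (i : ℕ) (P : RAMProgram) (s : RAMState) :
      s.reg i = 0 → RAMRuns (.loop i P) s 1 s

/-- Started in state `s`, the program `P` halts after time at most `T` with the number `v` in
register `0`. -/
def RAMOutputsWithin (P : RAMProgram) (s : RAMState) (v T : ℕ) : Prop :=
  ∃ t s', RAMRuns P s t s' ∧ t ≤ T ∧ s'.reg 0 = v

/-! ## Inputs -/

open Classical in
/-- The bit that tells whether a proposition holds. -/
noncomputable def propBit (p : Prop) : ℕ := if p then 1 else 0

/-- The bits that describe a layer, the symbols of the alphabet being numbered by `e`: the two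
flags, the characteristic sequences of the left, right, initial and final states, and the
characteristic sequence of the transitions in lexicographic order; `2 + 4w + w²n` bits in all. -/
noncomputable def Layer.encode {A : Type*} {w n : ℕ} (e : A ≃ Fin n) (B : Layer A w) : List ℕ :=
  [propBit (B.initialFlag = true), propBit (B.finalFlag = true)] ++
  (List.finRange w).map (fun q => propBit (q ∈ B.leftStates)) ++
  (List.finRange w).map (fun q => propBit (q ∈ B.rightStates)) ++
  (List.finRange w).map (fun q => propBit (q ∈ B.initialStates)) ++
  (List.finRange w).map (fun q => propBit (q ∈ B.finalStates)) ++
  (List.finRange w).flatMap fun p => (List.finRange n).flatMap fun a =>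
    (List.finRange w).map fun q => propBit ((p, e.symm a, q) ∈ B.transitions)

/-- The initial state for the input consisting of the numbers `n` (the size of the alphabet), `w`
and `k`, in binary, and of a list of layers: registers `0, 1, 2, 3` hold `n`, `w`, `k` and the
length of the list, the memory holds the bits of the layers one after the other, one bit per cell,
and everything else is `0`. -/
noncomputable def countingInput {A : Type*} {w n : ℕ} (e : A ≃ Fin n) (Ls : List (Layer A w))
    (k : ℕ) : RAMState where
  reg i := [n, w, k, Ls.length].getD i 0
  mem a := (Ls.flatMap (Layer.encode e)).getD a 0

/-- The initial state for the input consisting of the number `k` alone, held by register `0`. -/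
def numberInput (k : ℕ) : RAMState where
  reg i := if i = 0 then k else 0
  mem _ := 0

/-! Each computed function has exactly one lexicographically least sequence of layers that computes
it, so the functions are counted by counting the sequences that are least in their class. The point
is that a finite automaton reading layers can recognise least sequences.

Whether two sequences `D` and `D'` compute the same function depends on their last layers and on the
pairs of states that they reach on common strings. These pairs are recorded indirectly, through the
pairs of labellings of the states under which `D` and `D'` always reach states with equal labels.
The profile of `D` collects this information over all `D'` of the same length, together with the bit
telling whether `D' < D`. It can be updated layer by layer (`profile_iff`): an admissible pair of
labellings after a layer pulls back to one before it, since labels of `size W` bits suffice to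
compare any two maps on `W` states (`exists_labellings`). Labelling states by acceptance shows that
the profile decides minimality (`minimalProfile_iff`). There are only `2 ^ (W * size W)` labellings,
whereas there are `2 ^ (W * W)` relations between states.

A profile is a subset of `Q` codes, where `Q` is polynomial in the numbers of layers, labellings and
input bits. The automaton has `2 ^ Q` states, and its accepted words of length `k` are exactly the
least full sequences (`card_filter_minimalProfile`, `sum_pathCount_eq`). They are counted by `k`
vector-matrix products (`exists_pathCount_program`). The entries are at most `|S| ^ k`, hence have a
number of bits linear in `k`, so the time is `(2 ^ Q) ^ c * k ^ 2`. Deterministic complete layers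
are used directly, with `W = w`; arbitrary layers pass through the subset construction, with `W = 2
^ w`. Estimating `Q` gives the two double exponentials, and a fixed set of layers is hardwired into
the program.

The machine model is handled by a small calculus, `RamComp`, of functions computed in time
polynomial in a bound `U` for the parameters and linear in the bit length `K` of the memory cells.
It is closed under bounded sums and bounded quantifiers, so programs for the automaton follow from
the shape of its defining formulas. -/

/-! ## Timed executions -/

/-- Started in `s`, the program `P` halts in `s'` after time at most `T`. -/
def RunsIn (P : RAMProgram) (s : RAMState) (T : ℕ) (s' : RAMState) : Prop :=
  ∃ t, RAMRuns P s t s' ∧ t ≤ T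

namespace RunsIn

theorem mono {P : RAMProgram} {s s' : RAMState} {T T' : ℕ} (h : RunsIn P s T s') (hT : T ≤ T') :
    RunsIn P s T' s' :=
  let ⟨t, ht, hle⟩ := h; ⟨t, ht, hle.trans hT⟩

theorem seq {P Q : RAMProgram} {s s' s'' : RAMState} {T T' : ℕ} (h : RunsIn P s T s')
    (h' : RunsIn Q s' T' s'') : RunsIn (.seq P Q) s (T + T') s'' :=
  let ⟨_, ht, hle⟩ := h; let ⟨_, ht', hle'⟩ := h'
  ⟨_, .seq _ _ _ _ _ _ _ ht ht', Nat.add_le_add hle hle'⟩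

theorem const (i c : ℕ) (s : RAMState) : RunsIn (.const i c) s (1 + c.size) (s.setReg i c) :=
  ⟨_, .const _ _ _, le_rfl⟩

theorem copy (i j : ℕ) (s : RAMState) :
    RunsIn (.copy i j) s (1 + (s.reg j).size) (s.setReg i (s.reg j)) :=
  ⟨_, .copy _ _ _, le_rfl⟩

theorem add (i j l : ℕ) (s : RAMState) :
    RunsIn (.add i j l) s (1 + (s.reg j).size + (s.reg l).size)
      (s.setReg i (s.reg j + s.reg l)) :=
  ⟨_, .add _ _ _ _, le_rfl⟩

theorem sub (i j l : ℕ) (s : RAMState) :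
    RunsIn (.sub i j l) s (1 + (s.reg j).size + (s.reg l).size)
      (s.setReg i (s.reg j - s.reg l)) :=
  ⟨_, .sub _ _ _ _, le_rfl⟩

theorem half (i j : ℕ) (s : RAMState) :
    RunsIn (.half i j) s (1 + (s.reg j).size) (s.setReg i (s.reg j / 2)) :=
  ⟨_, .half _ _ _, le_rfl⟩

theorem load (i j : ℕ) (s : RAMState) :
    RunsIn (.load i j) s (1 + (s.reg j).size + (s.mem (s.reg j)).size)
      (s.setReg i (s.mem (s.reg j))) :=
  ⟨_, .load _ _ _, le_rfl⟩

theorem store (i j : ℕ) (s : RAMState) :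
    RunsIn (.store i j) s (1 + (s.reg i).size + (s.reg j).size)
      (s.setMem (s.reg i) (s.reg j)) :=
  ⟨_, .store _ _ _, le_rfl⟩

theorem cond_true {i : ℕ} {P Q : RAMProgram} {s s' : RAMState} {T : ℕ} (hi : s.reg i ≠ 0)
    (h : RunsIn P s T s') : RunsIn (.cond i P Q) s (1 + (s.reg i).size + T) s' :=
  let ⟨_, ht, hle⟩ := h
  ⟨_, .cond_true _ _ _ _ _ _ hi ht, Nat.add_le_add_left hle _⟩

theorem cond_false {i : ℕ} {P Q : RAMProgram} {s s' : RAMState} {T : ℕ} (hi : s.reg i = 0)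
    (h : RunsIn Q s T s') : RunsIn (.cond i P Q) s (1 + T) s' :=
  let ⟨_, ht, hle⟩ := h
  ⟨_, .cond_false _ _ _ _ _ _ hi ht, Nat.add_le_add_left hle _⟩

/-- A loop whose body decreases the loop register by one. -/
theorem countdown {r : ℕ} {P : RAMProgram} (Inv : ℕ → RAMState → Prop) {T N : ℕ}
    (hreg : ∀ j s, Inv j s → s.reg r = j)
    (hbody : ∀ j < N, ∀ s, Inv (j + 1) s → ∃ s', RunsIn P s T s' ∧ Inv j s') :
    ∀ j ≤ N, ∀ s, Inv j s →
      ∃ s', RunsIn (.loop r P) s (j * (T + N.size + 1) + 1) s' ∧ Inv 0 s' := by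
  intro j
  induction j with
  | zero =>
    intro _ s hs
    exact ⟨s, ⟨1, .loop_false _ _ _ (hreg _ _ hs), by omega⟩, hs⟩
  | succ j ih =>
    intro hj s hs
    obtain ⟨s₁, ⟨t₁, hr₁, ht₁⟩, hs₁⟩ := hbody j (by omega) s hs
    obtain ⟨s₂, ⟨t₂, hr₂, ht₂⟩, hs₂⟩ := ih (by omega) s₁ hs₁
    have hs' := hreg _ _ hs
    have hsz : (s.reg r).size ≤ N.size := Nat.size_le_size (by omega)
    refine ⟨s₂, ⟨_, .loop_true _ _ _ _ _ _ _ (by omega) hr₁ hr₂, ?_⟩, hs₂⟩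
    rw [Nat.succ_mul]
    omega

end RunsIn

@[simp] theorem RAMState.setReg_reg (s : RAMState) (i v j : ℕ) :
    (s.setReg i v).reg j = if j = i then v else s.reg j := by
  simp [RAMState.setReg, Function.update_apply]

@[simp] theorem RAMState.setReg_mem (s : RAMState) (i v : ℕ) : (s.setReg i v).mem = s.mem := rfl

@[simp] theorem RAMState.setMem_reg (s : RAMState) (a v : ℕ) : (s.setMem a v).reg = s.reg := rfl

@[simp] theorem RAMState.setMem_mem (s : RAMState) (a v b : ℕ) :
    (s.setMem a v).mem b = if b = a then v else s.mem b := by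
  simp [RAMState.setMem, Function.update_apply]

/-! ## Functions computed by programs in time polynomial in the values of the arguments -/

/-- Prepending a value to an environment. -/
def envCons (x : ℕ) (σ : ℕ → ℕ) : ℕ → ℕ
  | 0 => x
  | i + 1 => σ i

/-- Dropping the first value of an environment. -/
abbrev envTail (σ : ℕ → ℕ) : ℕ → ℕ := fun i => σ (i + 1)

/-- The function `f` of the memory and of an environment is computed by a program that leaves the
memory unchanged. The program is given uniformly in the registers `ρ` that hold the environment and
in a number `d` such that the registers below `d` are preserved and the result is written to register
`d`. If the environment is bounded by `U` and the memory by `2 ^ K`, then the time is at most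
`U ^ c * (κ * K + 1)` and the result is at most `U ^ c * 2 ^ (κ * K)`. -/
def RamComp (κ : ℕ) (f : (ℕ → ℕ) → (ℕ → ℕ) → ℕ) : Prop :=
  ∃ (C : (ℕ → ℕ) → ℕ → RAMProgram) (c : ℕ), ∀ (ρ : ℕ → ℕ) (d : ℕ) (s : RAMState) (U K : ℕ),
    (∀ i, ρ i < d) → 2 ≤ U → (∀ i, s.reg (ρ i) ≤ U) → (∀ a, s.mem a ≤ 2 ^ K) →
      f s.mem (s.reg ∘ ρ) ≤ U ^ c * 2 ^ (κ * K) ∧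
      ∃ s', RunsIn (C ρ d) s (U ^ c * (κ * K + 1)) s' ∧ s'.mem = s.mem ∧
        (∀ j < d, s'.reg j = s.reg j) ∧ s'.reg d = f s.mem (s.reg ∘ ρ)

/-- A predicate whose characteristic function is represented. -/
def RamPred (κ : ℕ) (p : (ℕ → ℕ) → (ℕ → ℕ) → Prop) : Prop :=
  RamComp κ fun m σ => propBit (p m σ)

/-- Since `U ^ c < 2 ^ U ^ c`, such a number has at most `U ^ c + K` bits. Thus bounds on values
turn into bounds on costs of the same shape as the running times. -/
theorem size_le_of_le_mul_two_pow {v U c K : ℕ} (hU : 2 ≤ U) (h : v ≤ U ^ c * 2 ^ K) :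
    v.size ≤ U ^ c * (K + 1) := by
  have h1 : 1 ≤ U ^ c := Nat.one_le_pow _ _ (by omega)
  rw [Nat.size_le]
  calc v ≤ U ^ c * 2 ^ K := h
    _ < 2 ^ U ^ c * 2 ^ K := Nat.mul_lt_mul_of_pos_right Nat.lt_two_pow_self (by positivity)
    _ = 2 ^ (U ^ c + K) := (pow_add _ _ _).symm
    _ ≤ 2 ^ (U ^ c * (K + 1)) := Nat.pow_le_pow_right (by norm_num) (by nlinarith)

theorem comp_reg_eq {s s' : RAMState} {ρ : ℕ → ℕ} {d : ℕ} (hρ : ∀ i, ρ i < d)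
    (h : ∀ j < d, s'.reg j = s.reg j) : s'.reg ∘ ρ = s.reg ∘ ρ :=
  funext fun i => h _ (hρ i)

theorem pow_mul_le_pow_mul {U a b X : ℕ} (hU : 2 ≤ U) (h : a ≤ b) : U ^ a * X ≤ U ^ b * X :=
  Nat.mul_le_mul_right _ (Nat.pow_le_pow_right (by omega) h)

/-- Because `U ≥ 2`, constant factors are absorbed by a larger exponent; all bounds therefore keep
the form `U ^ c * X`. -/
theorem mul_le_pow_add_mul {U c X n e : ℕ} (hU : 2 ≤ U) (hn : n ≤ 2 ^ e) :
    n * (U ^ c * X) ≤ U ^ (c + e) * X := by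
  calc n * (U ^ c * X) ≤ 2 ^ e * (U ^ c * X) := Nat.mul_le_mul_right _ hn
    _ ≤ U ^ e * (U ^ c * X) := Nat.mul_le_mul_right _ (Nat.pow_le_pow_left hU _)
    _ = U ^ (c + e) * X := by ring

namespace RamComp

variable {κ : ℕ} {f g h : (ℕ → ℕ) → (ℕ → ℕ) → ℕ}

theorem of_eq (hf : RamComp κ f) (e : ∀ m σ, f m σ = g m σ) : RamComp κ g :=
  (funext fun m => funext fun σ => e m σ : f = g) ▸ hf

/-- `κ = 0` marks values and times polynomial in `U` whatever the memory contains. Such functions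
may serve as addresses, loop bounds and left factors, and they are weakened to any `κ` when combined
with memory contents. -/
theorem of_zero (hf : RamComp 0 f) : RamComp κ f := by
  obtain ⟨C, c, hC⟩ := hf
  refine ⟨C, c, fun ρ d s U K hρ hU hs hm => ?_⟩
  obtain ⟨hv, s', hr, h⟩ := hC ρ d s U K hρ hU hs hm
  refine ⟨hv.trans ?_, s', hr.mono ?_, h⟩
  · exact Nat.mul_le_mul_left _ (Nat.pow_le_pow_right (by norm_num) (by simp))
  · exact Nat.mul_le_mul_left _ (by simp)

theorem const (n : ℕ) : RamComp κ fun _ _ => n := by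
  refine of_zero ⟨fun _ d => .const d n, n + 1, fun ρ d s U K hρ hU hs hm => ?_⟩
  -- The exponent comes from `n + 1 ≤ 2 ^ (n + 1)`.
  have h1 : n + 1 ≤ U ^ (n + 1) :=
    (Nat.lt_two_pow_self (n := n + 1)).le.trans (Nat.pow_le_pow_left hU _)
  refine ⟨by simp; omega, _, (RunsIn.const _ _ _).mono ?_, rfl, ?_, ?_⟩
  · have : n.size ≤ n := Nat.size_le.2 Nat.lt_two_pow_self
    simp; omega
  · intro j hj
    simp [hj.ne]
  · simp

theorem var (i : ℕ) : RamComp κ fun _ σ => σ i := by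
  refine of_zero ⟨fun ρ d => .copy d (ρ i), 2, fun ρ d s U K hρ hU hs hm => ?_⟩
  have h1 : s.reg (ρ i) ≤ U ^ 1 * 2 ^ 0 := by simpa using hs i
  have h2 := size_le_of_le_mul_two_pow hU h1
  simp only [pow_one, zero_add, mul_one] at h2
  refine ⟨by simp; nlinarith [hs i], _, (RunsIn.copy _ _ _).mono ?_, rfl, ?_, ?_⟩
  · simp; nlinarith [hs i]
  · intro j hj
    simp [hj.ne]
  · simp

/-- No data are moved: the same program is used with a shifted assignment of registers. -/
theorem tail (hf : RamComp κ f) : RamComp κ fun m σ => f m (envTail σ) := by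
  obtain ⟨C, c, hC⟩ := hf
  refine ⟨fun ρ d => C (envTail ρ) d, c, fun ρ d s U K hρ hU hs hm => ?_⟩
  exact hC (envTail ρ) d s U K (fun i => hρ _) hU (fun i => hs _) hm

/-- Evaluating two functions one after the other. -/
theorem exists_pair (hf : RamComp κ f) (hg : RamComp κ g) :
    ∃ (C : (ℕ → ℕ) → ℕ → RAMProgram) (c : ℕ), ∀ (ρ : ℕ → ℕ) (d : ℕ) (s : RAMState) (U K : ℕ),
    (∀ i, ρ i < d) → 2 ≤ U → (∀ i, s.reg (ρ i) ≤ U) → (∀ a, s.mem a ≤ 2 ^ K) →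
      f s.mem (s.reg ∘ ρ) ≤ U ^ c * 2 ^ (κ * K) ∧ g s.mem (s.reg ∘ ρ) ≤ U ^ c * 2 ^ (κ * K) ∧
      ∃ s', RunsIn (C ρ d) s (U ^ c * (κ * K + 1)) s' ∧ s'.mem = s.mem ∧
        (∀ j < d, s'.reg j = s.reg j) ∧ s'.reg d = f s.mem (s.reg ∘ ρ) ∧
        s'.reg (d + 1) = g s.mem (s.reg ∘ ρ) := by
  obtain ⟨F, cf, hF⟩ := hf
  obtain ⟨G, cg, hG⟩ := hg
  refine ⟨fun ρ d => .seq (F ρ d) (G ρ (d + 1)), cf + cg + 1,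
    fun ρ d s U K hρ hU hs hm => ?_⟩
  obtain ⟨hvf, s₁, hr₁, hm₁, hj₁, hd₁⟩ := hF ρ d s U K hρ hU hs hm
  have e₁ := comp_reg_eq hρ hj₁
  obtain ⟨hvg, s₂, hr₂, hm₂, hj₂, hd₂⟩ := hG ρ (d + 1) s₁ U K (fun i => (hρ i).trans d.lt_succ_self)
    hU (fun i => by rw [hj₁ _ (hρ i)]; exact hs i) (by rwa [hm₁])
  rw [hm₁, e₁] at hvg hd₂
  refine ⟨hvf.trans (pow_mul_le_pow_mul hU (by omega)), hvg.trans (pow_mul_le_pow_mul hU (by omega)),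
    s₂, (hr₁.seq hr₂).mono ?_, hm₂.trans hm₁, fun j hj => ?_, ?_, hd₂⟩
  · have h1 := pow_mul_le_pow_mul (X := κ * K + 1) hU (show cf ≤ cf + cg by omega)
    have h2 := pow_mul_le_pow_mul (X := κ * K + 1) hU (show cg ≤ cf + cg by omega)
    have h3 := mul_le_pow_add_mul (c := cf + cg) (X := κ * K + 1) (n := 2) (e := 1) hU (by norm_num)
    omega
  · rw [hj₂ _ (by omega), hj₁ _ hj]
  · rw [hj₂ _ (by omega), hd₁]

theorem add (hf : RamComp κ f) (hg : RamComp κ g) : RamComp κ fun m σ => f m σ + g m σ := by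
  obtain ⟨C, c, hC⟩ := exists_pair hf hg
  refine ⟨fun ρ d => .seq (C ρ d) (.add d d (d + 1)), c + 2, fun ρ d s U K hρ hU hs hm => ?_⟩
  obtain ⟨hf, hg, s', hr, hm', hj, hd, hd'⟩ := hC ρ d s U K hρ hU hs hm
  refine ⟨?_, _, (hr.seq (RunsIn.add _ _ _ _)).mono ?_, hm', fun j hj' => ?_, ?_⟩
  · have := mul_le_pow_add_mul (c := c) (X := 2 ^ (κ * K)) (n := 2) (e := 2) hU (by norm_num)
    dsimp only
    omega
  · have h1 := size_le_of_le_mul_two_pow hU hf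
    have h2 := size_le_of_le_mul_two_pow hU hg
    have h3 := mul_le_pow_add_mul (c := c) (X := κ * K + 1) (n := 4) (e := 2) hU (by norm_num)
    have h4 : 1 ≤ U ^ c * (κ * K + 1) := Nat.mul_pos (Nat.pow_pos (by omega)) (by omega)
    rw [hd, hd']
    omega
  · simp [hj'.ne, hj j hj']
  · simp [hd, hd']

theorem sub (hf : RamComp κ f) (hg : RamComp κ g) : RamComp κ fun m σ => f m σ - g m σ := by
  obtain ⟨C, c, hC⟩ := exists_pair hf hg
  refine ⟨fun ρ d => .seq (C ρ d) (.sub d d (d + 1)), c + 2, fun ρ d s U K hρ hU hs hm => ?_⟩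
  obtain ⟨hf, hg, s', hr, hm', hj, hd, hd'⟩ := hC ρ d s U K hρ hU hs hm
  refine ⟨?_, _, (hr.seq (RunsIn.sub _ _ _ _)).mono ?_, hm', fun j hj' => ?_, ?_⟩
  · have := pow_mul_le_pow_mul (X := 2 ^ (κ * K)) hU (show c ≤ c + 2 by omega)
    dsimp only
    omega
  · have h1 := size_le_of_le_mul_two_pow hU hf
    have h2 := size_le_of_le_mul_two_pow hU hg
    have h3 := mul_le_pow_add_mul (c := c) (X := κ * K + 1) (n := 4) (e := 2) hU (by norm_num)
    have h4 : 1 ≤ U ^ c * (κ * K + 1) := Nat.mul_pos (Nat.pow_pos (by omega)) (by omega)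
    rw [hd, hd']
    omega
  · simp [hj'.ne, hj j hj']
  · simp [hd, hd']

/-- The address has polynomial size, and the content contributes the `K` bits that `κ = 1` allows
for. -/
theorem read (hf : RamComp 0 f) : RamComp 1 fun m σ => m (f m σ) := by
  obtain ⟨C, c, hC⟩ := hf
  refine ⟨fun ρ d => .seq (C ρ d) (.load d d), c + 2, fun ρ d s U K hρ hU hs hm => ?_⟩
  obtain ⟨hf, s', hr, hm', hj, hd⟩ := hC ρ d s U K hρ hU hs hm
  rw [zero_mul] at hf hr
  refine ⟨?_, _, (hr.seq (RunsIn.load _ _ _)).mono ?_, hm', fun j hj' => ?_, ?_⟩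
  · exact (hm _).trans (by rw [one_mul]; exact Nat.le_mul_of_pos_left _ (Nat.pow_pos (by omega)))
  · have h1 := size_le_of_le_mul_two_pow hU hf
    have h2 := size_le_of_le_mul_two_pow (c := 0) hU
      (show s.mem (f s.mem (s.reg ∘ ρ)) ≤ U ^ 0 * 2 ^ K by simpa using hm _)
    have h3 := mul_le_pow_add_mul (c := c) (X := K + 1) (n := 4) (e := 2) hU (by norm_num)
    have h4 : 1 ≤ U ^ c := Nat.pow_pos (by omega)
    rw [hd, hm', one_mul]
    simp only [zero_add, mul_one, pow_zero, one_mul] at *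
    nlinarith
  · simp [hj'.ne, hj j hj']
  · simp [hd, hm']

theorem ite_ne_zero (hf : RamComp κ f) (hg : RamComp κ g) (hh : RamComp κ h) :
    RamComp κ fun m σ => if f m σ ≠ 0 then g m σ else h m σ := by
  obtain ⟨F, cf, hF⟩ := hf
  obtain ⟨G, cg, hG⟩ := hg
  obtain ⟨H, ch, hH⟩ := hh
  refine ⟨fun ρ d => .seq (F ρ d) (.cond d (G ρ d) (H ρ d)), cf + cg + ch + 3,
    fun ρ d s U K hρ hU hs hm => ?_⟩
  obtain ⟨hvf, s₁, hr₁, hm₁, hj₁, hd₁⟩ := hF ρ d s U K hρ hU hs hm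
  have e₁ := comp_reg_eq hρ hj₁
  have hs₁ : ∀ i, s₁.reg (ρ i) ≤ U := fun i => by rw [hj₁ _ (hρ i)]; exact hs i
  obtain ⟨hvg, s₂, hr₂, hm₂, hj₂, hd₂⟩ := hG ρ d s₁ U K hρ hU hs₁ (by rwa [hm₁])
  obtain ⟨hvh, s₃, hr₃, hm₃, hj₃, hd₃⟩ := hH ρ d s₁ U K hρ hU hs₁ (by rwa [hm₁])
  rw [hm₁, e₁] at hvg hd₂ hvh hd₃
  have h0 := size_le_of_le_mul_two_pow hU hvf
  have h1 := pow_mul_le_pow_mul (X := κ * K + 1) hU (show cf ≤ cf + cg + ch by omega)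
  have h2 := pow_mul_le_pow_mul (X := κ * K + 1) hU (show cg ≤ cf + cg + ch by omega)
  have h3 := pow_mul_le_pow_mul (X := κ * K + 1) hU (show ch ≤ cf + cg + ch by omega)
  have h4 := mul_le_pow_add_mul (c := cf + cg + ch) (X := κ * K + 1) (n := 4) (e := 3) hU
    (by norm_num)
  have h5 : 1 ≤ U ^ cf * (κ * K + 1) := Nat.mul_pos (Nat.pow_pos (by omega)) (by omega)
  by_cases hc : f s.mem (s.reg ∘ ρ) = 0
  · simp only [hc, ne_eq, not_true_eq_false, if_false]
    refine ⟨hvh.trans (pow_mul_le_pow_mul hU (by omega)), s₃,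
      (hr₁.seq (RunsIn.cond_false (hd₁.trans hc) hr₃)).mono ?_, hm₃.trans hm₁,
      fun j hj => (hj₃ j hj).trans (hj₁ j hj), hd₃⟩
    omega
  · simp only [hc, ne_eq, not_false_eq_true, if_true]
    refine ⟨hvg.trans (pow_mul_le_pow_mul hU (by omega)), s₂,
      (hr₁.seq (RunsIn.cond_true (by rwa [hd₁]) hr₂)).mono ?_, hm₂.trans hm₁,
      fun j hj => (hj₂ j hj).trans (hj₁ j hj), hd₂⟩
    rw [hd₁]
    omega

/-- Bounded sums. -/
theorem sum {b : (ℕ → ℕ) → (ℕ → ℕ) → ℕ} {F : (ℕ → ℕ) → (ℕ → ℕ) → ℕ → ℕ} (hb : RamComp 0 b)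
    (hF : RamComp κ fun m σ => F m (envTail σ) (σ 0)) :
    RamComp κ fun m σ => ∑ x ∈ Finset.range (b m σ), F m σ x := by
  obtain ⟨B, cb, hB⟩ := hb
  obtain ⟨G, cg, hG⟩ := hF
  refine ⟨fun ρ d => .seq (B ρ d) (.seq (.const (d + 1) 0) (.seq (.loop d
    (.seq (.const (d + 2) 1) (.seq (.sub d d (d + 2)) (.seq (G (envCons d ρ) (d + 2))
      (.add (d + 1) (d + 1) (d + 2)))))) (.copy d (d + 1)))), cb + (cb + (cb + 1) * cg) + 5,
    fun ρ d s U K hρ hU hs hm => ?_⟩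
  obtain ⟨hvb, s₁, hr₁, hm₁, hj₁, hd₁⟩ := hB ρ d s U K hρ hU hs hm
  set N := b s.mem (s.reg ∘ ρ) with hN
  set σ := s.reg ∘ ρ with hσ
  set X := κ * K + 1 with hX
  set c₀ := cb + (cb + 1) * cg with hc₀
  simp only [zero_mul, pow_zero, mul_one] at hvb hr₁
  have hUpos : 0 < U := by omega
  -- The summation index is bounded only by `U ^ cb`, so the summand is evaluated with the
  -- environment bound `U ^ (cb + 1)`; this turns its exponent `cg` into `(cb + 1) * cg`.
  have hU' : 2 ≤ U ^ (cb + 1) := hU.trans (Nat.le_self_pow (by omega) _)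
  have hpow : (U ^ (cb + 1)) ^ cg = U ^ ((cb + 1) * cg) := (pow_mul _ _ _).symm
  have hbody : ∀ s' : RAMState, (∀ j < d, s'.reg j = s.reg j) → s'.mem = s.mem → s'.reg d < N →
      F s.mem σ (s'.reg d) ≤ U ^ ((cb + 1) * cg) * 2 ^ (κ * K) ∧
      ∃ s'', RunsIn (G (envCons d ρ) (d + 2)) s' (U ^ ((cb + 1) * cg) * X) s'' ∧
        s''.mem = s.mem ∧ (∀ j < d + 2, s''.reg j = s'.reg j) ∧
        s''.reg (d + 2) = F s.mem σ (s'.reg d) := by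
    intro s' h1 h2 h3
    have hle : ∀ i, s'.reg (envCons d ρ i) ≤ U ^ (cb + 1) := by
      rintro (_ | i)
      · exact h3.le.trans (hvb.trans (Nat.pow_le_pow_right hUpos (by omega)))
      · show s'.reg (ρ i) ≤ _
        rw [h1 _ (hρ i)]
        exact (hs i).trans (Nat.le_self_pow (by omega) _)
    have h := hG (envCons d ρ) (d + 2) s' (U ^ (cb + 1)) K
      (by rintro (_ | i); exacts [by simp [envCons], (hρ i).trans (by omega)]) hU' hle (by rwa [h2])
    have e : envTail (s'.reg ∘ envCons d ρ) = σ := comp_reg_eq hρ h1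
    have e0 : (s'.reg ∘ envCons d ρ) 0 = s'.reg d := rfl
    simpa only [h2, e, e0, hpow] using h
  have hsum : ∀ j ≤ N, ∑ x ∈ Finset.Ico j N, F s.mem σ x ≤ U ^ c₀ * 2 ^ (κ * K) := by
    intro j _
    calc ∑ x ∈ Finset.Ico j N, F s.mem σ x
        ≤ ∑ x ∈ Finset.Ico j N, U ^ ((cb + 1) * cg) * 2 ^ (κ * K) := by
          refine Finset.sum_le_sum fun x hx => ?_
          -- The bound for a summand is part of a statement about machine states, so a state with
          -- the index in register `d` is supplied.
          have := (hbody (s.setReg d x) (fun j hj => by simp [hj.ne]) rfl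
            (by simpa using (Finset.mem_Ico.1 hx).2)).1
          simpa using this
      _ ≤ N * (U ^ ((cb + 1) * cg) * 2 ^ (κ * K)) := by
          rw [Finset.sum_const, smul_eq_mul, Nat.card_Ico]
          exact Nat.mul_le_mul_right _ (by omega)
      _ ≤ U ^ cb * (U ^ ((cb + 1) * cg) * 2 ^ (κ * K)) := Nat.mul_le_mul_right _ hvb
      _ = _ := by rw [hc₀, pow_add]; ring
  have hXpos : 1 ≤ X := by omega
  have hone : 1 ≤ U ^ c₀ * X := Nat.mul_pos (Nat.pow_pos hUpos) hXpos
  have hsizeN : N.size ≤ U ^ c₀ * X := by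
    have := size_le_of_le_mul_two_pow (K := 0) hU (show N ≤ U ^ cb * 2 ^ 0 by simpa using hvb)
    calc N.size ≤ U ^ cb := by simpa using this
      _ ≤ U ^ c₀ := Nat.pow_le_pow_right hUpos (by omega)
      _ ≤ U ^ c₀ * X := Nat.le_mul_of_pos_right _ hXpos
  -- Register `d` is both the loop counter and, after its decrement, the summation index; the terms
  -- are added from the top.
  let Inv : ℕ → RAMState → Prop := fun j s' => (∀ j < d, s'.reg j = s.reg j) ∧ s'.mem = s.mem ∧
    s'.reg d = j ∧ s'.reg (d + 1) = ∑ x ∈ Finset.Ico j N, F s.mem σ x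
  have hloop := RunsIn.countdown (r := d) (P := .seq (.const (d + 2) 1) (.seq (.sub d d (d + 2))
    (.seq (G (envCons d ρ) (d + 2)) (.add (d + 1) (d + 1) (d + 2))))) Inv
    (T := 10 * (U ^ c₀ * X)) (N := N) (fun j s h => h.2.2.1) ?_ N le_rfl (s₁.setReg (d + 1) 0) ?_
  · obtain ⟨s₃, hr₃, hj₃, hm₃, hd₃, hd₃'⟩ := hloop
    rw [Nat.Ico_zero_eq_range] at hd₃'
    have hv := hsum 0 (by omega)
    rw [Nat.Ico_zero_eq_range] at hv
    refine ⟨hv.trans (pow_mul_le_pow_mul hU (by omega)), _,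
      (hr₁.seq ((RunsIn.const _ _ _).seq (hr₃.seq (RunsIn.copy _ _ _)))).mono ?_, hm₃,
      fun j hj => by simp [hj.ne, hj₃ j hj], by simp [hd₃', hN]⟩
    have h1 := size_le_of_le_mul_two_pow hU hv
    rw [hd₃']
    rw [← hX] at h1
    have h2 : N * (10 * (U ^ c₀ * X) + N.size + 1) ≤ 12 * (U ^ (cb + c₀) * X) := by
      calc N * (10 * (U ^ c₀ * X) + N.size + 1) ≤ U ^ cb * (12 * (U ^ c₀ * X)) :=
            Nat.mul_le_mul hvb (by omega)
        _ = _ := by rw [pow_add]; ring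
    have h3 := pow_mul_le_pow_mul (X := X) hU (show c₀ ≤ cb + c₀ by omega)
    have h4 : U ^ cb ≤ U ^ (cb + c₀) * X :=
      (Nat.pow_le_pow_right hUpos (by omega)).trans (Nat.le_mul_of_pos_right _ hXpos)
    have h5 := mul_le_pow_add_mul (c := cb + c₀) (X := X) (n := 32) (e := 5) hU (by norm_num)
    simp only [Nat.size_zero]
    omega
  · rintro j hj s' ⟨h1, h2, h3, h4⟩
    set s₂ := (s'.setReg (d + 2) 1).setReg d
      ((s'.setReg (d + 2) 1).reg d - (s'.setReg (d + 2) 1).reg (d + 2)) with hs₂e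
    have hd₂ : s₂.reg d = j := by simp [hs₂e, h3]
    have hd₂' : s₂.reg (d + 1) = s'.reg (d + 1) := by simp [hs₂e]
    obtain ⟨hv, s₃, hr₃, hm₃, hj₃, hd₃⟩ := hbody s₂
      (fun i hi => by simp [hs₂e, hi.ne, (show i ≠ d + 2 by omega), h1 i hi]) h2 (by omega)
    refine ⟨_, ((RunsIn.const _ _ _).seq ((RunsIn.sub _ _ _ _).seq (hr₃.seq (RunsIn.add _ _ _ _)))).mono ?_, ?_⟩
    · have := hsum (j + 1) (by omega)
      rw [hj₃ _ (by omega), hd₃, hd₂', hd₂, h4]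
      have k1 := size_le_of_le_mul_two_pow hU this
      have k2 := pow_mul_le_pow_mul (X := X) hU (show (cb + 1) * cg ≤ c₀ by omega)
      rw [hd₂] at hv
      have k3 := size_le_of_le_mul_two_pow hU hv
      have k4 : (j + 1).size ≤ N.size := Nat.size_le_size (by omega)
      rw [← hX] at k1 k3
      simp [h3]
      omega
    · refine ⟨fun i hi => ?_, hm₃, ?_, ?_⟩
      · simp [hs₂e, hi.ne, (show i ≠ d + 2 by omega), (show i ≠ d + 1 by omega),
          hj₃ i (by omega), h1 i hi]
      · simp [hj₃ d (by omega), hd₂]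
      · simp [hj₃ (d + 1) (by omega), hd₃, hd₂, hd₂', h4,
          Finset.sum_eq_sum_Ico_succ_bot (show j < N by omega), Nat.add_comm]
  · exact ⟨fun j hj => by simp [(show j ≠ d + 1 by omega), hj₁ j hj], hm₁, by simp [hd₁], by simp⟩

/-- Multiplication is repeated addition of `g`, which is affordable because the number `f` of
summands is polynomially bounded. -/
theorem mul (hf : RamComp 0 f) (hg : RamComp κ g) : RamComp κ fun m σ => f m σ * g m σ :=
  (sum (F := fun m σ _ => g m σ) hf hg.tail).of_eq fun m σ => by simp

end RamComp

/-! ### Predicates: connectives, bounded quantifiers and bit tests -/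

theorem propBit_of_true {p : Prop} (h : p) : propBit p = 1 := by simp [propBit, h]

theorem propBit_ne_zero {p : Prop} : propBit p ≠ 0 ↔ p := by
  by_cases h : p <;> simp [propBit, h]

theorem propBit_le_one (p : Prop) : propBit p ≤ 1 := by
  by_cases h : p <;> simp [propBit, h]

theorem RamComp.ite {κ : ℕ} {p : (ℕ → ℕ) → (ℕ → ℕ) → Prop} [∀ m σ, Decidable (p m σ)]
    {f g : (ℕ → ℕ) → (ℕ → ℕ) → ℕ}
    (hp : RamPred κ p) (hf : RamComp κ f) (hg : RamComp κ g) :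
    RamComp κ fun m σ => if p m σ then f m σ else g m σ :=
  (RamComp.ite_ne_zero hp hf hg).of_eq fun m σ => by simp only [propBit_ne_zero]

namespace RamPred

variable {κ : ℕ} {f g : (ℕ → ℕ) → (ℕ → ℕ) → ℕ} {p q : (ℕ → ℕ) → (ℕ → ℕ) → Prop}

theorem of_iff (hp : RamPred κ p) (h : ∀ m σ, p m σ ↔ q m σ) : RamPred κ q :=
  RamComp.of_eq hp fun m σ => by rw [propext (h m σ)]

theorem of_zero (hp : RamPred 0 p) : RamPred κ p := RamComp.of_zero hp

theorem ne_zero (hf : RamComp κ f) : RamPred κ fun m σ => f m σ ≠ 0 :=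
  (hf.ite_ne_zero (.const 1) (.const 0)).of_eq fun m σ => by simp [propBit]

theorem not (hp : RamPred κ p) : RamPred κ fun m σ => ¬p m σ :=
  (RamComp.sub (.const 1) hp).of_eq fun m σ => by by_cases h : p m σ <;> simp [propBit, h]

theorem and (hp : RamPred κ p) (hq : RamPred κ q) : RamPred κ fun m σ => p m σ ∧ q m σ :=
  by
  classical
  exact (RamComp.ite hp hq (.const 0)).of_eq fun m σ => by by_cases h : p m σ <;> simp [propBit, h]

theorem imp (hp : RamPred κ p) (hq : RamPred κ q) : RamPred κ fun m σ => p m σ → q m σ :=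
  (hp.and hq.not).not.of_iff fun m σ => by tauto

theorem or (hp : RamPred κ p) (hq : RamPred κ q) : RamPred κ fun m σ => p m σ ∨ q m σ :=
  (hp.not.imp hq).of_iff fun m σ => by tauto

theorem iff (hp : RamPred κ p) (hq : RamPred κ q) : RamPred κ fun m σ => (p m σ ↔ q m σ) :=
  ((hp.imp hq).and (hq.imp hp)).of_iff fun m σ => by tauto

theorem lt (hf : RamComp κ f) (hg : RamComp κ g) : RamPred κ fun m σ => f m σ < g m σ :=
  (ne_zero (hg.sub hf)).of_iff fun m σ => by omega

theorem le (hf : RamComp κ f) (hg : RamComp κ g) : RamPred κ fun m σ => f m σ ≤ g m σ :=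
  (lt hg hf).not.of_iff fun m σ => by omega

theorem eq (hf : RamComp κ f) (hg : RamComp κ g) : RamPred κ fun m σ => f m σ = g m σ :=
  ((le hf hg).and (le hg hf)).of_iff fun m σ => by omega

/-- A bounded search is a bounded sum of bits that is tested for being nonzero. -/
theorem exists_lt {P : (ℕ → ℕ) → (ℕ → ℕ) → ℕ → Prop} (hf : RamComp 0 f)
    (hP : RamPred κ fun m σ => P m (envTail σ) (σ 0)) :
    RamPred κ fun m σ => ∃ x < f m σ, P m σ x :=
  (ne_zero (RamComp.sum (F := fun m σ x => propBit (P m σ x)) hf hP)).of_iff fun m σ => by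
    simp only [ne_eq, Finset.sum_eq_zero_iff, not_forall, Finset.mem_range, exists_prop]
    simp only [← ne_eq, propBit_ne_zero]

theorem forall_lt {P : (ℕ → ℕ) → (ℕ → ℕ) → ℕ → Prop} (hf : RamComp 0 f)
    (hP : RamPred κ fun m σ => P m (envTail σ) (σ 0)) :
    RamPred κ fun m σ => ∀ x < f m σ, P m σ x :=
  (exists_lt (P := fun m σ x => ¬P m σ x) hf hP.not).not.of_iff fun m σ => by
    simp

/-- Halving `g` times brings the bit in question to the lowest place, and `y - 2 * (y / 2)` isolates
it. -/
theorem testBit (hf : RamComp 0 f) (hg : RamComp 0 g) :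
    RamPred 0 fun m σ => (f m σ).testBit (g m σ) := by
  obtain ⟨C, c, hC⟩ := RamComp.exists_pair hf hg
  refine ⟨fun ρ d => .seq (C ρ d) (.seq (.loop (d + 1)
    (.seq (.const (d + 2) 1) (.seq (.sub (d + 1) (d + 1) (d + 2)) (.half d d))))
    (.seq (.half (d + 1) d) (.seq (.add (d + 1) (d + 1) (d + 1)) (.sub d d (d + 1))))),
    c + c + 5, fun ρ d s U K hρ hU hs hm => ?_⟩
  obtain ⟨hf, hg, s₁, hr₁, hm₁, hj₁, hd₁, hd₁'⟩ := hC ρ d s U K hρ hU hs hm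
  simp only [zero_mul, pow_zero, mul_one, zero_add] at hf hg hr₁ ⊢
  set F := f s.mem (s.reg ∘ ρ)
  set G := g s.mem (s.reg ∘ ρ)
  have hsz : ∀ x ≤ U ^ c, x.size ≤ U ^ c := fun x hx => by
    simpa using size_le_of_le_mul_two_pow (K := 0) hU (show x ≤ U ^ c * 2 ^ 0 by simpa using hx)
  have hone : 1 ≤ U ^ c := Nat.pow_pos (by omega)
  have hpow : 2 ^ 5 * (U ^ c * U ^ c) ≤ U ^ (c + c + 5) := by
    rw [pow_add, pow_add, Nat.mul_comm]
    exact Nat.mul_le_mul_left _ (Nat.pow_le_pow_left hU _)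
  have hcc : U ^ c ≤ U ^ c * U ^ c := Nat.le_mul_of_pos_right _ hone
  let Inv : ℕ → RAMState → Prop := fun j s' => (∀ j < d, s'.reg j = s.reg j) ∧ s'.mem = s.mem ∧
    s'.reg (d + 1) = j ∧ s'.reg d = F / 2 ^ (G - j)
  have hloop := RunsIn.countdown (r := d + 1) (P := .seq (.const (d + 2) 1)
    (.seq (.sub (d + 1) (d + 1) (d + 2)) (.half d d))) Inv
    (T := 7 * U ^ c) (N := G) (fun j s h => h.2.2.1) ?_ G le_rfl s₁ ?_
  · obtain ⟨s₂, hr₂, hj₂, hm₂, hd₂, hd₂'⟩ := hloop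
    have hF : F / 2 ^ (G - 0) ≤ F := Nat.div_le_self _ _
    set y := F / 2 ^ (G - 0) with hy
    refine ⟨(propBit_le_one _).trans (Nat.pow_pos (by omega)), _,
      (hr₁.seq (hr₂.seq ((RunsIn.half _ _ _).seq ((RunsIn.add _ _ _ _).seq
        (RunsIn.sub _ _ _ _))))).mono ?_, hm₂, fun j hj => ?_, ?_⟩
    · have h1 : G * (7 * U ^ c + G.size + 1) ≤ U ^ c * (9 * U ^ c) :=
        Nat.mul_le_mul hg (by have := hsz G hg; omega)
      have h2 := hsz y (by omega)
      have h3 := hsz (y / 2) (by omega)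
      have h4 := hsz (y / 2 + y / 2) (by omega)
      have h5 : U ^ c * (9 * U ^ c) = 9 * (U ^ c * U ^ c) := by ring
      simp [hd₂']
      omega
    · simp [hj.ne, (show j ≠ d + 1 by omega), hj₂ j hj]
    · have : F.testBit G = decide (y % 2 = 1) := by
        rw [Nat.testBit_eq_decide_div_mod_eq]; rfl
      simp only [RAMState.setReg_reg, if_true, hd₂', this, propBit]
      simp
      split_ifs <;> omega
  · rintro j hj s' ⟨h1, h2, h3, h4⟩
    refine ⟨_, ((RunsIn.const _ _ _).seq ((RunsIn.sub _ _ _ _).seq (RunsIn.half _ _ _))).mono ?_,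
      fun i hi => ?_, h2, ?_, ?_⟩
    · have k1 := hsz (j + 1) (by omega)
      have k2 := hsz (F / 2 ^ (G - (j + 1))) ((Nat.div_le_self _ _).trans hf)
      simp [h3, h4]
      omega
    · simp [hi.ne, (show i ≠ d + 2 by omega), (show i ≠ d + 1 by omega), h1 i hi]
    · simp [h3]
    · simp [h4, Nat.div_div_eq_div_mul, ← pow_succ]
      congr 2
      omega
  · exact ⟨hj₁, hm₁, hd₁', by simp [hd₁]⟩

end RamPred

theorem RamComp.pair {f g : (ℕ → ℕ) → (ℕ → ℕ) → ℕ} (hf : RamComp 0 f) (hg : RamComp 0 g) :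
    RamComp 0 fun m σ => Nat.pair (f m σ) (g m σ) :=
  (RamComp.ite (.lt hf hg) (.add (.mul hg hg) hf) (.add (.add (.mul hf hf) hf) hg)).of_eq
    fun m σ => by simp only [Nat.pair]

theorem RamComp.pow {f : (ℕ → ℕ) → (ℕ → ℕ) → ℕ} (hf : RamComp 0 f) (e : ℕ) :
    RamComp 0 fun m σ => f m σ ^ e := by
  induction e with
  | zero => simpa using RamComp.const 1
  | succ e ih => simpa only [pow_succ] using ih.mul hf

/-- The size of `n` is the number of `x` such that some bit of `n` at a position `y ≥ x` is set.
Such a position satisfies `2 ^ y ≤ n`, so searching up to `n` suffices. -/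
theorem RamComp.size {f : (ℕ → ℕ) → (ℕ → ℕ) → ℕ} (hf : RamComp 0 f) :
    RamComp 0 fun m σ => (f m σ).size := by
  classical
  have h : RamComp 0 fun m σ => ∑ x ∈ Finset.range (f m σ + 1),
      if (∃ y < f m σ + 1, x ≤ y ∧ (f m σ).testBit y) then 1 else 0 :=
    RamComp.sum (hf.add (.const 1)) (.ite (.exists_lt (hf.tail.add (.const 1))
      (.and (.le (.var 1) (.var 0)) (.testBit hf.tail.tail (.var 0)))) (.const 1) (.const 0))
  refine h.of_eq fun m σ => ?_
  set n := f m σ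
  have key : ∀ x, (∃ y < n + 1, x ≤ y ∧ n.testBit y = true) ↔ x < n.size := by
    intro x
    constructor
    · rintro ⟨y, -, hxy, hy⟩
      exact lt_of_le_of_lt hxy (Nat.lt_size.2 (Nat.ge_two_pow_of_testBit hy))
    · intro hx
      obtain ⟨y, hy, hy'⟩ := Nat.exists_ge_and_testBit_of_ge_two_pow (Nat.lt_size.1 hx)
      exact ⟨y, (Nat.lt_two_pow_self.trans_le (Nat.ge_two_pow_of_testBit hy')).trans
        n.lt_succ_self, hy, hy'⟩
  simp only [key]
  rw [Finset.sum_ite, Finset.sum_const_zero, Finset.sum_const, smul_eq_mul, mul_one, add_zero]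
  have hle : n.size ≤ n := Nat.size_le.2 Nat.lt_two_pow_self
  rw [show (Finset.range (n + 1)).filter (· < n.size) = Finset.range n.size by
    ext x; simp; omega, Finset.card_range]

/-! ## Straight-line programs and loops over the memory -/

/-- The registers that hold the parameters: all registers below `8` except the input register `2`. -/
def envReg : ℕ → ℕ
  | 0 => 0
  | 1 => 1
  | 2 => 3
  | 3 => 4
  | 4 => 5
  | 5 => 6
  | 6 => 7
  | _ => 0

theorem envReg_lt (i : ℕ) : envReg i < 8 := by
  unfold envReg; split <;> norm_num

theorem envReg_ne_two (i : ℕ) : envReg i ≠ 2 := by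
  unfold envReg; split <;> norm_num

theorem exists_assign {κ : ℕ} {f : (ℕ → ℕ) → (ℕ → ℕ) → ℕ} (hf : RamComp κ f) (r : ℕ) :
    ∃ P c, ∀ (s : RAMState) (U K : ℕ), 2 ≤ U → (∀ i, s.reg (envReg i) ≤ U) →
      (∀ a, s.mem a ≤ 2 ^ K) → ∃ s', RunsIn P s (U ^ c * (κ * K + 1)) s' ∧ s'.mem = s.mem ∧
        (∀ j < 8, j ≠ r → s'.reg j = s.reg j) ∧ s'.reg r = f s.mem (s.reg ∘ envReg) := by
  obtain ⟨C, c, hC⟩ := hf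
  refine ⟨.seq (C envReg 8) (.copy r 8), c + 2, fun s U K hU hs hm => ?_⟩
  obtain ⟨hv, s₁, hr, hm₁, hj, hd⟩ := hC envReg 8 s U K envReg_lt hU hs hm
  refine ⟨_, (hr.seq (RunsIn.copy _ _ _)).mono ?_, hm₁, fun j hj₁ hj₂ => ?_, ?_⟩
  · have h1 := size_le_of_le_mul_two_pow hU hv
    have h2 := mul_le_pow_add_mul (c := c) (X := κ * K + 1) (n := 3) (e := 2) hU (by norm_num)
    have h3 : 1 ≤ U ^ c * (κ * K + 1) := Nat.mul_pos (Nat.pow_pos (by omega)) (by omega)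
    rw [hd]
    omega
  · simp [hj₂, hj j hj₁]
  · simp [hd]

/-- Exponentials leave the polynomial calculus. They are built by repeated doubling, under the
assumption that `U` already dominates the result. -/
theorem exists_assign_two_pow {f : (ℕ → ℕ) → (ℕ → ℕ) → ℕ} (hf : RamComp 0 f) {r : ℕ} (hr : r < 8) :
    ∃ P c, ∀ (s : RAMState) (U K : ℕ), 2 ≤ U → (∀ i, s.reg (envReg i) ≤ U) →
      (∀ a, s.mem a ≤ 2 ^ K) → 2 ^ f s.mem (s.reg ∘ envReg) ≤ U →
        ∃ s', RunsIn P s (U ^ c) s' ∧ s'.mem = s.mem ∧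
          (∀ j < 8, j ≠ r → s'.reg j = s.reg j) ∧
          s'.reg r = 2 ^ f s.mem (s.reg ∘ envReg) := by
  obtain ⟨C, c, hC⟩ := hf
  refine ⟨.seq (C envReg 8) (.seq (.const r 1) (.loop 8 (.seq (.const 9 1) (.seq (.sub 8 8 9)
    (.add r r r))))), c + 7, fun s U K hU hs hm hF => ?_⟩
  obtain ⟨hv, s₁, hr₁, hm₁, hj₁, hd₁⟩ := hC envReg 8 s U K envReg_lt hU hs hm
  simp only [zero_mul, pow_zero, mul_one, zero_add] at hr₁ hv
  set F := f s.mem (s.reg ∘ envReg)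
  have hFU : F < U := Nat.lt_two_pow_self.trans_le hF
  let Inv : ℕ → RAMState → Prop := fun j s' => (∀ j < 8, j ≠ r → s'.reg j = s.reg j) ∧
    s'.mem = s.mem ∧ s'.reg 8 = j ∧ j ≤ F ∧ s'.reg r = 2 ^ (F - j)
  have hsz : ∀ x ≤ U, x.size ≤ U := fun x hx => by
    simpa using size_le_of_le_mul_two_pow (c := 1) (K := 0) hU
      (show x ≤ U ^ 1 * 2 ^ 0 by simpa using hx)
  have hloop := RunsIn.countdown (r := 8) (P := .seq (.const 9 1) (.seq (.sub 8 8 9)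
    (.add r r r))) Inv (T := 6 * U) (N := F) (fun j s h => h.2.2.1) ?_ F le_rfl
    (s₁.setReg r 1) ?_
  · obtain ⟨s₂, hr₂, hj₂, hm₂, -, -, hd₂⟩ := hloop
    refine ⟨s₂, (hr₁.seq ((RunsIn.const _ _ _).seq hr₂)).mono ?_, hm₂, hj₂, hd₂⟩
    have h1 : F * (6 * U + F.size + 1) ≤ U * (8 * U) :=
      Nat.mul_le_mul hFU.le (by have := hsz F hFU.le; omega)
    have h2 : U ^ c ≤ U ^ (c + 2) := Nat.pow_le_pow_right (by omega) (by omega)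
    have h3 : U ^ 2 ≤ U ^ (c + 2) := Nat.pow_le_pow_right (by omega) (by omega)
    have h4 := mul_le_pow_add_mul (c := c + 2) (X := 1) (n := 32) (e := 5) hU (by norm_num)
    rw [mul_one, mul_one, show c + 2 + 5 = c + 7 by omega] at h4
    have h5 : U * (8 * U) = 8 * U ^ 2 := by ring
    have h6 : 1 ≤ U ^ 2 := Nat.pow_pos (by omega)
    simp
    omega
  · rintro j hj s' ⟨h1, h2, h3, h4, h5⟩
    refine ⟨_, ((RunsIn.const _ _ _).seq ((RunsIn.sub _ _ _ _).seq (RunsIn.add _ _ _ _))).mono ?_,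
      fun i hi hir => ?_, h2, ?_, by omega, ?_⟩
    · have k1 := hsz (j + 1) (by omega)
      have k2 := hsz (2 ^ (F - (j + 1)))
        ((Nat.pow_le_pow_right (by norm_num) (by omega)).trans hF)
      simp [h3, (show r ≠ 8 by omega), (show r ≠ 9 by omega), h5]
      omega
    · simp [hir, hi.ne, (show i ≠ 9 by omega), h1 i hi hir]
    · simp [h3, (show 8 ≠ r by omega)]
    · simp [(show r ≠ 8 by omega), (show r ≠ 9 by omega), h5]
      rw [← mul_two, ← pow_succ]
      congr 1
      omega
  · refine ⟨fun j hj hjr => by simp [hjr, hj₁ j hj], hm₁, ?_, le_rfl, by simp⟩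
    simp [(show 8 ≠ r by omega), hd₁]

/-- Writing the values of a function to consecutive memory cells; their number is held by register
`7`. -/
theorem exists_fill {b g : (ℕ → ℕ) → (ℕ → ℕ) → ℕ} (hb : RamComp 0 b) (hg : RamComp 1 g) :
    ∃ P c, ∀ (s : RAMState) (U K β : ℕ), 2 ≤ U → (∀ i, s.reg (envReg i) ≤ U) →
      (∀ a, s.mem a ≤ 2 ^ K) →
      (∀ m, ∀ y < s.reg 7, b m (envCons y (s.reg ∘ envReg)) = β + y) →
      (∀ m, (∀ a, a < β ∨ β + s.reg 7 ≤ a → m a = s.mem a) → ∀ y < s.reg 7,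
        g m (envCons y (s.reg ∘ envReg)) = g s.mem (envCons y (s.reg ∘ envReg))) →
      (∀ y < s.reg 7, g s.mem (envCons y (s.reg ∘ envReg)) ≤ 2 ^ K) →
      ∃ s', RunsIn P s (U ^ c * (K + 1)) s' ∧ (∀ j < 8, s'.reg j = s.reg j) ∧
        ∀ a, s'.mem a = if β ≤ a ∧ a < β + s.reg 7 then
          g s.mem (envCons (a - β) (s.reg ∘ envReg)) else s.mem a := by
  obtain ⟨B, cb, hB⟩ := hb
  obtain ⟨G, cg, hG⟩ := hg
  refine ⟨.seq (.copy 8 7) (.loop 8 (.seq (.const 9 1) (.seq (.sub 8 8 9)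
    (.seq (G (envCons 8 envReg) 9) (.seq (B (envCons 8 envReg) 10) (.store 10 9)))))),
    cb + cg + 7, fun s U K β hU hs hm hbv hloc hgv => ?_⟩
  set N := s.reg 7 with hN
  set σ := s.reg ∘ envReg with hσ
  set c := cb + cg + 1 with hc
  have hUpos : 0 < U := by omega
  have hNU : N ≤ U := hs 6
  -- The loop writes downwards: `M j` is the memory when the cells from `β + j` on have been filled.
  set M : ℕ → ℕ → ℕ := fun j a => if β + j ≤ a ∧ a < β + N then g s.mem (envCons (a - β) σ)
    else s.mem a with hM
  have hMle : ∀ j a, M j a ≤ 2 ^ K := by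
    intro j a
    simp only [hM]
    split_ifs with h
    · exact hgv _ (by omega)
    · exact hm a
  have hone : 1 ≤ U ^ c * (K + 1) := Nat.mul_pos (Nat.pow_pos hUpos) (by omega)
  have hsz : ∀ x ≤ U, x.size ≤ U ^ c * (K + 1) := fun x hx => by
    have := size_le_of_le_mul_two_pow (c := 1) (K := 0) hU
      (show x ≤ U ^ 1 * 2 ^ 0 by simpa using hx)
    exact this.trans (Nat.mul_le_mul (Nat.pow_le_pow_right hUpos (by omega)) (by omega))
  have hρ : ∀ d, 9 ≤ d → ∀ i, envCons 8 envReg i < d := by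
    rintro d hd (_ | i)
    · exact hd
    · exact (envReg_lt i).trans (by omega)
  let Inv : ℕ → RAMState → Prop := fun j s' => (∀ j < 8, s'.reg j = s.reg j) ∧
    s'.mem = M j ∧ s'.reg 8 = j
  have hloop := RunsIn.countdown (r := 8) (P := .seq (.const 9 1) (.seq (.sub 8 8 9)
    (.seq (G (envCons 8 envReg) 9) (.seq (B (envCons 8 envReg) 10) (.store 10 9))))) Inv
    (T := 10 * (U ^ c * (K + 1))) (N := N) (fun j s h => h.2.2) ?_ N le_rfl
    (s.setReg 8 (s.reg 7)) ?_
  · obtain ⟨s₂, hr₂, hj₂, hm₂, -⟩ := hloop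
    refine ⟨s₂, ((RunsIn.copy _ _ _).seq hr₂).mono ?_, hj₂, fun a => by simp [hm₂, hM]⟩
    have h0 := hsz N hNU
    have h1 : N * (10 * (U ^ c * (K + 1)) + N.size + 1) ≤ U * (12 * (U ^ c * (K + 1))) :=
      Nat.mul_le_mul hNU (by omega)
    have h2 := mul_le_pow_add_mul (c := c + 1) (X := K + 1) (n := 32) (e := 5) hU (by norm_num)
    have h3 : U * (12 * (U ^ c * (K + 1))) = 12 * (U ^ (c + 1) * (K + 1)) := by ring
    have h4 := pow_mul_le_pow_mul (X := K + 1) hU (show c ≤ c + 1 by omega)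
    rw [show cb + cg + 7 = c + 1 + 5 by omega, ← hN]
    omega
  · rintro j hj s' ⟨h1, h2, h3⟩
    set s₁ := (s'.setReg 9 1).setReg 8 ((s'.setReg 9 1).reg 8 - (s'.setReg 9 1).reg 9) with hs₁
    have hd₁ : s₁.reg 8 = j := by simp [hs₁, h3]
    have hj₁ : ∀ i < 8, s₁.reg i = s.reg i := fun i hi => by
      simp [hs₁, hi.ne, (show i ≠ 9 by omega), h1 i hi]
    have env : ∀ s₂ : RAMState, (∀ i < 8, s₂.reg i = s.reg i) → s₂.reg 8 = j →
        s₂.reg ∘ envCons 8 envReg = envCons j σ := by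
      intro s₂ k1 k2
      funext i
      rcases i with _ | i
      · exact k2
      · exact k1 _ (envReg_lt i)
    have envle : ∀ i, envCons j σ i ≤ U := by
      rintro (_ | i)
      · exact (show j ≤ U by omega)
      · exact hs i
    have e₁ := env s₁ hj₁ hd₁
    obtain ⟨hgv', s₂, hr₂, hm₂, hj₂, hd₂⟩ := hG (envCons 8 envReg) 9 s₁ U K (hρ 9 le_rfl) hU
      (fun i => by rw [← Function.comp_apply (f := s₁.reg), e₁]; exact envle i)
      (fun a => by rw [show s₁.mem = s'.mem from rfl, h2]; exact hMle _ _)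
    have hj₂' : ∀ i < 8, s₂.reg i = s.reg i := fun i hi => (hj₂ i (by omega)).trans (hj₁ i hi)
    have e₂ := env s₂ hj₂' ((hj₂ 8 (by omega)).trans hd₁)
    have hm₂' : s₂.mem = M (j + 1) := hm₂.trans h2
    obtain ⟨hbv', s₃, hr₃, hm₃, hj₃, hd₃⟩ := hB (envCons 8 envReg) 10 s₂ U K (hρ 10 (by omega)) hU
      (fun i => by rw [← Function.comp_apply (f := s₂.reg), e₂]; exact envle i)
      (fun a => by rw [hm₂']; exact hMle _ _)
    -- By locality, the cells written so far do not influence the value that is written next.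
    rw [e₁, show s₁.mem = M (j + 1) from h2, hloc (M (j + 1)) (fun a ha => by
      simp only [hM]; rw [if_neg (by omega)]) j hj] at hd₂ hgv'
    rw [e₂, hbv _ _ hj] at hd₃ hbv'
    simp only [one_mul, zero_mul, zero_add, mul_one, pow_zero] at hr₂ hr₃ hgv' hbv'
    refine ⟨_, ((RunsIn.const _ _ _).seq ((RunsIn.sub _ _ _ _).seq (hr₂.seq (hr₃.seq
      (RunsIn.store _ _ _))))).mono ?_, fun i hi => ?_, ?_, ?_⟩
    · have k1 := hsz (j + 1) (by omega)
      have k2 := size_le_of_le_mul_two_pow (K := 0) hU (show β + j ≤ U ^ cb * 2 ^ 0 by simpa)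
      have k3 := size_le_of_le_mul_two_pow (c := 0) (K := K) hU (by simpa using hgv j hj)
      have k4 := pow_mul_le_pow_mul (X := K + 1) hU (show cg ≤ c by omega)
      have k5 := pow_mul_le_pow_mul (X := K + 1) hU (show cb ≤ c by omega)
      have k6 : U ^ cb ≤ U ^ cb * (K + 1) := Nat.le_mul_of_pos_right _ (by omega)
      have k7 := pow_mul_le_pow_mul (X := K + 1) hU (show 0 ≤ c by omega)
      rw [hj₃ 9 (by omega), hd₂, hd₃]
      simp only [zero_add, mul_one] at k2
      simp [h3]
      omega
    · exact (hj₃ i (by omega)).trans (hj₂' i hi)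
    · funext a
      rw [RAMState.setMem_mem, hd₃, hj₃ 9 (by omega), hd₂, hm₃, hm₂']
      simp only [hM]
      by_cases ha : a = β + j
      · subst ha
        simp [hj]
      · rw [if_neg ha]
        congr 1
        exact propext ⟨fun h => by omega, fun h => by omega⟩
    · exact (hj₃ 8 (by omega)).trans ((hj₂ 8 (by omega)).trans hd₁)
  · refine ⟨fun i hi => by simp [hi.ne], ?_, by simp [hN]⟩
    funext a
    simp only [hM, RAMState.setReg_mem]
    rw [if_neg (by omega)]

/-! ## Iterated vector-matrix products -/

/-- The numbers of ways of reaching the states `y < N` of an automaton with `S` letters. -/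
noncomputable def pathCount (N S : ℕ) (start : ℕ → Prop) (next : ℕ → ℕ → ℕ → Prop) :
    ℕ → ℕ → ℕ
  | 0, y => propBit (start y)
  | t + 1, y => ∑ x ∈ Finset.range N, ∑ i ∈ Finset.range S,
      propBit (next i x y) * pathCount N S start next t x

/-- The current vector occupies the cells below `N`. The next one is formed in the `N` cells above
and then copied back, so that no entry is overwritten while it is still needed. Register `2` is only
a loop counter and not a parameter: the number of products need not be bounded by `U`, and `s.reg 2
≤ K` pays for handling the counter. -/
theorem exists_pathCount_program {start acc : (ℕ → ℕ) → ℕ → Prop}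
    {next : (ℕ → ℕ) → ℕ → ℕ → ℕ → Prop}
    (hstart : RamPred 0 fun _ σ => start (envTail σ) (σ 0))
    (hnext : RamPred 0 fun _ σ => next (envTail (envTail (envTail σ))) (σ 0) (σ 1) (σ 2))
    (hacc : RamPred 0 fun _ σ => acc (envTail σ) (σ 0)) :
    ∃ P c, ∀ (s : RAMState) (U K : ℕ), 2 ≤ U → (∀ i, s.reg (envReg i) ≤ U) →
      (∀ a, s.mem a ≤ 2 ^ K) → s.reg 2 ≤ K →
      (∀ t ≤ s.reg 2, ∀ y < s.reg 7, pathCount (s.reg 7) (s.reg 3) (start (s.reg ∘ envReg))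
        (next (s.reg ∘ envReg)) t y ≤ 2 ^ K) →
      RAMOutputsWithin P s (∑ x ∈ Finset.range (s.reg 7), propBit (acc (s.reg ∘ envReg) x) *
        pathCount (s.reg 7) (s.reg 3) (start (s.reg ∘ envReg)) (next (s.reg ∘ envReg)) (s.reg 2) x)
        (U ^ c * ((K + 1) * (s.reg 2 + 1))) := by
  obtain ⟨P₀, c₀, h₀⟩ := exists_fill (b := fun _ σ => σ 0) (.var 0) (hstart.of_zero (κ := 1))
  have hg : RamComp 1 fun m σ => ∑ x ∈ Finset.range (σ 7), ∑ i ∈ Finset.range (σ 3),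
      propBit (next (envTail σ) i x (σ 0)) * m x :=
    RamComp.sum (F := fun m σ x => ∑ i ∈ Finset.range (σ 3),
        propBit (next (envTail σ) i x (σ 0)) * m x) (.var 7)
      (RamComp.sum (F := fun m σ i =>
        propBit (next (envTail (envTail σ)) i (σ 0) (σ 1)) * m (σ 0)) (.var 4)
        (RamComp.mul hnext (RamComp.read (.var 1))))
  obtain ⟨P₁, c₁, h₁⟩ := exists_fill (b := fun _ σ => σ 7 + σ 0) (.add (.var 7) (.var 0)) hg
  obtain ⟨P₂, c₂, h₂⟩ := exists_fill (b := fun _ σ => σ 0) (g := fun m σ => m (σ 7 + σ 0)) (.var 0)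
    (RamComp.read (.add (.var 7) (.var 0)))
  obtain ⟨P₃, c₃, h₃⟩ := exists_assign (κ := 1) (f := fun m σ => ∑ x ∈ Finset.range (σ 6),
    propBit (acc σ x) * m x)
    (RamComp.sum (F := fun m σ x => propBit (acc σ x) * m x) (.var 6)
      (RamComp.mul hacc (RamComp.read (.var 0)))) 0
  refine ⟨.seq P₀ (.seq (.loop 2 (.seq (.const 8 1) (.seq (.sub 2 2 8) (.seq P₁ P₂)))) P₃),
    c₀ + c₁ + c₂ + c₃ + 5, fun s U K hU hs hm hk hv => ?_⟩
  set N := s.reg 7 with hN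
  set k := s.reg 2 with hkdef
  set σ := s.reg ∘ envReg with hσ
  set v := pathCount N (s.reg 3) (start σ) (next σ) with hvdef
  have env : ∀ s' : RAMState, (∀ j < 8, j ≠ 2 → s'.reg j = s.reg j) → s'.reg ∘ envReg = σ :=
    fun s' h => funext fun i => h _ (envReg_lt i) (envReg_ne_two i)
  have envle : ∀ s' : RAMState, (∀ j < 8, j ≠ 2 → s'.reg j = s.reg j) →
      ∀ i, s'.reg (envReg i) ≤ U := fun s' h i => by
    rw [h _ (envReg_lt i) (envReg_ne_two i)]; exact hs i
  obtain ⟨s₁, hr₁, hj₁, hm₁⟩ := h₀ s U K 0 hU hs hm (fun m y hy => by simp [envCons])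
    (fun m _ y hy => rfl) (fun y hy => (propBit_le_one _).trans Nat.one_le_two_pow)
  -- The counter `j` is the number of products still to be formed, so the vector stored is that of
  -- time `k - j`.
  let Inv : ℕ → RAMState → Prop := fun j s' => (∀ i < 8, i ≠ 2 → s'.reg i = s.reg i) ∧
    s'.reg 2 = j ∧ (∀ y < N, s'.mem y = v (k - j) y) ∧ (∀ a, s'.mem a ≤ 2 ^ K)
  set c := c₀ + c₁ + c₂ + c₃ with hc
  have hUpos : 0 < U := by omega
  have hpc : ∀ e ≤ c, U ^ e * (K + 1) ≤ U ^ c * (K + 1) := fun e he =>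
    pow_mul_le_pow_mul hU he
  have hone : 1 ≤ U ^ c * (K + 1) := Nat.mul_pos (Nat.pow_pos hUpos) (by omega)
  have hszk : k.size ≤ U ^ c * (K + 1) := by
    have h1 : k.size ≤ k := Nat.size_le.2 Nat.lt_two_pow_self
    have h2 : K + 1 ≤ U ^ c * (K + 1) := Nat.le_mul_of_pos_left _ (Nat.pow_pos hUpos)
    omega
  have hloop := RunsIn.countdown (r := 2) (P := .seq (.const 8 1) (.seq (.sub 2 2 8)
    (.seq P₁ P₂))) Inv (T := 7 * (U ^ c * (K + 1))) (N := k) (fun j s h => h.2.1) ?_ k le_rfl s₁ ?_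
  · obtain ⟨s₂, hr₂, hj₂, -, hv₂, hm₂⟩ := hloop
    obtain ⟨s₃, hr₃, -, -, hd₃⟩ := h₃ s₂ U K hU (envle s₂ hj₂) hm₂
    obtain ⟨t, ht, hle⟩ := (hr₁.seq (hr₂.seq hr₃)).mono (T' :=
      (U ^ (c + 5) * ((K + 1) * (k + 1)))) (by
        have e1 := hpc c₀ (by omega)
        have e2 := hpc c₃ (by omega)
        have e3 : k * (7 * (U ^ c * (K + 1)) + k.size + 1) ≤ k * (9 * (U ^ c * (K + 1))) :=
          Nat.mul_le_mul_left _ (by omega)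
        have e4 := mul_le_pow_add_mul (c := c) (X := (K + 1) * (k + 1)) (n := 32) (e := 5) hU
          (by norm_num)
        have e5 : U ^ c * ((K + 1) * (k + 1)) =
          k * (U ^ c * (K + 1)) + U ^ c * (K + 1) := by ring
        have e6 : k * (9 * (U ^ c * (K + 1))) = 9 * (k * (U ^ c * (K + 1))) := by ring
        rw [one_mul]
        omega)
    refine ⟨t, s₃, ht, hle, hd₃.trans ?_⟩
    rw [env s₂ hj₂]
    refine Finset.sum_congr rfl fun x hx => ?_
    rw [hv₂ x (Finset.mem_range.1 hx), Nat.sub_zero]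
  · rintro j hj s' ⟨g1, g2, g3, g4⟩
    set s₄ := (s'.setReg 8 1).setReg 2 ((s'.setReg 8 1).reg 2 - (s'.setReg 8 1).reg 8) with hs₄
    have hj₄ : ∀ i < 8, i ≠ 2 → s₄.reg i = s.reg i := fun i hi hi2 => by
      simp [hs₄, hi2, (show i ≠ 8 by omega), g1 i hi hi2]
    have hk₄ : s₄.reg 2 = j := by simp [hs₄, g2]
    have hN₄ : s₄.reg 7 = N := hj₄ 7 (by omega) (by omega)
    have eσ : σ 6 = N := rfl
    have eσ' : σ 2 = s.reg 3 := rfl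
    have hval : ∀ y < N, ∑ x ∈ Finset.range N, ∑ i ∈ Finset.range (s.reg 3),
        propBit (next σ i x y) * s'.mem x = v (k - j) y := by
      intro y hy
      rw [show k - j = k - (j + 1) + 1 by omega, hvdef, pathCount]
      refine Finset.sum_congr rfl fun x hx => Finset.sum_congr rfl fun i _ => ?_
      rw [g3 x (Finset.mem_range.1 hx)]
    obtain ⟨s₅, hr₅, hj₅, hm₅⟩ := h₁ s₄ U K N hU (envle s₄ hj₄) g4
      (fun m y hy => by rw [env s₄ hj₄]; simp [envCons, eσ])
      (fun m hm' y hy => by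
        rw [env s₄ hj₄]
        simp only [envCons, eσ, eσ']
        refine Finset.sum_congr rfl fun x hx => Finset.sum_congr rfl fun i _ => ?_
        rw [hm' x (Or.inl (Finset.mem_range.1 hx))])
      (fun y hy => by
        rw [hN₄] at hy
        rw [env s₄ hj₄]
        exact (hval y hy).trans_le (hv _ (by omega) _ hy))
    have hj₅' : ∀ i < 8, i ≠ 2 → s₅.reg i = s.reg i :=
      fun i hi hi2 => (hj₅ i hi).trans (hj₄ i hi hi2)
    have hN₅ : s₅.reg 7 = N := hj₅' 7 (by omega) (by omega)
    rw [env s₄ hj₄, hN₄] at hm₅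
    have hmem₅ : ∀ y < N, s₅.mem (N + y) = v (k - j) y := fun y hy => by
      rw [hm₅, if_pos (by omega), Nat.add_sub_cancel_left]
      exact hval y hy
    have hle₅ : ∀ a, s₅.mem a ≤ 2 ^ K := fun a => by
      by_cases h : N ≤ a ∧ a < N + N
      · obtain ⟨y, rfl⟩ := Nat.exists_eq_add_of_le h.1
        rw [hmem₅ y (by omega)]
        exact hv _ (by omega) _ (by omega)
      · rw [hm₅, if_neg h]
        exact g4 a
    obtain ⟨s₆, hr₆, hj₆, hm₆⟩ := h₂ s₅ U K 0 hU (envle s₅ hj₅') hle₅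
      (fun m y hy => by simp [envCons])
      (fun m hm' y hy => by
        rw [env s₅ hj₅']
        simp only [envCons, eσ]
        exact hm' _ (by omega))
      (fun y hy => hle₅ _)
    rw [env s₅ hj₅', hN₅] at hm₆
    simp only [Nat.sub_zero, envCons, eσ, Nat.zero_le, true_and, Nat.zero_add] at hm₆
    refine ⟨s₆, ((RunsIn.const _ _ _).seq ((RunsIn.sub _ _ _ _).seq (hr₅.seq hr₆))).mono ?_,
      fun i hi hi2 => (hj₆ i hi).trans (hj₅' i hi hi2),
      (hj₆ 2 (by omega)).trans ((hj₅ 2 (by omega)).trans hk₄), fun y hy => ?_, fun a => ?_⟩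
    · have e1 := hpc c₁ (by omega)
      have e2 := hpc c₂ (by omega)
      have e3 : (j + 1).size ≤ k.size := Nat.size_le_size (by omega)
      simp [g2]
      omega
    · rw [hm₆, if_pos hy, hmem₅ y hy]
    · rw [hm₆]
      split_ifs
      · exact hle₅ _
      · exact hle₅ _
  · refine ⟨fun i hi _ => hj₁ i hi, hj₁ 2 (by omega), fun y hy => ?_, fun a => ?_⟩
    · rw [hm₁, if_pos (by omega), Nat.sub_self]
      rfl
    · rw [hm₁]
      split_ifs
      · exact (propBit_le_one _).trans Nat.one_le_two_pow
      · exact hm a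

/-! ## Words and path counts -/

/-- The lists of length `t` of numbers less than `S`. -/
def words (S : ℕ) : ℕ → Finset (List ℕ)
  | 0 => {[]}
  | t + 1 => (Finset.range S ×ˢ words S t).image fun p => p.1 :: p.2

theorem mem_words {S t : ℕ} {u : List ℕ} :
    u ∈ words S t ↔ u.length = t ∧ ∀ a ∈ u, a < S := by
  induction t generalizing u with
  | zero =>
    simp only [words, Finset.mem_singleton]
    constructor
    · rintro rfl; simp
    · exact fun h => List.length_eq_zero_iff.1 h.1
  | succ t ih =>
    simp only [words, Finset.mem_image, Finset.mem_product, Finset.mem_range, Prod.exists]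
    constructor
    · rintro ⟨a, v, ⟨ha, hv⟩, rfl⟩
      have := ih.1 hv
      exact ⟨by simp [this.1], by simpa [ha] using this.2⟩
    · rintro ⟨hl, hu⟩
      rcases u with _ | ⟨a, v⟩
      · simp at hl
      · exact ⟨a, v, ⟨hu a (by simp), ih.2 ⟨by simpa using hl, fun b hb => hu b (by simp [hb])⟩⟩, rfl⟩

theorem cons_mem_words {S t a : ℕ} {u : List ℕ} :
    a :: u ∈ words S (t + 1) ↔ a < S ∧ u ∈ words S t := by
  simp only [mem_words, List.length_cons, List.mem_cons, forall_eq_or_imp, Nat.add_right_cancel_iff]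
  tauto

theorem sum_words_succ {S t : ℕ} (f : List ℕ → ℕ) :
    ∑ u ∈ words S (t + 1), f u = ∑ u ∈ words S t, ∑ a ∈ Finset.range S, f (a :: u) := by
  rw [words, Finset.sum_image (by
    rintro ⟨a, u⟩ - ⟨b, v⟩ - h
    simpa using h), Finset.sum_product, Finset.sum_comm]

theorem card_words (S t : ℕ) : (words S t).card = S ^ t := by
  induction t with
  | zero => simp [words]
  | succ t ih =>
    rw [Finset.card_eq_sum_ones, sum_words_succ]
    simp [ih, pow_succ]

theorem sum_propBit_eq {N y : ℕ} (hy : y < N) (f : ℕ → ℕ) :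
    ∑ x ∈ Finset.range N, propBit (y = x) * f x = f y := by
  rw [Finset.sum_eq_single y]
  · simp [propBit]
  · intro b _ hb
    simp [propBit, hb.symm]
  · exact fun h => absurd (Finset.mem_range.2 hy) h

section PathCount

variable {N S : ℕ} {start : ℕ → Prop} {next : ℕ → ℕ → ℕ → Prop} {y₀ : ℕ} {step : ℕ → ℕ → ℕ}

theorem foldr_lt (hy₀ : y₀ < N) (hstep : ∀ i x, step i x < N) (D : List ℕ) :
    D.foldr step y₀ < N := by
  cases D with
  | nil => exact hy₀
  | cons i D => exact hstep _ _

/-- The path counts of a deterministic automaton count words. -/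
theorem pathCount_eq (hy₀ : y₀ < N) (hstep : ∀ i x, step i x < N)
    (hs : ∀ y < N, start y ↔ y₀ = y) (hn : ∀ i < S, ∀ x < N, ∀ y < N, next i x y ↔ step i x = y)
    (t : ℕ) {y : ℕ} (hy : y < N) :
    pathCount N S start next t y = ∑ D ∈ words S t, propBit (D.foldr step y₀ = y) := by
  induction t generalizing y with
  | zero => simp [pathCount, words, hs y hy]
  | succ t ih =>
    rw [pathCount, sum_words_succ]
    have h1 : ∀ x ∈ Finset.range N, ∑ i ∈ Finset.range S,
        propBit (next i x y) * pathCount N S start next t x = ∑ D ∈ words S t,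
          propBit (D.foldr step y₀ = x) * ∑ i ∈ Finset.range S, propBit (step i x = y) := by
      intro x hx
      rw [ih (Finset.mem_range.1 hx), ← Finset.sum_mul, ← Finset.sum_mul, Nat.mul_comm]
      congr 1
      refine Finset.sum_congr rfl fun i hi => ?_
      rw [propext (hn i (Finset.mem_range.1 hi) x (Finset.mem_range.1 hx) y hy)]
    rw [Finset.sum_congr rfl h1, Finset.sum_comm]
    refine Finset.sum_congr rfl fun D _ => ?_
    rw [sum_propBit_eq (foldr_lt hy₀ hstep D) fun x => ∑ i ∈ Finset.range S, propBit (step i x = y)]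
    rfl

/-- No entry exceeds the number of all words, hence its bit length is linear in `t`. This accounts
for one of the two factors `k` of the running time. -/
theorem pathCount_le (hy₀ : y₀ < N) (hstep : ∀ i x, step i x < N)
    (hs : ∀ y < N, start y ↔ y₀ = y) (hn : ∀ i < S, ∀ x < N, ∀ y < N, next i x y ↔ step i x = y)
    (t : ℕ) {y : ℕ} (hy : y < N) : pathCount N S start next t y ≤ S ^ t := by
  rw [pathCount_eq hy₀ hstep hs hn t hy, ← card_words, Finset.card_eq_sum_ones]
  exact Finset.sum_le_sum fun _ _ => propBit_le_one _

-- Every word is counted exactly once, at the state in which it ends.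
open Classical in
theorem sum_pathCount_eq (hy₀ : y₀ < N) (hstep : ∀ i x, step i x < N)
    (hs : ∀ y < N, start y ↔ y₀ = y) (hn : ∀ i < S, ∀ x < N, ∀ y < N, next i x y ↔ step i x = y)
    (acc : ℕ → Prop) (t : ℕ) :
    ∑ x ∈ Finset.range N, propBit (acc x) * pathCount N S start next t x =
      ((words S t).filter fun D => acc (D.foldr step y₀)).card := by
  have h1 : ∀ x ∈ Finset.range N, propBit (acc x) * pathCount N S start next t x =
      ∑ D ∈ words S t, propBit (D.foldr step y₀ = x) * propBit (acc x) := by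
    intro x hx
    rw [pathCount_eq hy₀ hstep hs hn t (Finset.mem_range.1 hx), Finset.mul_sum]
    exact Finset.sum_congr rfl fun _ _ => Nat.mul_comm _ _
  rw [Finset.sum_congr rfl h1, Finset.sum_comm, Finset.card_filter]
  refine Finset.sum_congr rfl fun D _ => ?_
  rw [sum_propBit_eq (foldr_lt hy₀ hstep D) fun x => propBit (acc x)]
  by_cases h : acc (D.foldr step y₀) <;> simp [propBit, h]

end PathCount

/-! ## Labellings of states -/

/-- The labels of `p` in `α` and of `p'` in `β` agree, where a number is a labelling of states by
strings of `B` bits. -/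
def LabelEq (B α p β p' : ℕ) : Prop :=
  ∀ t < B, (α.testBit (p * B + t) ↔ β.testBit (p' * B + t))

/-- `α` is the concatenation of the blocks formed by the lowest `B` bits of `f 0, …, f (W - 1)`. -/
theorem exists_labelling (W B : ℕ) (f : ℕ → ℕ) : ∃ α < 2 ^ (W * B), ∀ p < W, ∀ t < B,
    α.testBit (p * B + t) = (f p).testBit t := by
  refine ⟨Nat.ofBits fun j : Fin (W * B) => (f (j / B)).testBit (j % B), Nat.ofBits_lt_two_pow _,
    fun p hp t ht => ?_⟩
  have hlt : p * B + t < W * B := by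
    calc p * B + t < p * B + B := by omega
      _ = (p + 1) * B := by ring
      _ ≤ W * B := Nat.mul_le_mul_right _ hp
  rw [Nat.testBit_ofBits_lt _ _ hlt]
  simp only
  rw [Nat.mul_comm p B, Nat.mul_add_div (by omega), Nat.div_eq_of_lt ht, add_zero, Nat.mul_add_mod,
    Nat.mod_eq_of_lt ht]

/-- Only coincidences of values matter, not the values themselves. A value is represented by the
least argument at which `F` takes it, and a value of `G` that `F` does not take below `W` is
represented by `W`. All representatives are at most `W`, so `W.size` bits per state are enough,
however large `T` is. -/
theorem exists_labellings (W : ℕ) {T : Type*} (F G : ℕ → T) :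
    ∃ α < 2 ^ (W * W.size), ∃ β < 2 ^ (W * W.size), ∀ p < W, ∀ p' < W,
      LabelEq W.size α p β p' ↔ F p = G p' := by
  classical
  have hf : ∀ p, ∃ x, F x = F p := fun p => ⟨p, rfl⟩
  let f : ℕ → ℕ := fun p => Nat.find (hf p)
  let g : ℕ → ℕ := fun p' => if h : ∃ x, x < W ∧ F x = G p' then Nat.find h else W
  have hW : W < 2 ^ W.size := Nat.lt_size_self W
  have hfle : ∀ p, f p ≤ p := fun p => Nat.find_min' _ rfl
  have hfs : ∀ p, F (f p) = F p := fun p => Nat.find_spec (hf p)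
  have hgle : ∀ p', g p' ≤ W := fun p' => by
    simp only [g]
    split_ifs with h
    · exact (Nat.find_spec h).1.le
    · exact le_rfl
  obtain ⟨α, hα, hα'⟩ := exists_labelling W W.size f
  obtain ⟨β, hβ, hβ'⟩ := exists_labelling W W.size g
  refine ⟨α, hα, β, hβ, fun p hp p' hp' => ?_⟩
  have key : LabelEq W.size α p β p' ↔ f p = g p' := by
    constructor
    · intro h
      refine Nat.eq_of_testBit_eq fun t => ?_
      by_cases ht : t < W.size
      · rw [← hα' p hp t ht, ← hβ' p' hp' t ht, Bool.eq_iff_iff]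
        exact h t ht
      · have hpow : 2 ^ W.size ≤ 2 ^ t := Nat.pow_le_pow_right (by norm_num) (by omega)
        have := hfle p
        have := hgle p'
        rw [Nat.testBit_eq_false_of_lt (by omega), Nat.testBit_eq_false_of_lt (by omega)]
    · intro h t ht
      rw [hα' p hp t ht, hβ' p' hp' t ht, h]
  rw [key]
  have := hfle p
  by_cases h : ∃ x, x < W ∧ F x = G p'
  · have hg : g p' = Nat.find h := dif_pos h
    have hgs := Nat.find_spec h
    constructor
    · intro e
      rw [← hfs p, e, hg, hgs.2]
    · intro e
      rw [hg]
      apply le_antisymm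
      · exact Nat.find_min' _ (hgs.2.trans e.symm)
      · exact Nat.find_min' _ ⟨by omega, (hfs p).trans e⟩
  -- The extra label `W` is never used by `f`, because `f p ≤ p < W`.
  · have hg : g p' = W := dif_neg h
    constructor
    · intro e
      omega
    · intro e
      exact absurd ⟨p, hp, e⟩ h

theorem LabelEq.zero (B p p' : ℕ) : LabelEq B 0 p 0 p' := fun _ _ => by simp

/-! ## Deterministic systems of layers -/

/-- A deterministic system of layers. There are `size` layers and `symbols` symbols, and each layer
`i` acts on the states below `states` by `trans i p a`; `ini` and `fin` are the flags, `start i` is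
the initial state of `i` if its flag `ini` is on, and `acc` describes the final states. States will
be labelled by numbers below `labels`. -/
structure DetSystem where
  size : ℕ
  states : ℕ
  symbols : ℕ
  labels : ℕ
  ini : ℕ → Prop
  fin : ℕ → Prop
  glue : ℕ → ℕ → Prop
  start : ℕ → ℕ
  trans : ℕ → ℕ → ℕ → ℕ
  acc : ℕ → ℕ → Prop

/-- Codes of quintuples. -/
def quintuple (i j b α β : ℕ) : ℕ :=
  Nat.pair i (Nat.pair j (Nat.pair b (Nat.pair α β)))

theorem quintuple_inj {i j b α β i' j' b' α' β' : ℕ} :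
    quintuple i j b α β = quintuple i' j' b' α' β' ↔
      i = i' ∧ j = j' ∧ b = b' ∧ α = α' ∧ β = β' := by
  simp [quintuple, Nat.pair_eq_pair]

theorem pair_lt_pow {a b M e : ℕ} (ha : a < M) (hb : b < M ^ (e + 1)) :
    Nat.pair a b < M ^ (2 * (e + 1)) := by
  have h1 : M ≤ M ^ (e + 1) := Nat.le_self_pow (by omega) _
  calc Nat.pair a b < (max a b + 1) ^ 2 := Nat.pair_lt_max_add_one_sq a b
    _ ≤ (M ^ (e + 1)) ^ 2 := Nat.pow_le_pow_left (by omega) _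
    _ = _ := by rw [← pow_mul, Nat.mul_comm]

/-- Each of the four pairings at most squares the bound, whence the exponent `16`. -/
theorem quintuple_lt {i j b α β M : ℕ} (hi : i < M) (hj : j < M) (hb : b < M)
    (hα : α < M) (hβ : β < M) : quintuple i j b α β < M ^ 16 := by
  exact pair_lt_pow (e := 7) hi (pair_lt_pow (e := 3) hj (pair_lt_pow (e := 1) hb
    (pair_lt_pow (e := 0) hα (by simpa using hβ))))

namespace DetSystem

variable (M : DetSystem)

/-- The states stay in range, and there are enough labellings. -/
structure Bounded : Prop where
  labels_eq : M.labels = 2 ^ (M.states * M.states.size)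
  start_lt : ∀ i < M.size, M.ini i → M.start i < M.states
  trans_lt : ∀ i < M.size, ∀ p < M.states, ∀ a < M.symbols, M.trans i p a < M.states

open Classical in
/-- The action of the layers, where an initial layer acts on its initial state. -/
noncomputable def trans' (i p a : ℕ) : ℕ :=
  if M.ini i then M.trans i (M.start i) a else M.trans i p a

/-- The layer `i` may follow the layer `h`, or may come first if `h = M.size`. -/
def Follows (h i : ℕ) : Prop :=
  (h = M.size ∧ M.ini i) ∨ (h ≠ M.size ∧ ¬M.ini i ∧ ¬M.fin h ∧ M.glue h i)

/-- The last layer of a sequence of layers (which is its head: sequences grow at the left end). -/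
abbrev last (D : List ℕ) : ℕ := D.headD M.size

/-- Sequences of layers that fit together. -/
def Valid : List ℕ → Prop
  | [] => True
  | i :: D => i < M.size ∧ M.Follows (M.last D) i ∧ Valid D

/-- The state that is reached by a sequence of layers on a string. -/
noncomputable def run : List ℕ → List ℕ → ℕ
  | i :: D, a :: u => M.trans' i (run D u) a
  | _, _ => 0

/-- The labels of the states before two layers `i` and `j` determine those after them. -/
def Compat (α₀ β₀ i j α β : ℕ) : Prop :=
  ∀ p < M.states, ∀ p' < M.states, LabelEq M.states.size α₀ p β₀ p' → ∀ a < M.symbols,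
    LabelEq M.states.size α (M.trans' i p a) β (M.trans' j p' a)

/-- The profile of the empty sequence. -/
def StartBit (q : ℕ) : Prop :=
  ∃ α < M.labels, ∃ β < M.labels, LabelEq M.states.size α 0 β 0 ∧
    q = quintuple M.size M.size 0 α β

/-- The change of the profile `X` of a sequence by the layer `i`. -/
def NextBit (X : ℕ → Prop) (i q : ℕ) : Prop :=
  ∃ i₀ < M.size + 1, ∃ j₀ < M.size + 1, ∃ b₀ < 2, ∃ α₀ < M.labels, ∃ β₀ < M.labels,
    X (quintuple i₀ j₀ b₀ α₀ β₀) ∧ i < M.size ∧ M.Follows i₀ i ∧ ∃ j < M.size, M.Follows j₀ j ∧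
      ∃ α < M.labels, ∃ β < M.labels, M.Compat α₀ β₀ i j α β ∧
        q = quintuple i j (propBit (j < i ∨ (j = i ∧ b₀ ≠ 0))) α β

/-- The profile of a sequence `D` of layers: the codes of `(last D, last D', [D' < D], α, β)`, for
all sequences `D'` of the same length and all labellings `α` and `β` such that the states that are
reached by `D` and `D'` on a string have the same label. -/
def Profile : List ℕ → ℕ → Prop
  | [] => M.StartBit
  | i :: D => M.NextBit (Profile D) i

variable {M}

/-! ### Profiles determine minimality -/

theorem Valid.mem_words {D : List ℕ} (h : M.Valid D) : D ∈ words M.size D.length := by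
  induction D with
  | nil => simp [words]
  | cons i D ih => exact cons_mem_words.2 ⟨h.1, ih h.2.2⟩

theorem last_lt_succ {D : List ℕ} (h : M.Valid D) : M.last D < M.size + 1 := by
  cases D with
  | nil => exact Nat.lt_succ_self _
  | cons i D => exact h.1.trans (Nat.lt_succ_self _)

theorem Bounded.trans'_lt (hM : M.Bounded) {i p a : ℕ} (hi : i < M.size) (hp : p < M.states)
    (ha : a < M.symbols) : M.trans' i p a < M.states := by
  unfold trans'
  split_ifs with h
  · exact hM.trans_lt i hi _ (hM.start_lt i hi h) a ha
  · exact hM.trans_lt i hi p hp a ha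

theorem Bounded.run_lt (hM : M.Bounded) (h0 : 0 < M.states) {D u : List ℕ} (hD : M.Valid D)
    (hu : u ∈ words M.symbols D.length) : M.run D u < M.states := by
  induction D generalizing u with
  | nil => simpa [run] using h0
  | cons i D ih =>
    rcases u with _ | ⟨a, u⟩
    · simpa [run] using h0
    · have := cons_mem_words.1 hu
      exact hM.trans'_lt hD.1 (ih hD.2.2 this.2) this.1

/-- The recursive update refers to the previous profile alone, and still nothing is lost.
Compatibility carries equality of labels forward along a layer; conversely, admissible labellings
after the layers `i` and `j` pull back to admissible labellings before them. The order bit can be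
updated as well: sequences are stored with their last layer in front, so `j :: D' < i :: D` is
decided by `j` and `i`, or by the previous bit if these agree. -/
theorem profile_iff (hM : M.Bounded) (h0 : 0 < M.states) (D : List ℕ) (q : ℕ) :
    M.Profile D q ↔ M.Valid D ∧ ∃ D', M.Valid D' ∧ D'.length = D.length ∧
      ∃ α < M.labels, ∃ β < M.labels,
        (∀ u ∈ words M.symbols D.length,
          LabelEq M.states.size α (M.run D u) β (M.run D' u)) ∧
        q = quintuple (M.last D) (M.last D') (propBit (D' < D)) α β := by
  induction D generalizing q with
  | nil =>
    simp only [Profile, StartBit, Valid, true_and, List.length_nil, List.length_eq_zero_iff, words,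
      Finset.mem_singleton, forall_eq]
    constructor
    · rintro ⟨α, hα, β, hβ, h, rfl⟩
      exact ⟨[], trivial, rfl, α, hα, β, hβ, h, by simp [propBit]⟩
    · rintro ⟨D', -, rfl, α, hα, β, hβ, h, rfl⟩
      exact ⟨α, hα, β, hβ, h, by simp [propBit]⟩
  | cons i D ih =>
    constructor
    · rintro ⟨i₀, -, j₀, -, b₀, -, α₀, -, β₀, -, hX, hi, hi₀, j, hj, hj₀, α, hα, β, hβ, hc, rfl⟩
      obtain ⟨hD, D', hD', hl, α₁, -, β₁, -, hrun, he⟩ := (ih _).1 hX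
      obtain ⟨rfl, rfl, rfl, rfl, rfl⟩ := quintuple_inj.1 he
      refine ⟨⟨hi, hi₀, hD⟩, j :: D', ⟨hj, hj₀, hD'⟩, by simp [hl], α, hα, β, hβ, ?_, ?_⟩
      · intro u hu
        rcases u with _ | ⟨a, u⟩
        · simp [mem_words] at hu
        · obtain ⟨ha, hu⟩ := cons_mem_words.1 hu
          exact hc _ (hM.run_lt h0 hD hu) _ (hM.run_lt h0 hD' (hl ▸ hu)) (hrun u hu) a ha
      · congr 1
        simp only [List.cons_lt_cons_iff, propBit_ne_zero]
    · rintro ⟨⟨hi, hiD, hD⟩, D'', hD'', hl, α, hα, β, hβ, hrun, rfl⟩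
      rcases D'' with _ | ⟨j, D'⟩
      · simp at hl
      obtain ⟨hj, hjD, hD'⟩ := hD''
      simp only [List.length_cons, Nat.add_right_cancel_iff] at hl
      -- The weakest precondition of the given labellings: two states receive equal labels exactly
      -- if, for every symbol, their successors have equal labels under `α` and `β`.
      obtain ⟨α₀, hα₀, β₀, hβ₀, hlab⟩ := exists_labellings M.states
        (fun p => fun (a : Fin M.symbols) (t : Fin M.states.size) =>
          α.testBit (M.trans' i p a * M.states.size + t))
        (fun p => fun (a : Fin M.symbols) (t : Fin M.states.size) =>
          β.testBit (M.trans' j p a * M.states.size + t))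
      rw [← hM.labels_eq] at hα₀ hβ₀
      refine ⟨M.last D, last_lt_succ hD, M.last D', last_lt_succ hD', propBit (D' < D),
        (propBit_le_one _).trans_lt (by norm_num), α₀, hα₀, β₀, hβ₀, (ih _).2 ⟨hD, D', hD', hl,
          α₀, hα₀, β₀, hβ₀, fun u hu => ?_, rfl⟩, hi, hiD, j, hj, hjD, α, hα, β, hβ, ?_, ?_⟩
      · rw [hlab _ (hM.run_lt h0 hD hu) _ (hM.run_lt h0 hD' (hl ▸ hu))]
        funext a t
        rw [Bool.eq_iff_iff]
        exact hrun (a :: u) (cons_mem_words.2 ⟨a.2, hu⟩) t t.2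
      · intro p hp p' hp' h a ha t ht
        have := congrFun (congrFun ((hlab p hp p' hp').1 h) ⟨a, ha⟩) ⟨t, ht⟩
        rw [← Bool.eq_iff_iff]
        exact this
      · congr 1
        simp only [List.cons_lt_cons_iff, propBit_ne_zero]

variable (M)

/-- Sequences of layers that start with an initial layer and end with a final layer. -/
def Full (D : List ℕ) : Prop := M.Valid D ∧ M.fin (M.last D)

/-- The string `u` is accepted by the sequence `D` of layers. -/
def Accepts (D u : List ℕ) : Prop := M.acc (M.last D) (M.run D u)

/-- The profile `X` belongs to a full sequence that is minimal among the full sequences that accept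
the same strings. -/
def MinimalProfile (X : ℕ → Prop) : Prop :=
  (∃ i < M.size, ∃ j < M.size, ∃ b < 2, ∃ α < M.labels, ∃ β < M.labels,
    X (quintuple i j b α β) ∧ M.fin i) ∧
  ¬∃ i < M.size, ∃ j < M.size, ∃ α < M.labels, ∃ β < M.labels,
    X (quintuple i j 1 α β) ∧ M.fin i ∧ M.fin j ∧ ∀ p < M.states, ∀ p' < M.states,
      LabelEq M.states.size α p β p' → (M.acc i p ↔ M.acc j p')

variable {M}

theorem last_lt {D : List ℕ} (h : M.Valid D) (hl : 0 < D.length) : M.last D < M.size := by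
  rcases D with _ | ⟨i, D⟩
  · simp at hl
  · exact h.1

/-- If `D` and `D'` accept the same strings, then labelling states by whether they are accepting is
admissible for the pair. Conversely, admissible labellings in which equal labels imply equal
acceptance force `D` and `D'` to accept the same strings. A smaller equivalent sequence is therefore
visible among the codes whose order bit is `1`. -/
theorem minimalProfile_iff (hM : M.Bounded) (h0 : 0 < M.states) {D : List ℕ} (hl : 0 < D.length) :
    M.MinimalProfile (M.Profile D) ↔ M.Full D ∧ ∀ D', M.Full D' → D'.length = D.length →
      (∀ u ∈ words M.symbols D.length, (M.Accepts D u ↔ M.Accepts D' u)) → ¬D' < D := by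
  refine (and_congr_left' (b := M.Full D) ?_).trans (and_congr_right fun hF => ?_)
  · constructor
    · rintro ⟨i, -, j, -, b, -, α, -, β, -, hX, hi⟩
      obtain ⟨hD, D', -, -, α₁, -, β₁, -, -, he⟩ := (profile_iff hM h0 D _).1 hX
      obtain ⟨rfl, -⟩ := quintuple_inj.1 he
      exact ⟨hD, hi⟩
    · rintro ⟨hD, hf⟩
      have hpos : 0 < M.labels := hM.labels_eq ▸ Nat.pow_pos (by norm_num)
      -- Paired with itself under constant labellings, every valid sequence contributes a code from
      -- which its last layer can be read.
      exact ⟨M.last D, last_lt hD hl, M.last D, last_lt hD hl, 0, by norm_num, 0, hpos, 0, hpos,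
        (profile_iff hM h0 D _).2 ⟨hD, D, hD, rfl, 0, hpos, 0, hpos,
          fun u _ => LabelEq.zero _ _ _, by simp [propBit]⟩, hf⟩
  · constructor
    · intro h D' hD' hl' hacc hlt
      -- The label of a state tells whether it is accepting.
      obtain ⟨α, hα, β, hβ, hlab⟩ := exists_labellings M.states
        (fun p => M.acc (M.last D) p) (fun p => M.acc (M.last D') p)
      rw [← hM.labels_eq] at hα hβ
      refine h ⟨M.last D, last_lt hF.1 hl, M.last D', last_lt hD'.1 (hl' ▸ hl), α, hα, β, hβ,
        (profile_iff hM h0 D _).2 ⟨hF.1, D', hD'.1, hl', α, hα, β, hβ, fun u hu => ?_, ?_⟩,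
        hF.2, hD'.2, fun p hp p' hp' he => iff_of_eq ((hlab p hp p' hp').1 he)⟩
      · rw [hlab _ (hM.run_lt h0 hF.1 hu) _ (hM.run_lt h0 hD'.1 (hl' ▸ hu))]
        exact propext (hacc u hu)
      · rw [propBit_of_true hlt]
    · rintro h ⟨i, -, j, -, α, -, β, -, hX, hi, hj, hacc⟩
      obtain ⟨hD, D', hD', hl', α₁, -, β₁, -, hrun, he⟩ := (profile_iff hM h0 D _).1 hX
      obtain ⟨rfl, rfl, hb, rfl, rfl⟩ := quintuple_inj.1 he
      refine h D' ⟨hD', hj⟩ hl' (fun u hu => ?_) (propBit_ne_zero.1 (by omega))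
      exact hacc _ (hM.run_lt h0 hD hu) _ (hM.run_lt h0 hD' (hl' ▸ hu)) (hrun u hu)

/-! ### Profiles as numbers -/

open Classical in
/-- The number whose bits below `Q` are given by `X`. -/
noncomputable def _root_.ofBitPred (Q : ℕ) (X : ℕ → Prop) : ℕ :=
  Nat.ofBits fun q : Fin Q => decide (X q)

theorem _root_.ofBitPred_lt (Q : ℕ) (X : ℕ → Prop) : ofBitPred Q X < 2 ^ Q :=
  Nat.ofBits_lt_two_pow _

theorem _root_.testBit_ofBitPred {Q q : ℕ} {X : ℕ → Prop} (hq : q < Q) :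
    (ofBitPred Q X).testBit q ↔ X q := by
  simp [ofBitPred, Nat.testBit_ofBits_lt _ _ hq]

theorem _root_.testBit_ofBitPred_of_imp {Q : ℕ} {X : ℕ → Prop} (hX : ∀ q, X q → q < Q) (q : ℕ) :
    (ofBitPred Q X).testBit q ↔ X q := by
  by_cases hq : q < Q
  · exact testBit_ofBitPred hq
  · rw [Nat.testBit_eq_false_of_lt ((ofBitPred_lt _ _).trans_le
      (Nat.pow_le_pow_right (by norm_num) (by omega)))]
    simp only [Bool.false_eq_true, false_iff]
    exact fun h => hq (hX q h)

/-- This replaces an equation for a number defined by its bits by a bounded formula about the bits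
of `y`, which a program can test. -/
theorem _root_.forall_testBit_iff {Q y : ℕ} (hy : y < 2 ^ Q) (X : ℕ → Prop) :
    (∀ q < Q, (y.testBit q ↔ X q)) ↔ ofBitPred Q X = y := by
  constructor
  · intro h
    refine Nat.eq_of_testBit_eq fun q => ?_
    by_cases hq : q < Q
    · rw [Bool.eq_iff_iff, testBit_ofBitPred hq, h q hq]
    · have : 2 ^ Q ≤ 2 ^ q := Nat.pow_le_pow_right (by norm_num) (by omega)
      rw [Nat.testBit_eq_false_of_lt (hy.trans_le this),
        Nat.testBit_eq_false_of_lt ((ofBitPred_lt _ _).trans_le this)]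
  · rintro rfl q hq
    exact testBit_ofBitPred hq

variable (M)

/-- The number of the profile of the empty sequence. -/
noncomputable def startNum (Q : ℕ) : ℕ := ofBitPred Q M.StartBit

/-- The action of a layer on the numbers of profiles. -/
noncomputable def nextNum (Q i x : ℕ) : ℕ := ofBitPred Q (M.NextBit (fun q => x.testBit q) i)

variable {M}

theorem Profile.lt {Q : ℕ} (hQ : (M.labels + M.size + 2) ^ 16 ≤ Q) (D : List ℕ) (q : ℕ)
    (h : M.Profile D q) : q < Q := by
  refine lt_of_lt_of_le ?_ hQ
  rcases D with _ | ⟨i, D⟩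
  · obtain ⟨α, hα, β, hβ, -, rfl⟩ := h
    apply quintuple_lt <;> omega
  · obtain ⟨i₀, -, j₀, -, b₀, -, α₀, -, β₀, -, -, hi, -, j, hj, -, α, hα, β, hβ, -, rfl⟩ := h
    have := propBit_le_one (j < i ∨ (j = i ∧ b₀ ≠ 0))
    apply quintuple_lt <;> omega

/-- All codes lie below `Q`, so truncation to `Q` bits loses nothing, and the state of the numerical
automaton after reading `D` is the whole profile of `D`. -/
theorem testBit_foldr {Q : ℕ} (hQ : (M.labels + M.size + 2) ^ 16 ≤ Q) (D : List ℕ) (q : ℕ) :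
    (D.foldr (M.nextNum Q) (M.startNum Q)).testBit q ↔ M.Profile D q := by
  induction D generalizing q with
  | nil => exact testBit_ofBitPred_of_imp (Profile.lt hQ []) q
  | cons i D ih =>
    have e : (fun q => ((D.foldr (M.nextNum Q) (M.startNum Q)).testBit q : Prop)) = M.Profile D :=
      funext fun q => propext (ih q)
    rw [List.foldr_cons, nextNum, e]
    exact testBit_ofBitPred_of_imp (Profile.lt hQ (i :: D)) q

open Classical in
/-- The number of functions that are computed by full sequences of length `k`. -/
theorem card_filter_minimalProfile (hM : M.Bounded) (h0 : 0 < M.states) {k Q : ℕ} (hk : 0 < k)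
    (hQ : (M.labels + M.size + 2) ^ 16 ≤ Q) {T : Type*} (F : List ℕ → T)
    (hF : ∀ D D', F D = F D' ↔ ∀ u ∈ words M.symbols k, (M.Accepts D u ↔ M.Accepts D' u)) :
    ((words M.size k).filter fun D => M.MinimalProfile
      fun q => (D.foldr (M.nextNum Q) (M.startNum Q)).testBit q).card =
      (F '' {D | M.Full D ∧ D.length = k}).ncard := by
  set I : Finset (List ℕ) := (words M.size k).filter fun D => M.MinimalProfile
      fun q => (D.foldr (M.nextNum Q) (M.startNum Q)).testBit q with hI
  have hmem : ∀ D, D ∈ I ↔ (M.Full D ∧ D.length = k) ∧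
      ∀ D', M.Full D' → D'.length = k → F D = F D' → ¬D' < D := by
    intro D
    have e : (fun q => ((D.foldr (M.nextNum Q) (M.startNum Q)).testBit q : Prop)) = M.Profile D :=
      funext fun q => propext (testBit_foldr hQ D q)
    rw [hI, Finset.mem_filter, e]
    constructor
    · rintro ⟨hw, hD⟩
      have hl := (mem_words.1 hw).1
      subst hl
      obtain ⟨h1, h2⟩ := (minimalProfile_iff hM h0 hk).1 hD
      exact ⟨⟨h1, rfl⟩, fun D' hD' hl' he => h2 D' hD' hl' ((hF D D').1 he)⟩
    · rintro ⟨⟨hD, rfl⟩, h⟩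
      exact ⟨hD.1.mem_words, (minimalProfile_iff hM h0 hk).2
        ⟨hD, fun D' hD' hl' he => h D' hD' hl' ((hF D D').2 he)⟩⟩
  -- There are finitely many words of length `k`, so every class of full sequences has a least
  -- member.
  have himage : F '' {D | M.Full D ∧ D.length = k} = F '' (I : Set (List ℕ)) := by
    apply Set.Subset.antisymm
    · rintro _ ⟨D, hD, rfl⟩
      have hfin : {D' | (M.Full D' ∧ D'.length = k) ∧ F D' = F D}.Finite :=
        (words M.size k).finite_toSet.subset fun D' h => h.1.2 ▸ h.1.1.1.mem_words
      obtain ⟨D', hD', hmin⟩ := Set.exists_min_image _ id hfin ⟨D, hD, rfl⟩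
      refine ⟨D', (hmem D').2 ⟨hD'.1, fun D'' h1 h2 h3 => ?_⟩, hD'.2⟩
      exact not_lt.2 (hmin D'' ⟨⟨h1, h2⟩, h3.symm.trans hD'.2⟩)
    · exact Set.image_mono fun D hD => ((hmem D).1 hD).1
  rw [himage, Set.InjOn.ncard_image, Set.ncard_coe_finset]
  intro D hD D' hD' he
  have h1 := (hmem D).1 hD
  have h2 := (hmem D').1 hD'
  -- Two minimal members of one class are comparable, hence equal.
  exact le_antisymm (not_lt.1 (h1.2 D' h2.1.1 h2.1.2 he)) (not_lt.1 (h2.2 D h1.1.1 h1.1.2 he.symm))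

end DetSystem

/-! ## Represented systems of layers -/

/-- A list of parameters that are represented. -/
def RamEnv (e : (ℕ → ℕ) → (ℕ → ℕ) → ℕ → ℕ) : Prop := ∀ i, RamComp 0 fun m σ => e m σ i

theorem RamEnv.tail {e : (ℕ → ℕ) → (ℕ → ℕ) → ℕ → ℕ} (he : RamEnv e) :
    RamEnv fun m σ => e m (envTail σ) := fun i => (he i).tail

/-- A family of systems whose components are represented. -/
structure RamSystem (sys : (ℕ → ℕ) → DetSystem) : Prop where
  size : ∀ {e}, RamEnv e → RamComp 0 fun m σ => (sys (e m σ)).size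
  states : ∀ {e}, RamEnv e → RamComp 0 fun m σ => (sys (e m σ)).states
  symbols : ∀ {e}, RamEnv e → RamComp 0 fun m σ => (sys (e m σ)).symbols
  labels : ∀ {e}, RamEnv e → RamComp 0 fun m σ => (sys (e m σ)).labels
  ini : ∀ {e f}, RamEnv e → RamComp 0 f → RamPred 0 fun m σ => (sys (e m σ)).ini (f m σ)
  fin : ∀ {e f}, RamEnv e → RamComp 0 f → RamPred 0 fun m σ => (sys (e m σ)).fin (f m σ)
  glue : ∀ {e f g}, RamEnv e → RamComp 0 f → RamComp 0 g →
    RamPred 0 fun m σ => (sys (e m σ)).glue (f m σ) (g m σ)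
  start : ∀ {e f}, RamEnv e → RamComp 0 f → RamComp 0 fun m σ => (sys (e m σ)).start (f m σ)
  trans : ∀ {e f g h}, RamEnv e → RamComp 0 f → RamComp 0 g → RamComp 0 h →
    RamComp 0 fun m σ => (sys (e m σ)).trans (f m σ) (g m σ) (h m σ)
  acc : ∀ {e f g}, RamEnv e → RamComp 0 f → RamComp 0 g →
    RamPred 0 fun m σ => (sys (e m σ)).acc (f m σ) (g m σ)

/-- Here and in the similar lemmas for systems, the proof term mirrors the defining formula. Every
bounded quantifier prepends a value to the environment, so `.var` numbers the bound variables from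
the innermost outwards, and functions from outside are shifted by `tail`. -/
theorem RamPred.labelEq {B α p β p' : (ℕ → ℕ) → (ℕ → ℕ) → ℕ} (hB : RamComp 0 B)
    (hα : RamComp 0 α) (hp : RamComp 0 p) (hβ : RamComp 0 β) (hp' : RamComp 0 p') :
    RamPred 0 fun m σ => LabelEq (B m σ) (α m σ) (p m σ) (β m σ) (p' m σ) :=
  .forall_lt hB (.iff (.testBit hα.tail (.add (.mul hp.tail hB.tail) (.var 0)))
    (.testBit hβ.tail (.add (.mul hp'.tail hB.tail) (.var 0))))

theorem RamComp.quintuple {f₁ f₂ f₃ f₄ f₅ : (ℕ → ℕ) → (ℕ → ℕ) → ℕ} (h₁ : RamComp 0 f₁)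
    (h₂ : RamComp 0 f₂) (h₃ : RamComp 0 f₃) (h₄ : RamComp 0 f₄) (h₅ : RamComp 0 f₅) :
    RamComp 0 fun m σ => quintuple (f₁ m σ) (f₂ m σ) (f₃ m σ) (f₄ m σ) (f₅ m σ) :=
  .pair h₁ (.pair h₂ (.pair h₃ (.pair h₄ h₅)))

namespace RamSystem

variable {sys : (ℕ → ℕ) → DetSystem} {e : (ℕ → ℕ) → (ℕ → ℕ) → ℕ → ℕ}
  {f g h : (ℕ → ℕ) → (ℕ → ℕ) → ℕ}

theorem trans' (H : RamSystem sys) (he : RamEnv e) (hf : RamComp 0 f) (hg : RamComp 0 g)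
    (hh : RamComp 0 h) :
    RamComp 0 fun m σ => (sys (e m σ)).trans' (f m σ) (g m σ) (h m σ) := by
  classical
  unfold DetSystem.trans'
  exact .ite (H.ini he hf) (H.trans he hf (H.start he hf) hh) (H.trans he hf hg hh)

theorem follows (H : RamSystem sys) (he : RamEnv e) (hf : RamComp 0 f) (hg : RamComp 0 g) :
    RamPred 0 fun m σ => (sys (e m σ)).Follows (f m σ) (g m σ) :=
  .or (.and (.eq hf (H.size he)) (H.ini he hg)) (.and (.not (.eq hf (H.size he)))
    (.and (.not (H.ini he hg)) (.and (.not (H.fin he hf)) (H.glue he hf hg))))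

theorem compat {α₀ β₀ i j α β : (ℕ → ℕ) → (ℕ → ℕ) → ℕ} (H : RamSystem sys) (he : RamEnv e)
    (hα₀ : RamComp 0 α₀) (hβ₀ : RamComp 0 β₀) (hi : RamComp 0 i) (hj : RamComp 0 j)
    (hα : RamComp 0 α) (hβ : RamComp 0 β) :
    RamPred 0 fun m σ =>
      (sys (e m σ)).Compat (α₀ m σ) (β₀ m σ) (i m σ) (j m σ) (α m σ) (β m σ) :=
  .forall_lt (H.states he) <| .forall_lt (H.states he.tail) <|
    .imp (.labelEq (H.states he.tail.tail).size hα₀.tail.tail (.var 1) hβ₀.tail.tail (.var 0)) <|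
    .forall_lt (H.symbols he.tail.tail) <| .labelEq (H.states he.tail.tail.tail).size
      hα.tail.tail.tail (H.trans' he.tail.tail.tail hi.tail.tail.tail (.var 2) (.var 0))
      hβ.tail.tail.tail (H.trans' he.tail.tail.tail hj.tail.tail.tail (.var 1) (.var 0))

theorem startBit (H : RamSystem sys) (he : RamEnv e) (hf : RamComp 0 f) :
    RamPred 0 fun m σ => (sys (e m σ)).StartBit (f m σ) :=
  .exists_lt (H.labels he) <| .exists_lt (H.labels he.tail) <|
    .and (.labelEq (H.states he.tail.tail).size (.var 1) (.const 0) (.var 0) (.const 0)) <|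
    .eq hf.tail.tail (.quintuple (H.size he.tail.tail) (H.size he.tail.tail) (.const 0) (.var 1)
      (.var 0))

theorem nextBit (H : RamSystem sys) (he : RamEnv e) (hf : RamComp 0 f) (hg : RamComp 0 g)
    (hh : RamComp 0 h) :
    RamPred 0 fun m σ =>
      (sys (e m σ)).NextBit (fun q => (f m σ).testBit q) (g m σ) (h m σ) :=
  have he5 := he.tail.tail.tail.tail.tail
  have he8 := he5.tail.tail.tail
  .exists_lt (.add (H.size he) (.const 1)) <| .exists_lt (.add (H.size he.tail) (.const 1)) <|
  .exists_lt (.const 2) <| .exists_lt (H.labels he.tail.tail.tail) <|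
  .exists_lt (H.labels he.tail.tail.tail.tail) <|
  .and (.testBit hf.tail.tail.tail.tail.tail
    (.quintuple (.var 4) (.var 3) (.var 2) (.var 1) (.var 0))) <|
  .and (.lt hg.tail.tail.tail.tail.tail (H.size he5)) <|
  .and (H.follows he5 (.var 4) hg.tail.tail.tail.tail.tail) <|
  .exists_lt (H.size he5) <| .and (H.follows he5.tail (.var 4) (.var 0)) <|
  .exists_lt (H.labels he5.tail) <| .exists_lt (H.labels he5.tail.tail) <|
  .and (H.compat he8 (.var 4) (.var 3) hg.tail.tail.tail.tail.tail.tail.tail.tail (.var 2) (.var 1)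
    (.var 0)) <|
  .eq hh.tail.tail.tail.tail.tail.tail.tail.tail <|
  .quintuple hg.tail.tail.tail.tail.tail.tail.tail.tail (.var 2)
    (RamPred.or (.lt (.var 2) hg.tail.tail.tail.tail.tail.tail.tail.tail)
      (.and (.eq (.var 2) hg.tail.tail.tail.tail.tail.tail.tail.tail) (.ne_zero (.var 5))))
    (.var 1) (.var 0)

theorem minimalProfile (H : RamSystem sys) (he : RamEnv e) (hf : RamComp 0 f) :
    RamPred 0 fun m σ => (sys (e m σ)).MinimalProfile fun q => (f m σ).testBit q :=
  have he4 := he.tail.tail.tail.tail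
  .and
  (.exists_lt (H.size he) <| .exists_lt (H.size he.tail) <| .exists_lt (.const 2) <|
    .exists_lt (H.labels he.tail.tail.tail) <| .exists_lt (H.labels he4) <|
    .and (.testBit hf.tail.tail.tail.tail.tail
      (.quintuple (.var 4) (.var 3) (.var 2) (.var 1) (.var 0))) (H.fin he4.tail (.var 4)))
  (.not <| .exists_lt (H.size he) <| .exists_lt (H.size he.tail) <|
    .exists_lt (H.labels he.tail.tail) <| .exists_lt (H.labels he.tail.tail.tail) <|
    .and (.testBit hf.tail.tail.tail.tail
      (.quintuple (.var 3) (.var 2) (.const 1) (.var 1) (.var 0))) <|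
    .and (H.fin he4 (.var 3)) <| .and (H.fin he4 (.var 2)) <|
    .forall_lt (H.states he4) <| .forall_lt (H.states he4.tail) <|
    .imp (.labelEq (H.states he4.tail.tail).size (.var 3) (.var 1) (.var 2) (.var 0)) <|
    .iff (H.acc he4.tail.tail (.var 5) (.var 1)) (H.acc he4.tail.tail (.var 4) (.var 0)))

end RamSystem

/-! ## The two systems that are given by an encoded list of layers

The parameters are the size of the alphabet, the width, the number of layers, the number whose
binary digits are the bits of the layers, the number of states and the number of labellings. -/

/-- The number of bits of a layer. -/
def layerBits (n w : ℕ) : ℕ := 2 + (w + w + w + w) + w * (n * w)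

/-- The bits of the layer `i`. -/
def codeBit (e : ℕ → ℕ) (i x : ℕ) : Prop := (e 3).testBit (i * layerBits (e 0) (e 1) + x)

/-- The left states of the layer `i`. -/
abbrev codeLeft (e : ℕ → ℕ) (i q : ℕ) : Prop := codeBit e i (2 + q)

/-- The right states of the layer `i`. -/
abbrev codeRight (e : ℕ → ℕ) (i q : ℕ) : Prop := codeBit e i (2 + (e 1 + q))

/-- The initial states of the layer `i`. -/
abbrev codeInitial (e : ℕ → ℕ) (i q : ℕ) : Prop := codeBit e i (2 + (e 1 + (e 1 + q)))

/-- The final states of the layer `i`. -/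
abbrev codeFinal (e : ℕ → ℕ) (i q : ℕ) : Prop := codeBit e i (2 + (e 1 + (e 1 + (e 1 + q))))

/-- The transitions of the layer `i`. -/
abbrev codeTrans (e : ℕ → ℕ) (i p a q : ℕ) : Prop :=
  codeBit e i (2 + (e 1 + (e 1 + (e 1 + (e 1 + (p * (e 0 * e 1) + (a * e 1 + q)))))))

open Classical in
/-- The sum of the numbers below `N` that satisfy `p`, which is used when there is at most one. -/
noncomputable def sumOf (N : ℕ) (p : ℕ → Prop) : ℕ := ∑ q ∈ Finset.range N, if p q then q else 0

theorem sumOf_eq {N q : ℕ} {p : ℕ → Prop} (hq : q < N) (hp : ∀ x < N, p x ↔ x = q) :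
    sumOf N p = q := by
  rw [sumOf, Finset.sum_eq_single q]
  · rw [if_pos ((hp q hq).2 rfl)]
  · intro x hx hne
    rw [if_neg fun h => hne ((hp x (Finset.mem_range.1 hx)).1 h)]
  · exact fun h => absurd (Finset.mem_range.2 hq) h

/-- If no number satisfies `p`, the sum takes the default value `0`; this is where `0 < N` enters.
-/
theorem sumOf_lt {N : ℕ} {p : ℕ → Prop} (h0 : 0 < N)
    (hp : ∀ x < N, ∀ y < N, p x → p y → x = y) : sumOf N p < N := by
  by_cases h : ∃ q < N, p q
  · obtain ⟨q, hq, hpq⟩ := h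
    rwa [sumOf_eq hq fun x hx => ⟨fun hx' => hp x hx q hq hx' hpq, fun e => e ▸ hpq⟩]
  · rw [sumOf, Finset.sum_eq_zero]
    · exact h0
    · exact fun x hx => if_neg fun hx' => h ⟨x, Finset.mem_range.1 hx, hx'⟩

theorem RamComp.sumOf {N : (ℕ → ℕ) → (ℕ → ℕ) → ℕ} {P : (ℕ → ℕ) → (ℕ → ℕ) → ℕ → Prop}
    (hN : RamComp 0 N) {κ : ℕ} (hP : RamPred κ fun m σ => P m (envTail σ) (σ 0)) :
    RamComp κ fun m σ => sumOf (N m σ) (P m σ) := by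
  classical
  unfold _root_.sumOf
  exact .sum (F := fun m σ x => if P m σ x then x else 0) hN (.ite hP (.var 0) (.const 0))

/-- The system of deterministic layers. -/
noncomputable def detSystem (e : ℕ → ℕ) : DetSystem where
  size := e 2
  states := e 4
  symbols := e 0
  labels := e 5
  ini i := codeBit e i 0
  fin i := codeBit e i 1
  glue i j := ∀ q < e 1, (codeRight e i q ↔ codeLeft e j q)
  start i := sumOf (e 4) (codeInitial e i)
  trans i p a := sumOf (e 4) (codeTrans e i p a)
  acc i p := codeFinal e i p

/-- The system of the layers that result from the subset construction. -/
noncomputable def subsetSystem (e : ℕ → ℕ) : DetSystem where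
  size := e 2
  states := e 4
  symbols := e 0
  labels := e 5
  ini i := codeBit e i 0
  fin i := codeBit e i 1
  glue i j := ∀ q < e 1, (codeRight e i q ↔ codeLeft e j q)
  start i := sumOf (e 4) fun Y => ∀ q < e 1, (Y.testBit q ↔ codeInitial e i q)
  trans i X a := sumOf (e 4) fun Y => ∀ q < e 1,
    (Y.testBit q ↔ ∃ p < e 1, X.testBit p ∧ codeTrans e i p a q)
  acc i X := ∃ p < e 1, X.testBit p ∧ codeFinal e i p

section

variable {e : (ℕ → ℕ) → (ℕ → ℕ) → ℕ → ℕ} {f g h p : (ℕ → ℕ) → (ℕ → ℕ) → ℕ}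

theorem RamEnv.codeBit (he : RamEnv e) (hf : RamComp 0 f) (hg : RamComp 0 g) :
    RamPred 0 fun m σ => codeBit (e m σ) (f m σ) (g m σ) :=
  .testBit (he 3) (.add (.mul hf (.add (.add (.const 2) (.add (.add (.add (he 1) (he 1)) (he 1))
    (he 1))) (.mul (he 1) (.mul (he 0) (he 1))))) hg)

theorem RamEnv.codeTrans (he : RamEnv e) (hf : RamComp 0 f) (hp : RamComp 0 p) (hg : RamComp 0 g)
    (hh : RamComp 0 h) :
    RamPred 0 fun m σ => codeTrans (e m σ) (f m σ) (p m σ) (g m σ) (h m σ) :=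
  he.codeBit hf (.add (.const 2) (.add (he 1) (.add (he 1) (.add (he 1) (.add (he 1)
    (.add (.mul hp (.mul (he 0) (he 1))) (.add (.mul hg (he 1)) hh)))))))

theorem RamEnv.codeInitial (he : RamEnv e) (hf : RamComp 0 f) (hp : RamComp 0 p) :
    RamPred 0 fun m σ => codeInitial (e m σ) (f m σ) (p m σ) :=
  he.codeBit hf (.add (.const 2) (.add (he 1) (.add (he 1) hp)))

theorem RamEnv.codeFinal (he : RamEnv e) (hf : RamComp 0 f) (hp : RamComp 0 p) :
    RamPred 0 fun m σ => codeFinal (e m σ) (f m σ) (p m σ) :=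
  he.codeBit hf (.add (.const 2) (.add (he 1) (.add (he 1) (.add (he 1) hp))))

theorem RamEnv.glue (he : RamEnv e) (hf : RamComp 0 f) (hg : RamComp 0 g) :
    RamPred 0 fun m σ => ∀ q < e m σ 1,
      (codeRight (e m σ) (f m σ) q ↔ codeLeft (e m σ) (g m σ) q) :=
  .forall_lt (he 1) (.iff (he.tail.codeBit hf.tail (.add (.const 2) (.add (he.tail 1) (.var 0))))
    (he.tail.codeBit hg.tail (.add (.const 2) (.var 0))))

end

theorem ramSystem_detSystem : RamSystem detSystem where
  size he := he 2
  states he := he 4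
  symbols he := he 0
  labels he := he 5
  ini he hf := he.codeBit hf (.const 0)
  fin he hf := he.codeBit hf (.const 1)
  glue he hf hg := he.glue hf hg
  start he hf := .sumOf (he 4) (he.tail.codeInitial hf.tail (.var 0))
  trans he hf hg hh := .sumOf (he 4) (he.tail.codeTrans hf.tail hg.tail hh.tail (.var 0))
  acc he hf hg := he.codeFinal hf hg

theorem ramSystem_subsetSystem : RamSystem subsetSystem where
  size he := he 2
  states he := he 4
  symbols he := he 0
  labels he := he 5
  ini he hf := he.codeBit hf (.const 0)
  fin he hf := he.codeBit hf (.const 1)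
  glue he hf hg := he.glue hf hg
  start he hf := .sumOf (he 4) <| .forall_lt (he.tail 1) <| .iff (.testBit (.var 1) (.var 0))
    (he.tail.tail.codeInitial hf.tail.tail (.var 0))
  trans he hf hg hh := .sumOf (he 4) <| .forall_lt (he.tail 1) <|
    .iff (.testBit (.var 1) (.var 0)) <| .exists_lt (he.tail.tail 1) <|
    .and (.testBit hg.tail.tail.tail (.var 0)) <| he.tail.tail.tail.codeTrans hf.tail.tail.tail
      (.var 0) hh.tail.tail.tail (.var 1)
  acc he hf hg := .exists_lt (he 1) <| .and (.testBit hg.tail (.var 0))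
    (he.tail.codeFinal hf.tail (.var 0))

/-! ## The counting program -/

/-- A bound for the codes that occur in profiles, in terms of the parameters. -/
def codeBound (e : ℕ → ℕ) : ℕ := (e 5 + e 2 + layerBits (e 0) (e 1) + 2) ^ 16

theorem RamEnv.codeBound {e : (ℕ → ℕ) → (ℕ → ℕ) → ℕ → ℕ} (he : RamEnv e) :
    RamComp 0 fun m σ => codeBound (e m σ) :=
  .pow (.add (.add (.add (he 5) (he 2)) (.add (.add (.const 2)
    (.add (.add (.add (he 1) (he 1)) (he 1)) (he 1))) (.mul (he 1) (.mul (he 0) (he 1)))))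
    (.const 2)) 16

section

variable {sys : (ℕ → ℕ) → DetSystem}

/-- The program that counts functions, after the parameters have been computed. -/
theorem exists_profile_program (H : RamSystem sys) (hsize : ∀ e, (sys e).size = e 2)
    (hlabels : ∀ e, (sys e).labels = e 5) :
    ∃ P c, ∀ (s : RAMState) (U K : ℕ), 2 ≤ U → (∀ i, s.reg (envReg i) ≤ U) →
      (∀ a, s.mem a ≤ 2 ^ K) → s.reg 2 ≤ K → (s.reg 3) ^ s.reg 2 ≤ 2 ^ K →
      s.reg 7 = 2 ^ codeBound (s.reg ∘ envReg) → 0 < s.reg 2 →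
      (sys (s.reg ∘ envReg)).Bounded → 0 < (sys (s.reg ∘ envReg)).states →
      ∀ (T : Type) (F : List ℕ → T), (∀ D D', F D = F D' ↔
        ∀ u ∈ words (sys (s.reg ∘ envReg)).symbols (s.reg 2),
          ((sys (s.reg ∘ envReg)).Accepts D u ↔ (sys (s.reg ∘ envReg)).Accepts D' u)) →
      RAMOutputsWithin P s
        (F '' {D | (sys (s.reg ∘ envReg)).Full D ∧ D.length = s.reg 2}).ncard
        (U ^ c * ((K + 1) * (s.reg 2 + 1))) := by
  have E : ∀ j, RamEnv fun _ σ i => σ (i + j) := fun j i => .var (i + j)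
  -- The automaton is presented by relations between the bits of profile numbers; `hst` and `hnx`
  -- identify them with the functions `startNum` and `nextNum`.
  obtain ⟨P, c, hP⟩ := exists_pathCount_program
    (start := fun σ y => ∀ q < codeBound σ, (y.testBit q ↔ (sys σ).StartBit q))
    (next := fun σ i x y => ∀ q < codeBound σ,
      (y.testBit q ↔ (sys σ).NextBit (fun q => x.testBit q) i q))
    (acc := fun σ x => (sys σ).MinimalProfile fun q => x.testBit q)
    (.forall_lt (E 1).codeBound (.iff (.testBit (.var 1) (.var 0)) (H.startBit (E 2) (.var 0))))
    (.forall_lt (E 3).codeBound (.iff (.testBit (.var 3) (.var 0))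
      (H.nextBit (E 4) (.var 2) (.var 1) (.var 0))))
    (H.minimalProfile (E 1) (.var 0))
  refine ⟨P, c, fun s U K hU hs hm hk hK hV hk0 hB h0 T F hF => ?_⟩
  set σ := s.reg ∘ envReg with hσ
  set Q := codeBound σ with hQ
  have hS : (sys σ).size = s.reg 3 := hsize σ
  have hcode : ((sys σ).labels + (sys σ).size + 2) ^ 16 ≤ Q := by
    rw [hlabels, hsize]
    exact Nat.pow_le_pow_left (by omega) _
  have hy₀ : (sys σ).startNum Q < s.reg 7 := by rw [hV]; exact ofBitPred_lt _ _
  have hstep : ∀ i x, (sys σ).nextNum Q i x < s.reg 7 := fun i x => by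
    rw [hV]; exact ofBitPred_lt _ _
  have hst : ∀ y < s.reg 7, (∀ q < Q, (y.testBit q ↔ (sys σ).StartBit q)) ↔
      (sys σ).startNum Q = y := fun y hy => forall_testBit_iff (hV ▸ hy) _
  have hnx : ∀ i < s.reg 3, ∀ x < s.reg 7, ∀ y < s.reg 7, (∀ q < Q, (y.testBit q ↔
      (sys σ).NextBit (fun q => x.testBit q) i q)) ↔ (sys σ).nextNum Q i x = y :=
    fun i _ x _ y hy => forall_testBit_iff (hV ▸ hy) _
  have h := hP s U K hU hs hm hk (fun t ht y hy => by
    refine (pathCount_le hy₀ hstep hst hnx t hy).trans ?_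
    -- Without layers, monotonicity of the power in `t` fails because `0 ^ 0 = 1`.
    rcases Nat.eq_zero_or_pos (s.reg 3) with h | h
    · rw [h]
      exact (pow_le_one₀ (by omega) (by omega)).trans Nat.one_le_two_pow
    · exact (Nat.pow_le_pow_right h ht).trans hK)
  rwa [sum_pathCount_eq hy₀ hstep hst hnx, ← hS, DetSystem.card_filter_minimalProfile hB h0 hk0
    hcode F hF] at h

/-- The program that counts functions, where `wid w` is the number of states. -/
theorem exists_count_program (H : RamSystem sys) (hsize : ∀ e, (sys e).size = e 2)
    (hlabels : ∀ e, (sys e).labels = e 5) {wid : ℕ → ℕ}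
    (hwid : ∃ P c, ∀ (s : RAMState) (U : ℕ), 2 ≤ U → (∀ i, s.reg (envReg i) ≤ U) →
      (∀ a, s.mem a ≤ 1) → wid (s.reg 1) ≤ U → ∃ s', RunsIn P s (U ^ c) s' ∧ s'.mem = s.mem ∧
          (∀ j < 8, j ≠ 5 → s'.reg j = s.reg j) ∧ s'.reg 5 = wid (s.reg 1)) :
    ∃ P c, ∀ (n w k S : ℕ) (s : RAMState), s.reg 0 = n → s.reg 1 = w → s.reg 2 = k → s.reg 3 = S →
      (∀ j < 8, 4 ≤ j → s.reg j = 0) → (∀ a, s.mem a ≤ 1) →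
      (∀ a, S * layerBits n w ≤ a → s.mem a = 0) → 0 < w → 0 < k →
      ∃ e : ℕ → ℕ, e 0 = n ∧ e 1 = w ∧ e 2 = S ∧ (∀ a, (e 3).testBit a ↔ s.mem a = 1) ∧
        e 4 = wid w ∧ e 5 = 2 ^ (wid w * (wid w).size) ∧
        ((sys e).Bounded → 0 < (sys e).states → ∀ (T : Type) (F : List ℕ → T),
          (∀ D D', F D = F D' ↔ ∀ u ∈ words (sys e).symbols k,
            ((sys e).Accepts D u ↔ (sys e).Accepts D' u)) →
          RAMOutputsWithin P s (F '' {D | (sys e).Full D ∧ D.length = k}).ncard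
            (2 ^ (c * codeBound e) * k ^ 2)) := by
  have E : RamEnv fun _ σ => σ := fun i => .var i
  obtain ⟨P₁, c₁, h₁⟩ := hwid
  obtain ⟨P₂, c₂, h₂⟩ := exists_assign_two_pow (f := fun _ σ => σ 4 * (σ 4).size)
    (.mul (.var 4) (RamComp.var 4).size) (r := 6) (by norm_num)
  obtain ⟨P₃, c₃, h₃⟩ := exists_assign_two_pow (f := fun _ σ => codeBound σ) E.codeBound (r := 7)
    (by norm_num)
  -- The input is packed into a single number, because the vector of path counts is going to
  -- overwrite the memory. That number is found by searching for the one whose bits match the cells.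
  obtain ⟨P₄, c₄, h₄⟩ := exists_assign (κ := 1)
    (f := fun m σ => sumOf (σ 6) fun y => ∀ a < codeBound σ, (y.testBit a ↔ m a ≠ 0))
    (.sumOf (.var 6) (.forall_lt E.tail.codeBound (.iff
      (RamPred.of_zero (.testBit (.var 1) (.var 0))) (.ne_zero (.read (.var 0)))))) 4
  obtain ⟨P₅, c₅, h₅⟩ := exists_profile_program H hsize hlabels
  refine ⟨.seq P₁ (.seq P₂ (.seq P₃ (.seq P₄ P₅))), c₁ + c₂ + c₃ + c₄ + c₅ + 5,
    fun n w k S s hn hw hk hS hz hm hmz hw0 hk0 => ?_⟩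
  set W := wid w with hW
  obtain ⟨A, hA⟩ : ∃ A, A = 2 ^ (W * W.size) := ⟨_, rfl⟩
  obtain ⟨L, hL⟩ : ∃ L, L = layerBits n w := ⟨_, rfl⟩
  -- `Q` bits accommodate both a profile and the packed input of `S * L` bits, and `U = 2 ^ Q`, the
  -- number of states of the automaton, bounds all parameters.
  obtain ⟨Q, hQ⟩ : ∃ Q, Q = (A + S + L + 2) ^ 16 := ⟨_, rfl⟩
  obtain ⟨U, hUdef⟩ : ∃ U, U = 2 ^ Q := ⟨_, rfl⟩
  rw [← hL] at hmz
  rw [← hA]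
  have hbase : A + S + L + 2 ≤ Q := by rw [hQ]; exact Nat.le_self_pow (by norm_num) _
  have hQU : Q < U := by rw [hUdef]; exact Nat.lt_two_pow_self
  have hU : 2 ≤ U := by omega
  have hAU : A ≤ U := by omega
  have hWA : W ≤ A := by
    rcases Nat.eq_zero_or_pos W with h | h
    · omega
    · exact hA ▸ (Nat.lt_size_self W).le.trans (Nat.pow_le_pow_right (by norm_num)
        (Nat.le_mul_of_pos_left _ h))
  have hnL : n ≤ L := by
    have h1 : n * w ≤ w * (n * w) := Nat.le_mul_of_pos_left _ hw0
    have h2 : n ≤ n * w := Nat.le_mul_of_pos_right _ hw0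
    simp only [hL, layerBits]
    omega
  have hwL : w ≤ L := by simp only [hL, layerBits]; omega
  have hSL : S * L ≤ Q := by
    calc S * L ≤ (A + S + L + 2) * (A + S + L + 2) := Nat.mul_le_mul (by omega) (by omega)
      _ = (A + S + L + 2) ^ 2 := by ring
      _ ≤ Q := by rw [hQ]; exact Nat.pow_le_pow_right (by omega) (by norm_num)
  have hle : ∀ s' : RAMState, s'.reg 0 = n → s'.reg 1 = w → s'.reg 3 = S → s'.reg 4 ≤ U →
      s'.reg 5 ≤ U → s'.reg 6 ≤ U → s'.reg 7 ≤ U → ∀ i, s'.reg (envReg i) ≤ U := by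
    intro s' a0 a1 a3 a4 a5 a6 a7 i
    unfold envReg
    split <;> omega
  have hcode : ∀ s' : RAMState, s'.reg 0 = n → s'.reg 1 = w → s'.reg 3 = S → s'.reg 6 = A →
      codeBound (s'.reg ∘ envReg) = Q := by
    rintro s' a0 a1 a3 a6
    simp only [codeBound, Function.comp_apply, envReg, a0, a1, a3, a6, hQ, hL]
  have hm0 : ∀ a, s.mem a ≤ 2 ^ 0 := by simpa using hm
  obtain ⟨s₁, hr₁, hm₁, hj₁, hd₁⟩ := h₁ s U hU (hle s hn hw hS (by simp [hz])
    (by simp [hz]) (by simp [hz]) (by simp [hz])) hm (by rw [hw]; omega)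
  rw [hw, ← hW] at hd₁
  have r1 : s₁.reg 0 = n ∧ s₁.reg 1 = w ∧ s₁.reg 2 = k ∧ s₁.reg 3 = S ∧ s₁.reg 4 = 0 ∧
      s₁.reg 6 = 0 ∧ s₁.reg 7 = 0 := by
    refine ⟨?_, ?_, ?_, ?_, ?_, ?_, ?_⟩ <;> rw [hj₁ _ (by norm_num) (by norm_num)] <;> simp [*]
  obtain ⟨a0, a1, a2, a3, a4, a6, a7⟩ := r1
  have e4 : (s₁.reg ∘ envReg) 4 = W := hd₁
  -- The memory still consists of single bits, so `K = 0` is a valid bound.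
  obtain ⟨s₂, hr₂, hm₂, hj₂, hd₂⟩ := h₂ s₁ U 0 hU (hle s₁ a0 a1 a3 (by omega) (by omega) (by omega)
    (by omega)) (by rwa [hm₁]) (by rw [e4, ← hA]; exact hAU)
  rw [e4, ← hA] at hd₂
  have r2 : s₂.reg 0 = n ∧ s₂.reg 1 = w ∧ s₂.reg 2 = k ∧ s₂.reg 3 = S ∧ s₂.reg 4 = 0 ∧
      s₂.reg 5 = W ∧ s₂.reg 7 = 0 := by
    exact ⟨(hj₂ _ (by norm_num) (by norm_num)).trans a0,
      (hj₂ _ (by norm_num) (by norm_num)).trans a1,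
      (hj₂ _ (by norm_num) (by norm_num)).trans a2,
      (hj₂ _ (by norm_num) (by norm_num)).trans a3,
      (hj₂ _ (by norm_num) (by norm_num)).trans a4,
      (hj₂ _ (by norm_num) (by norm_num)).trans hd₁,
      (hj₂ _ (by norm_num) (by norm_num)).trans a7⟩
  obtain ⟨b0, b1, b2, b3, b4, b5, b7⟩ := r2
  have eQ₂ : codeBound (s₂.reg ∘ envReg) = Q := hcode s₂ b0 b1 b3 hd₂
  obtain ⟨s₃, hr₃, hm₃, hj₃, hd₃⟩ := h₃ s₂ U 0 hU (hle s₂ b0 b1 b3 (by omega) (by omega) (by omega)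
    (by omega)) (by rwa [hm₂, hm₁]) (by rw [eQ₂, ← hUdef])
  rw [eQ₂, ← hUdef] at hd₃
  have r3 : s₃.reg 0 = n ∧ s₃.reg 1 = w ∧ s₃.reg 2 = k ∧ s₃.reg 3 = S ∧ s₃.reg 4 = 0 ∧
      s₃.reg 5 = W ∧ s₃.reg 6 = A := by
    exact ⟨(hj₃ _ (by norm_num) (by norm_num)).trans b0,
      (hj₃ _ (by norm_num) (by norm_num)).trans b1,
      (hj₃ _ (by norm_num) (by norm_num)).trans b2,
      (hj₃ _ (by norm_num) (by norm_num)).trans b3,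
      (hj₃ _ (by norm_num) (by norm_num)).trans b4,
      (hj₃ _ (by norm_num) (by norm_num)).trans b5,
      (hj₃ _ (by norm_num) (by norm_num)).trans hd₂⟩
  obtain ⟨c0, c1, c2, c3, c4, c5, c6⟩ := r3
  obtain ⟨s₄, hr₄, hm₄, hj₄, hd₄⟩ := h₄ s₃ U 0 hU (hle s₃ c0 c1 c3 (by omega) (by omega) (by omega)
    (by omega)) (by rwa [hm₃, hm₂, hm₁])
  have eQ₃ : codeBound (s₃.reg ∘ envReg) = Q := hcode s₃ c0 c1 c3 c6
  have e6 : (s₃.reg ∘ envReg) 6 = U := hd₃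
  obtain ⟨z, hzdef⟩ : ∃ z, z = ofBitPred Q fun a => s.mem a ≠ 0 := ⟨_, rfl⟩
  have hzU : z < U := by rw [hzdef, hUdef]; exact ofBitPred_lt _ _
  rw [eQ₃, e6, hm₃, hm₂, hm₁, sumOf_eq (q := z) hzU (fun y hy => by
    rw [hzdef, eq_comm]; exact forall_testBit_iff (by rwa [← hUdef]) _)] at hd₄
  have r4 : s₄.reg 0 = n ∧ s₄.reg 1 = w ∧ s₄.reg 2 = k ∧ s₄.reg 3 = S ∧ s₄.reg 5 = W ∧
      s₄.reg 6 = A ∧ s₄.reg 7 = U := by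
    exact ⟨(hj₄ _ (by norm_num) (by norm_num)).trans c0,
      (hj₄ _ (by norm_num) (by norm_num)).trans c1,
      (hj₄ _ (by norm_num) (by norm_num)).trans c2,
      (hj₄ _ (by norm_num) (by norm_num)).trans c3,
      (hj₄ _ (by norm_num) (by norm_num)).trans c5,
      (hj₄ _ (by norm_num) (by norm_num)).trans c6,
      (hj₄ _ (by norm_num) (by norm_num)).trans hd₃⟩
  obtain ⟨d0, d1, d2, d3, d5, d6, d7⟩ := r4
  have hmem₄ : s₄.mem = s.mem := by rw [hm₄, hm₃, hm₂, hm₁]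
  have eQ₄ : codeBound (s₄.reg ∘ envReg) = Q := hcode s₄ d0 d1 d3 d6
  refine ⟨s₄.reg ∘ envReg, d0, d1, d3, fun a => ?_, d5, d6, fun hB h0 T F hF => ?_⟩
  · show (s₄.reg 4).testBit a ↔ _
    rw [hd₄, hzdef, testBit_ofBitPred_of_imp fun a ha => by
      by_contra h
      exact ha (hmz a (by omega))]
    have := hm a
    omega
  -- With `S + 1` instead of `S`, the exponent also bounds `k` itself, even if `S = 0`.
  · have hK : S ^ k ≤ 2 ^ ((S + 1) * k) := by
      rw [pow_mul]
      exact Nat.pow_le_pow_left (Nat.lt_two_pow_self.le.trans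
        (Nat.pow_le_pow_right (by norm_num) (by omega))) _
    obtain ⟨t, s₅, hr₅, ht, hv⟩ := h₅ s₄ U ((S + 1) * k) hU (hle s₄ d0 d1 d3 (by omega) (by omega)
      (by omega) (by omega)) (fun a => by
        rw [hmem₄]; exact (hm a).trans Nat.one_le_two_pow)
      (by rw [d2]; exact Nat.le_mul_of_pos_left _ (by omega)) (by rwa [d2, d3])
      (by rw [eQ₄, d7, hUdef]) (by omega) hB h0 T F (by rwa [d2])
    rw [d2] at hv ht
    obtain ⟨t', hr', ht'⟩ := hr₁.seq (hr₂.seq (hr₃.seq (hr₄.seq ⟨t, hr₅, ht⟩)))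
    refine ⟨t', s₅, hr', ht'.trans ?_, hv⟩
    rw [eQ₄, Nat.mul_comm _ Q, pow_mul, ← hUdef]
    set c := c₁ + c₂ + c₃ + c₄ + c₅ with hc
    have hUpos : 0 < U := by omega
    have hk2 : 1 ≤ k ^ 2 := Nat.pow_pos hk0
    have p : ∀ i ≤ c + 2, U ^ i ≤ U ^ (c + 2) * k ^ 2 := fun i hi =>
      (Nat.pow_le_pow_right hUpos hi).trans (Nat.le_mul_of_pos_right _ hk2)
    -- One factor is the bit length of the path counts, the other the number of products; together
    -- they give `k ^ 2`.
    have h5 : U ^ c₅ * (((S + 1) * k + 1) * (k + 1)) ≤ U ^ (c + 2) * k ^ 2 := by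
      calc U ^ c₅ * (((S + 1) * k + 1) * (k + 1)) ≤ U ^ c * ((U * k) * (U * k)) := by
            refine Nat.mul_le_mul (Nat.pow_le_pow_right hUpos (by omega)) (Nat.mul_le_mul ?_ ?_)
            · calc (S + 1) * k + 1 ≤ (S + 1) * k + k := by omega
                _ = (S + 2) * k := by ring
                _ ≤ U * k := Nat.mul_le_mul_right _ (by omega)
            · calc k + 1 ≤ 2 * k := by omega
                _ ≤ U * k := Nat.mul_le_mul_right _ hU
        _ = _ := by ring
    have h6 := mul_le_pow_add_mul (c := c + 2) (X := k ^ 2) (n := 5) (e := 3) hU (by norm_num)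
    have := p c₁ (by omega)
    have := p c₂ (by omega)
    have := p c₃ (by omega)
    have := p c₄ (by omega)
    rw [show c + 5 = c + 2 + 3 by omega, mul_zero, zero_add, mul_one]
    omega

end

/-! ## Decoding lists of layers -/

theorem List.getD_append_add {α : Type*} {l l' : List α} {m : ℕ} (h : l.length = m) (x : ℕ) (d : α) :
    (l ++ l').getD (m + x) d = l'.getD x d := by
  rw [List.getD_append_right _ _ _ _ (by omega)]
  congr 1
  omega

theorem List.getD_map_finRange {α : Type*} {w : ℕ} (f : Fin w → α) (q : Fin w) (d : α) :
    ((List.finRange w).map f).getD q d = f q := by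
  rw [List.getD_eq_getElem _ _ (by simp)]
  simp

theorem List.getD_flatMap_of_length {α β : Type*} {l : List α} {f : α → List β} {L : ℕ}
    (hf : ∀ a ∈ l, (f a).length = L) {i x : ℕ} (hi : i < l.length) (hx : x < L) (d : β) :
    (l.flatMap f).getD (i * L + x) d = (f l[i]).getD x d := by
  induction l generalizing i with
  | nil => simp at hi
  | cons a l ih =>
    have ha : (f a).length = L := hf a (by simp)
    rw [List.flatMap_cons]
    rcases i with _ | i
    · rw [List.getD_append _ _ _ _ (by omega)]
      simp
    · rw [show (i + 1) * L + x = L + (i * L + x) by ring, List.getD_append_add ha]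
      simpa using ih (fun b hb => hf b (by simp [hb])) (by simpa using hi)

theorem List.length_flatMap_of_length {α β : Type*} {l : List α} {f : α → List β} {L : ℕ}
    (hf : ∀ a ∈ l, (f a).length = L) : (l.flatMap f).length = l.length * L := by
  induction l with
  | nil => simp
  | cons a l ih =>
    rw [List.flatMap_cons, List.length_append, hf a (by simp), ih fun b hb => hf b (by simp [hb]),
      List.length_cons]
    ring

instance {A : Type u} {w : ℕ} : Inhabited (Layer A w) where
  default :=
    { leftStates := ∅, rightStates := ∅, transitions := ∅, initialStates := ∅, finalStates := ∅
      initialFlag := false, finalFlag := false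
      transitions_subset := by simp
      initialStates_subset := by simp
      finalStates_subset := by simp
      initialStates_eq_empty := by simp
      finalStates_eq_empty := by simp }

section Encode

variable {A : Type u} {n w : ℕ} (ε : A ≃ Fin n) (B : Layer A w)

theorem Layer.encode_eq : B.encode ε =
    propBit (B.initialFlag = true) :: propBit (B.finalFlag = true) ::
    ((List.finRange w).map (fun q => propBit (q ∈ B.leftStates)) ++
    ((List.finRange w).map (fun q => propBit (q ∈ B.rightStates)) ++
    ((List.finRange w).map (fun q => propBit (q ∈ B.initialStates)) ++
    ((List.finRange w).map (fun q => propBit (q ∈ B.finalStates)) ++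
    (List.finRange w).flatMap fun p => (List.finRange n).flatMap fun a =>
      (List.finRange w).map fun q => propBit ((p, ε.symm a, q) ∈ B.transitions))))) := by
  simp [Layer.encode]

theorem Layer.length_transitions_encode (p : Fin w) :
    ((List.finRange n).flatMap fun a => (List.finRange w).map fun q =>
      propBit ((p, ε.symm a, q) ∈ B.transitions)).length = n * w := by
  rw [List.length_flatMap_of_length (L := w) (by simp)]
  simp

theorem Layer.length_encode : (B.encode ε).length = layerBits n w := by
  rw [B.encode_eq]
  simp only [List.length_cons, List.length_append, List.length_map, List.length_finRange]
  rw [List.length_flatMap_of_length fun p _ => B.length_transitions_encode ε p]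
  simp [layerBits]
  ring

theorem Layer.getD_encode_left (q : Fin w) :
    (B.encode ε).getD (2 + q) 0 = propBit (q ∈ B.leftStates) := by
  rw [B.encode_eq, Nat.add_comm]
  simp only [List.getD_cons_succ]
  rw [List.getD_append _ _ _ _ (by simp), List.getD_map_finRange]

theorem Layer.getD_encode_right (q : Fin w) :
    (B.encode ε).getD (2 + (w + q)) 0 = propBit (q ∈ B.rightStates) := by
  rw [B.encode_eq, Nat.add_comm]
  simp only [List.getD_cons_succ]
  rw [List.getD_append_add (by simp), List.getD_append _ _ _ _ (by simp), List.getD_map_finRange]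

theorem Layer.getD_encode_initial (q : Fin w) :
    (B.encode ε).getD (2 + (w + (w + q))) 0 = propBit (q ∈ B.initialStates) := by
  rw [B.encode_eq, Nat.add_comm]
  simp only [List.getD_cons_succ]
  rw [List.getD_append_add (by simp), List.getD_append_add (by simp),
    List.getD_append _ _ _ _ (by simp), List.getD_map_finRange]

theorem Layer.getD_encode_final (q : Fin w) :
    (B.encode ε).getD (2 + (w + (w + (w + q)))) 0 = propBit (q ∈ B.finalStates) := by
  rw [B.encode_eq, Nat.add_comm]
  simp only [List.getD_cons_succ]
  rw [List.getD_append_add (by simp), List.getD_append_add (by simp),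
    List.getD_append_add (by simp), List.getD_append _ _ _ _ (by simp), List.getD_map_finRange]

theorem Layer.getD_encode_transitions (p : Fin w) (a : A) (q : Fin w) :
    (B.encode ε).getD (2 + (w + (w + (w + (w + (p * (n * w) + (ε a * w + q))))))) 0 =
      propBit ((p, a, q) ∈ B.transitions) := by
  have h1 : (ε a : ℕ) * w + q < n * w := by
    calc (ε a : ℕ) * w + q < ε a * w + w := by omega
      _ = (ε a + 1) * w := by ring
      _ ≤ n * w := Nat.mul_le_mul_right _ (ε a).2
  rw [B.encode_eq, Nat.add_comm]
  simp only [List.getD_cons_succ]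
  rw [List.getD_append_add (by simp), List.getD_append_add (by simp),
    List.getD_append_add (by simp), List.getD_append_add (by simp),
    List.getD_flatMap_of_length (fun p _ => B.length_transitions_encode ε p) (by simp) h1,
    List.getD_flatMap_of_length (L := w) (by simp) (by simp) q.2, List.getD_map_finRange]
  simp

end Encode

/-- The parameters `e` describe the list `Ls` of layers. -/
structure Describes {A : Type u} {n w : ℕ} (ε : A ≃ Fin n) (Ls : List (Layer A w)) (e : ℕ → ℕ) :
    Prop where
  symbols : e 0 = n
  width : e 1 = w
  size : e 2 = Ls.length
  ini : ∀ i < Ls.length, (codeBit e i 0 ↔ (Ls.getD i default).initialFlag = true)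
  fin : ∀ i < Ls.length, (codeBit e i 1 ↔ (Ls.getD i default).finalFlag = true)
  left : ∀ i < Ls.length, ∀ q : Fin w, (codeLeft e i q ↔ q ∈ (Ls.getD i default).leftStates)
  right : ∀ i < Ls.length, ∀ q : Fin w, (codeRight e i q ↔ q ∈ (Ls.getD i default).rightStates)
  initial : ∀ i < Ls.length, ∀ q : Fin w,
    (codeInitial e i q ↔ q ∈ (Ls.getD i default).initialStates)
  final : ∀ i < Ls.length, ∀ q : Fin w, (codeFinal e i q ↔ q ∈ (Ls.getD i default).finalStates)
  trans : ∀ i < Ls.length, ∀ (p : Fin w) (a : A) (q : Fin w),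
    (codeTrans e i p (ε a) q ↔ (p, a, q) ∈ (Ls.getD i default).transitions)

theorem propBit_eq_one {p : Prop} : propBit p = 1 ↔ p := by
  by_cases h : p <;> simp [propBit, h]

/-- All layers are encoded by blocks of the same length `layerBits n w`, so the bits of layer `i`
begin at `i * layerBits n w`, and the offsets inside a block are those of `Layer.encode`. -/
theorem describes_of_testBit {A : Type u} {n w : ℕ} (ε : A ≃ Fin n) (Ls : List (Layer A w)) (k : ℕ)
    {e : ℕ → ℕ} (h0 : e 0 = n) (h1 : e 1 = w) (h2 : e 2 = Ls.length)
    (h3 : ∀ a, (e 3).testBit a ↔ (countingInput ε Ls k).mem a = 1) : Describes ε Ls e := by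
  have key : ∀ i < Ls.length, ∀ x < layerBits n w, ∀ p : Prop,
      ((Ls.getD i default).encode ε).getD x 0 = propBit p → (codeBit e i x ↔ p) := by
    intro i hi x hx p hp
    rw [codeBit, h3, h0, h1]
    show (Ls.flatMap (Layer.encode ε)).getD _ 0 = 1 ↔ p
    rw [List.getD_flatMap_of_length (fun B _ => B.length_encode ε) hi hx,
      ← List.getD_eq_getElem _ default hi, hp, propBit_eq_one]
  have hL : layerBits n w = 2 + (w + w + w + w) + w * (n * w) := rfl
  refine ⟨h0, h1, h2, fun i hi => ?_, fun i hi => ?_, fun i hi q => ?_, fun i hi q => ?_,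
    fun i hi q => ?_, fun i hi q => ?_, fun i hi p a q => ?_⟩
  · exact key i hi 0 (by omega) _ (by rw [Layer.encode_eq]; rfl)
  · exact key i hi 1 (by omega) _ (by rw [Layer.encode_eq]; rfl)
  · exact key i hi _ (by omega) _ (Layer.getD_encode_left ..)
  · rw [codeRight, h1]
    exact key i hi _ (by omega) _ (Layer.getD_encode_right ..)
  · rw [codeInitial, h1]
    exact key i hi _ (by omega) _ (Layer.getD_encode_initial ..)
  · rw [codeFinal, h1]
    exact key i hi _ (by omega) _ (Layer.getD_encode_final ..)
  · rw [codeTrans, h0, h1]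
    refine key i hi _ ?_ _ (Layer.getD_encode_transitions ..)
    have h1 : (ε a : ℕ) * w + q < n * w := by
      calc (ε a : ℕ) * w + q < ε a * w + w := by omega
        _ = (ε a + 1) * w := by ring
        _ ≤ n * w := Nat.mul_le_mul_right _ (ε a).2
    have h2 : (p : ℕ) * (n * w) + ((ε a : ℕ) * w + q) < w * (n * w) := by
      calc (p : ℕ) * (n * w) + ((ε a : ℕ) * w + q) < p * (n * w) + n * w := by omega
        _ = (p + 1) * (n * w) := by ring
        _ ≤ w * (n * w) := Nat.mul_le_mul_right _ p.2
    omega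

theorem countingInput_mem_le {A : Type u} {n w : ℕ} (ε : A ≃ Fin n) (Ls : List (Layer A w))
    (k a : ℕ) : (countingInput ε Ls k).mem a ≤ 1 := by
  show (Ls.flatMap (Layer.encode ε)).getD a 0 ≤ 1
  by_cases ha : a < (Ls.flatMap (Layer.encode ε)).length
  · rw [List.getD_eq_getElem _ _ ha]
    have h := List.getElem_mem ha
    generalize (Ls.flatMap (Layer.encode ε))[a] = y at h
    simp only [Layer.encode, List.mem_flatMap, List.mem_append, List.mem_map, List.mem_cons,
      List.not_mem_nil, or_false] at h
    obtain ⟨B, -, h⟩ := h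
    rcases h with ((((( rfl | rfl) | ⟨q, -, rfl⟩) | ⟨q, -, rfl⟩) | ⟨q, -, rfl⟩) | ⟨q, -, rfl⟩) |
      ⟨p, -, a, -, q, -, rfl⟩ <;> exact propBit_le_one _
  · rw [List.getD_eq_default _ _ (by omega)]
    exact Nat.zero_le _

theorem countingInput_mem_eq_zero {A : Type u} {n w : ℕ} (ε : A ≃ Fin n) (Ls : List (Layer A w))
    (k : ℕ) {a : ℕ} (ha : Ls.length * layerBits n w ≤ a) : (countingInput ε Ls k).mem a = 0 := by
  show (Ls.flatMap (Layer.encode ε)).getD a 0 = 0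
  rw [List.getD_eq_default]
  rwa [List.length_flatMap_of_length fun B _ => B.length_encode ε]

/-! ## Sequences as functions of the position -/

/-- The list `[x (t - 1), …, x 0]`. -/
def revPrefix (x : ℕ → ℕ) : ℕ → List ℕ
  | 0 => []
  | t + 1 => x t :: revPrefix x t

@[simp] theorem length_revPrefix (x : ℕ → ℕ) (t : ℕ) : (revPrefix x t).length = t := by
  induction t with
  | zero => rfl
  | succ t ih => simp [revPrefix, ih]

theorem revPrefix_congr {x y : ℕ → ℕ} {t : ℕ} (h : ∀ i < t, x i = y i) :
    revPrefix x t = revPrefix y t := by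
  induction t with
  | zero => rfl
  | succ t ih => rw [revPrefix, revPrefix, h t (by omega), ih fun i hi => h i (by omega)]

theorem exists_revPrefix (D : List ℕ) : ∃ x, D = revPrefix x D.length := by
  induction D with
  | nil => exact ⟨fun _ => 0, rfl⟩
  | cons i D ih =>
    obtain ⟨x, hx⟩ := ih
    refine ⟨Function.update x D.length i, ?_⟩
    rw [List.length_cons, revPrefix, Function.update_self]
    congr 1
    conv_lhs => rw [hx]
    exact revPrefix_congr fun j hj => by rw [Function.update_of_ne (by omega)]

theorem revPrefix_mem_words {x : ℕ → ℕ} {S t : ℕ} :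
    revPrefix x t ∈ words S t ↔ ∀ i < t, x i < S := by
  induction t with
  | zero => simp [revPrefix, words]
  | succ t ih =>
    rw [revPrefix, cons_mem_words, ih]
    constructor
    · rintro ⟨h1, h2⟩ i hi
      rcases Nat.lt_succ_iff_lt_or_eq.1 hi with h | rfl
      exacts [h2 i h, h1]
    · exact fun h => ⟨h t (by omega), fun i hi => h i (by omega)⟩

/-- The predecessor of the first layer is the sentinel `M.size`, while later predecessors are
indices below it; hence the two alternatives of `Follows` are told apart by `i = 0`. -/
theorem DetSystem.valid_revPrefix (M : DetSystem) (x : ℕ → ℕ) (t : ℕ) :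
    M.Valid (revPrefix x t) ↔ ∀ i < t, x i < M.size ∧ ((i = 0 ∧ M.ini (x i)) ∨
      (i ≠ 0 ∧ ¬M.ini (x i) ∧ ¬M.fin (x (i - 1)) ∧ M.glue (x (i - 1)) (x i))) := by
  induction t with
  | zero => simp [revPrefix, DetSystem.Valid]
  | succ t ih =>
    rw [revPrefix, DetSystem.Valid, ih]
    constructor
    · rintro ⟨h1, h2, h3⟩ i hi
      rcases Nat.lt_succ_iff_lt_or_eq.1 hi with h | rfl
      · exact h3 i h
      · refine ⟨h1, ?_⟩
        rcases i with _ | i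
        · simpa [DetSystem.Follows, revPrefix, DetSystem.last] using h2
        · have := (h3 i (by omega)).1.ne
          simpa [DetSystem.Follows, revPrefix, DetSystem.last, this] using h2
    · intro h
      refine ⟨(h t (by omega)).1, ?_, fun i hi => h i (by omega)⟩
      have h2 := (h t (by omega)).2
      rcases t with _ | t
      · simpa [DetSystem.Follows, revPrefix, DetSystem.last] using h2
      · have := (h t (by omega)).1.ne
        simpa [DetSystem.Follows, revPrefix, DetSystem.last, this] using h2

/-! ## Reachable states -/

/-- The states that are reached by the first `t` layers on a string. -/
def reachSet {A : Type u} {w : ℕ} (D : ℕ → Layer A w) (s : ℕ → A) : ℕ → Set (Fin w)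
  | 0 => (D 0).initialStates
  | t + 1 => {q | ∃ p ∈ reachSet D s t, (p, s t, q) ∈ (D t).transitions}

theorem exists_path {A : Type u} {w : ℕ} {D : ℕ → Layer A w} {s : ℕ → A} {t : ℕ} {q : Fin w}
    (hq : q ∈ reachSet D s t) : ∃ P : ℕ → Fin w, P 0 ∈ (D 0).initialStates ∧ P t = q ∧
      ∀ i < t, (P i, s i, P (i + 1)) ∈ (D i).transitions := by
  induction t generalizing q with
  | zero => exact ⟨fun _ => q, hq, rfl, by simp⟩
  | succ t ih =>
    obtain ⟨p, hp, hpq⟩ := hq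
    obtain ⟨P, h0, ht, h⟩ := ih hp
    refine ⟨Function.update P (t + 1) q, ?_, Function.update_self .., fun i hi => ?_⟩
    · rwa [Function.update_of_ne (by omega)]
    · rw [Function.update_of_ne (by omega)]
      rcases Nat.lt_succ_iff_lt_or_eq.1 hi with hi' | rfl
      · rw [Function.update_of_ne (by omega)]
        exact h i hi'
      · rw [Function.update_self, ht]
        exact hpq

theorem oddAccepts_iff {A : Type u} {w : ℕ} (D : ℕ → Layer A w) (s : ℕ → A) {k : ℕ} (hk : 0 < k) :
    ODDAccepts (fun i : Fin k => D i) (fun i => s i) ↔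
      ∃ q ∈ reachSet D s k, q ∈ (D (k - 1)).finalStates := by
  constructor
  · rintro ⟨p, q, hT, hpq, h0, hF⟩
    have key : ∀ t (ht : t < k), q ⟨t, ht⟩ ∈ reachSet D s (t + 1) := by
      intro t
      induction t with
      | zero => exact fun ht => ⟨p ⟨0, ht⟩, h0 ⟨0, ht⟩ rfl, hT ⟨0, ht⟩⟩
      | succ t ih =>
        intro ht
        refine ⟨p ⟨t + 1, ht⟩, ?_, hT ⟨t + 1, ht⟩⟩
        rw [hpq ⟨t, by omega⟩ ⟨t + 1, ht⟩ rfl]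
        exact ih _
    refine ⟨q ⟨k - 1, by omega⟩, ?_, hF ⟨k - 1, by omega⟩ (by simp; omega)⟩
    have := key (k - 1) (by omega)
    rwa [show k - 1 + 1 = k by omega] at this
  · rintro ⟨q, hq, hF⟩
    obtain ⟨P, h0, hk', h⟩ := exists_path hq
    refine ⟨fun i => P i, fun i => P (i + 1), fun i => h i i.2, fun i j hij => by simp [hij],
      fun i hi => ?_, fun i hi => ?_⟩
    · simpa [hi] using h0
    · simp only [hi, hk']
      rwa [show (i : ℕ) = k - 1 by omega]

/-- A relation between the states of a system and sets of states that is preserved by the layers is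
satisfied by the states that are reached. -/
theorem run_revPrefix_rel {A : Type u} {w : ℕ} {M : DetSystem} {D : ℕ → Layer A w} {s : ℕ → A}
    {x u : ℕ → ℕ} {k : ℕ} (hx : M.Valid (revPrefix x k)) (R : ℕ → ℕ → Set (Fin w) → Prop)
    (h0 : 0 < k → R 0 (M.start (x 0)) (reachSet D s 0))
    (hs : ∀ t < k, ∀ X, R t X (reachSet D s t) →
      R (t + 1) (M.trans (x t) X (u t)) (reachSet D s (t + 1))) :
    ∀ t < k, R (t + 1) (M.run (revPrefix x (t + 1)) (revPrefix u (t + 1))) (reachSet D s (t + 1)) := by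
  rw [DetSystem.valid_revPrefix] at hx
  intro t
  induction t with
  | zero =>
    intro ht
    obtain ⟨-, ⟨-, h⟩ | ⟨h, -⟩⟩ := hx 0 ht
    · simp only [revPrefix, DetSystem.run, DetSystem.trans', if_pos h]
      exact hs 0 ht _ (h0 ht)
    · exact absurd rfl h
  | succ t ih =>
    intro ht
    obtain ⟨-, ⟨h, -⟩ | ⟨-, h, -⟩⟩ := hx (t + 1) ht
    · omega
    · show R _ (M.trans' (x (t + 1)) (M.run (revPrefix x (t + 1)) (revPrefix u (t + 1))) (u (t + 1))) _
      rw [DetSystem.trans', if_neg h]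
      exact hs (t + 1) ht _ (ih (by omega))

/-! ## Counting functions by counting sequences -/

section Count

variable {A : Type u} {n w : ℕ} {ε : A ≃ Fin n} {Ls : List (Layer A w)} {e : ℕ → ℕ}

/-- The components that the two systems of an encoded list of layers have in common. -/
structure IsCodeSystem (M : DetSystem) (e : ℕ → ℕ) : Prop where
  size : M.size = e 2
  states : M.states = e 4
  symbols : M.symbols = e 0
  labels : M.labels = e 5
  ini : ∀ i, M.ini i ↔ codeBit e i 0
  fin : ∀ i, M.fin i ↔ codeBit e i 1
  glue : ∀ i j, M.glue i j ↔ ∀ q < e 1, (codeRight e i q ↔ codeLeft e j q)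

theorem isCodeSystem_detSystem (e : ℕ → ℕ) : IsCodeSystem (detSystem e) e :=
  ⟨rfl, rfl, rfl, rfl, fun _ => Iff.rfl, fun _ => Iff.rfl, fun _ _ => Iff.rfl⟩

theorem isCodeSystem_subsetSystem (e : ℕ → ℕ) : IsCodeSystem (subsetSystem e) e :=
  ⟨rfl, rfl, rfl, rfl, fun _ => Iff.rfl, fun _ => Iff.rfl, fun _ _ => Iff.rfl⟩

variable {M : DetSystem}

theorem IsCodeSystem.glue_iff (hM : IsCodeSystem M e) (he : Describes ε Ls e) {i j : ℕ}
    (hi : i < Ls.length) (hj : j < Ls.length) : M.glue i j ↔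
      (Ls.getD j default).leftStates = (Ls.getD i default).rightStates := by
  rw [hM.glue, he.width, Set.ext_iff]
  constructor
  · intro h q
    rw [← he.left j hj, ← he.right i hi]
    exact (h q q.2).symm
  · intro h q hq
    have := h ⟨q, hq⟩
    rw [← he.left j hj, ← he.right i hi] at this
    exact this.symm

/-- Full sequences describe ODDs. -/
theorem IsCodeSystem.full_iff (hM : IsCodeSystem M e) (he : Describes ε Ls e) {x : ℕ → ℕ} {k : ℕ}
    (hk : 0 < k) : M.Full (revPrefix x k) ↔ (∀ i < k, x i < Ls.length) ∧
      IsODD fun i : Fin k => Ls.getD (x i) default := by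
  have hlast : M.last (revPrefix x k) = x (k - 1) := by
    rcases k with _ | k
    · omega
    · rfl
  rw [DetSystem.Full, hlast, DetSystem.valid_revPrefix, hM.size, he.size]
  constructor
  · rintro ⟨h, hf⟩
    have hlt : ∀ i < k, x i < Ls.length := fun i hi => (h i hi).1
    refine ⟨hlt, hk, fun i j hij => ?_, fun i => ?_, fun i => ?_⟩
    · obtain ⟨-, ⟨h1, -⟩ | ⟨-, -, -, h1⟩⟩ := h j j.2
      · omega
      · rw [show (j : ℕ) - 1 = i by omega] at h1
        exact (hM.glue_iff he (hlt i i.2) (hlt j j.2)).1 h1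
    · rw [← he.ini _ (hlt i i.2), ← hM.ini]
      obtain ⟨-, ⟨h1, h2⟩ | ⟨h1, h2, -⟩⟩ := h i i.2
      · exact iff_of_true h2 h1
      · exact iff_of_false h2 h1
    · rw [← he.fin _ (hlt i i.2), ← hM.fin]
      by_cases hik : (i : ℕ) + 1 = k
      · rw [show (i : ℕ) = k - 1 by omega]
        simp only [hf, true_iff]
        omega
      -- Validity at position `i + 1` excludes the final flag at its predecessor.
      · obtain ⟨-, ⟨h1, -⟩ | ⟨-, -, h1, -⟩⟩ := h (i + 1) (by omega)
        · omega
        · exact iff_of_false h1 hik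
  · rintro ⟨hlt, -, hg, hi, hf⟩
    refine ⟨fun i hik => ⟨hlt i hik, ?_⟩, ?_⟩
    · have h1 := hi ⟨i, hik⟩
      simp only at h1
      rw [← he.ini _ (hlt i hik), ← hM.ini] at h1
      by_cases h0 : i = 0
      · exact Or.inl ⟨h0, h1.2 h0⟩
      · refine Or.inr ⟨h0, fun h => h0 (h1.1 h), fun h => ?_, ?_⟩
        · rw [hM.fin, he.fin _ (hlt (i - 1) (by omega))] at h
          have := (hf ⟨i - 1, by omega⟩).1 h
          simp only at this
          omega
        · exact (hM.glue_iff he (hlt (i - 1) (by omega)) (hlt i hik)).2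
            (hg ⟨i - 1, by omega⟩ ⟨i, hik⟩ (by simp; omega))
    · rw [hM.fin, he.fin _ (hlt (k - 1) (by omega))]
      exact (hf ⟨k - 1, by omega⟩).2 (by simp; omega)

/-- The function of strings that is computed by a sequence of layers. -/
noncomputable def DetSystem.computes (M : DetSystem) (n k : ℕ) (D : List ℕ) :
    (Fin k → Fin n) → Prop :=
  fun v => M.Accepts D (revPrefix (fun t => if h : t < k then (v ⟨t, h⟩ : ℕ) else 0) k)

theorem DetSystem.computes_eq_iff (M : DetSystem) (n k : ℕ) (D D' : List ℕ) :
    M.computes n k D = M.computes n k D' ↔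
      ∀ u ∈ words n k, (M.Accepts D u ↔ M.Accepts D' u) := by
  constructor
  · intro h u hu
    obtain ⟨x, hx⟩ := exists_revPrefix u
    have hl := (mem_words.1 hu).1
    rw [hl] at hx
    rw [hx, revPrefix_mem_words] at hu
    have e : revPrefix (fun t => if h : t < k then (x t : ℕ) else 0) k = u := by
      rw [hx]
      exact revPrefix_congr fun i hi => by simp [hi]
    have := congrFun h fun i => ⟨x i, hu i i.2⟩
    simp only [DetSystem.computes] at this
    rw [e] at this
    exact iff_of_eq this
  · intro h
    funext v
    refine propext (h _ (revPrefix_mem_words.2 fun i hi => ?_))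
    simp [hi]

/-- Full sequences of indices correspond to ODDs over `S`, so the two families compute the same
functions once strings of numbers are translated into strings of symbols. The translation `Φ` is
injective because `ε` is a bijection. -/
theorem ncard_computableFunctions_eq [Nonempty A] {k : ℕ} (hk : 0 < k) (hM : IsCodeSystem M e)
    (he : Describes ε Ls e) {S : Set (Layer A w)} (hS : ∀ B, B ∈ Ls ↔ B ∈ S)
    (hacc : ∀ x, M.Full (revPrefix x k) → ∀ s : ℕ → A,
      (M.Accepts (revPrefix x k) (revPrefix (fun t => ε (s t)) k) ↔
        ∃ q ∈ reachSet (fun i => Ls.getD (x i) default) s k,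
          q ∈ (Ls.getD (x (k - 1)) default).finalStates)) :
    (computableFunctions S k).ncard =
      (M.computes n k '' {D | M.Full D ∧ D.length = k}).ncard := by
  classical
  let Φ : ((Fin k → Fin n) → Prop) → ((Fin k → A) → Bool) := fun g s => decide (g fun i => ε (s i))
  have hΦ : Function.Injective Φ := by
    intro g g' h
    funext v
    have := congrFun h fun i => ε.symm (v i)
    simpa [Φ] using this
  rw [← Set.InjOn.ncard_image hΦ.injOn]
  congr 1
  have hval : ∀ x, M.Full (revPrefix x k) → ∀ s : Fin k → A,
      (Φ (M.computes n k (revPrefix x k)) s = true ↔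
        ODDAccepts (fun i : Fin k => Ls.getD (x i) default) s) := by
    intro x hx s
    -- Reachability is formulated for infinite strings; the symbols from position `k` on do not
    -- matter.
    let s' : ℕ → A := fun t => if h : t < k then s ⟨t, h⟩ else Classical.arbitrary A
    have hs' : (fun i : Fin k => s' i) = s := by
      funext i
      simp [s']
    have h := hacc x hx s'
    rw [← oddAccepts_iff (fun i => Ls.getD (x i) default) s' hk, hs'] at h
    rw [← h]
    simp only [Φ, DetSystem.computes, decide_eq_true_eq]
    have hu : revPrefix (fun t => if h : t < k then (ε (s ⟨t, h⟩) : ℕ) else 0) k =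
        revPrefix (fun t => ε (s' t)) k := revPrefix_congr fun i hi => by simp [s', hi]
    rw [hu]
  ext f
  constructor
  · rintro ⟨D, hD, hDS, hf⟩
    choose y hy using fun i => List.getElem_of_mem ((hS (D i)).2 (hDS i))
    choose hy' hy using hy
    let x : ℕ → ℕ := fun t => if h : t < k then y ⟨t, h⟩ else 0
    have hxD : (fun i : Fin k => Ls.getD (x i) default) = D := by
      funext i
      simp [x, hy']
      simpa using hy i
    have hx : M.Full (revPrefix x k) := (hM.full_iff he hk).2
      ⟨fun i hi => by simp [x, hi, hy'], by rwa [hxD]⟩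
    refine ⟨_, ⟨revPrefix x k, ⟨hx, by simp⟩, rfl⟩, ?_⟩
    funext s
    rw [Bool.eq_iff_iff, hval x hx s, hxD, hf]
  · rintro ⟨_, ⟨D, ⟨hD, hl⟩, rfl⟩, rfl⟩
    obtain ⟨x, hx⟩ := exists_revPrefix D
    rw [hl] at hx
    subst hx
    obtain ⟨hlt, hodd⟩ := (hM.full_iff he hk).1 hD
    refine ⟨_, hodd, fun i => ?_, fun s => hval x hD s⟩
    rw [← hS, List.getD_eq_getElem _ _ (hlt i i.2)]
    exact List.getElem_mem _

end Count

section Systems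

variable {A : Type u} {n w : ℕ} {ε : A ≃ Fin n} {Ls : List (Layer A w)} {e : ℕ → ℕ}

theorem getD_mem_of_lt {i : ℕ} (hi : i < Ls.length) : Ls.getD i default ∈ Ls := by
  rw [List.getD_eq_getElem _ _ hi]
  exact List.getElem_mem _

/-! ### Deterministic layers -/

theorem detSystem_trans (he : Describes ε Ls e) (h4 : e 4 = w)
    (hdet : ∀ B ∈ Ls, B.Deterministic) {i : ℕ} (hi : i < Ls.length) {p q : Fin w} {a : A}
    (h : (p, a, q) ∈ (Ls.getD i default).transitions) :
    (detSystem e).trans i p (ε a) = q := by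
  have hd := (hdet _ (getD_mem_of_lt hi)).2
  refine sumOf_eq (h4 ▸ q.2) fun x hx => ?_
  rw [h4] at hx
  have hT := he.trans i hi p a ⟨x, hx⟩
  have hpq := (Ls.getD i default).transitions_subset _ _ _ h
  refine hT.trans ⟨fun h' => ?_, ?_⟩
  · exact congrArg Fin.val (hd p hpq.1 a _ ((Ls.getD i default).transitions_subset _ _ _ h').2
      q hpq.2 h' h)
  · rintro rfl
    exact h

theorem detSystem_start (he : Describes ε Ls e) (h4 : e 4 = w) {i : ℕ} (hi : i < Ls.length)
    {q : Fin w} (h : (Ls.getD i default).initialStates = {q}) : (detSystem e).start i = q := by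
  refine sumOf_eq (h4 ▸ q.2) fun x hx => ?_
  rw [h4] at hx
  refine (he.initial i hi ⟨x, hx⟩).trans ?_
  rw [h, Set.mem_singleton_iff, Fin.ext_iff]

theorem exists_initialStates_eq {B : Layer A w} (hB : B.Deterministic) (h : B.initialFlag = true) :
    ∃ q ∈ B.leftStates, B.initialStates = {q} := by
  obtain ⟨h1, h2⟩ := hB.1 h
  obtain ⟨q, hq⟩ := Set.ncard_eq_one.1 h2
  exact ⟨q, by simp [hq], h1.trans hq⟩

theorem detSystem_bounded (he : Describes ε Ls e) (hw : 0 < w) (h4 : e 4 = w)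
    (h5 : e 5 = 2 ^ (w * w.size)) (hdet : ∀ B ∈ Ls, B.Deterministic) : (detSystem e).Bounded where
  labels_eq := by
    show e 5 = 2 ^ (e 4 * (e 4).size)
    rw [h5, h4]
  start_lt i hi hini := by
    have hi' : i < Ls.length := he.size ▸ hi
    obtain ⟨q, -, hq⟩ := exists_initialStates_eq (hdet _ (getD_mem_of_lt hi')) ((he.ini i hi').1 hini)
    rw [detSystem_start he h4 hi' hq]
    exact h4 ▸ q.2
  trans_lt i hi p hp a ha := by
    have hi' : i < Ls.length := he.size ▸ hi
    have hp' : p < w := h4 ▸ hp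
    have ha' : a < n := he.symbols ▸ ha
    refine sumOf_lt (by omega) fun x hx y hy hxT hyT => ?_
    have key := he.trans i hi' ⟨p, hp'⟩ (ε.symm ⟨a, ha'⟩)
    simp only [Equiv.apply_symm_apply] at key
    have hxT' := (key ⟨x, by omega⟩).1 hxT
    have hyT' := (key ⟨y, by omega⟩).1 hyT
    have s := (Ls.getD i default).transitions_subset
    exact congrArg Fin.val ((hdet _ (getD_mem_of_lt hi')).2 _ (s _ _ _ hxT').1 _ _ (s _ _ _ hxT').2
      _ (s _ _ _ hyT').2 hxT' hyT')

/-- The invariant is that the set of reached states is a singleton, whose element is the state of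
the system. Determinism excludes a second state, and completeness provides one. The latter concerns
left states only, so the invariant also records that the state lies in the left frontier of the next
layer, which follows from the gluing condition. -/
theorem detSystem_accepts (he : Describes ε Ls e) (h4 : e 4 = w)
    (hdet : ∀ B ∈ Ls, B.Deterministic ∧ B.Complete) {k : ℕ} (hk : 0 < k) {x : ℕ → ℕ}
    (hx : (detSystem e).Full (revPrefix x k)) (s : ℕ → A) :
    (detSystem e).Accepts (revPrefix x k) (revPrefix (fun t => ε (s t)) k) ↔
      ∃ q ∈ reachSet (fun i => Ls.getD (x i) default) s k,
        q ∈ (Ls.getD (x (k - 1)) default).finalStates := by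
  have hdet' : ∀ B ∈ Ls, B.Deterministic := fun B hB => (hdet B hB).1
  obtain ⟨hlt, -, hglue, hini, -⟩ := ((isCodeSystem_detSystem e).full_iff he hk).1 hx
  have key := run_revPrefix_rel (D := fun i => Ls.getD (x i) default) (s := s)
    (u := fun t => ε (s t)) hx.1 (fun t X T => ∃ q : Fin w, X = q ∧ T = {q} ∧
      (t < k → q ∈ (Ls.getD (x t) default).leftStates)) ?_ ?_ (k - 1) (by omega)
  · rw [show k - 1 + 1 = k by omega] at key
    obtain ⟨q, hq, hR, -⟩ := key
    rw [hR, DetSystem.Accepts, hq]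
    have hlast : (detSystem e).last (revPrefix x k) = x (k - 1) := by
      rcases k with _ | k
      · omega
      · rfl
    rw [hlast]
    simp only [Set.mem_singleton_iff, exists_eq_left]
    exact he.final _ (hlt (k - 1) (by omega)) q
  · intro _
    obtain ⟨q, hq, hq'⟩ := exists_initialStates_eq (hdet' _ (getD_mem_of_lt (hlt 0 hk)))
      ((hini ⟨0, hk⟩).2 rfl)
    exact ⟨q, detSystem_start he h4 (hlt 0 hk) hq', hq', fun _ => hq⟩
  · rintro t ht _ ⟨q, rfl, hR, hq⟩
    have hB := hdet _ (getD_mem_of_lt (hlt t ht))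
    obtain ⟨q', hq', hT⟩ := hB.2.2 q (hq ht) (s t)
    refine ⟨q', detSystem_trans he h4 hdet' (hlt t ht) hT, ?_, fun ht' => ?_⟩
    · ext y
      simp only [reachSet, hR, Set.mem_singleton_iff, exists_eq_left, Set.mem_ofPred_eq]
      constructor
      · intro hy
        exact hB.1.2 q (hq ht) (s t) y (Layer.transitions_subset _ _ _ _ hy).2 q' hq' hy hT
      · rintro rfl
        exact hT
    · rw [hglue ⟨t, ht⟩ ⟨t + 1, ht'⟩ rfl]
      exact hq'

/-! ### The subset construction -/

/-- A number below `2 ^ w` is determined by its lowest `w` bits, so exactly one candidate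
contributes. -/
theorem sumOf_testBit_eq {W : ℕ} (hW : W = 2 ^ w) (p : ℕ → Prop) :
    sumOf W (fun Y => ∀ q < w, (Y.testBit q ↔ p q)) = ofBitPred w p := by
  subst hW
  exact sumOf_eq (ofBitPred_lt _ _) fun y hy => (forall_testBit_iff hy p).trans eq_comm

theorem subsetSystem_start (he : Describes ε Ls e) (h4 : e 4 = 2 ^ w) (i : ℕ) :
    (subsetSystem e).start i = ofBitPred w (codeInitial e i) := by
  simp only [subsetSystem, he.width]
  exact sumOf_testBit_eq h4 _

theorem subsetSystem_trans (he : Describes ε Ls e) (h4 : e 4 = 2 ^ w) (i X a : ℕ) :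
    (subsetSystem e).trans i X a =
      ofBitPred w fun q => ∃ p < w, X.testBit p ∧ codeTrans e i p a q := by
  have := he.width
  simp only [subsetSystem]
  rw [this]
  exact sumOf_testBit_eq h4 _

theorem subsetSystem_bounded (he : Describes ε Ls e) (h4 : e 4 = 2 ^ w)
    (h5 : e 5 = 2 ^ (2 ^ w * (2 ^ w).size)) : (subsetSystem e).Bounded where
  labels_eq := by
    show e 5 = 2 ^ (e 4 * (e 4).size)
    rw [h5, h4]
  start_lt i _ _ := by
    rw [subsetSystem_start he h4]
    exact (ofBitPred_lt _ _).trans_eq h4.symm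
  trans_lt i _ p _ a _ := by
    rw [subsetSystem_trans he h4]
    exact (ofBitPred_lt _ _).trans_eq h4.symm

/-- The state of the system codes the set of reached states bit by bit, so neither determinism nor
completeness is needed. -/
theorem subsetSystem_accepts (he : Describes ε Ls e) (h4 : e 4 = 2 ^ w) {k : ℕ} (hk : 0 < k)
    {x : ℕ → ℕ} (hx : (subsetSystem e).Full (revPrefix x k)) (s : ℕ → A) :
    (subsetSystem e).Accepts (revPrefix x k) (revPrefix (fun t => ε (s t)) k) ↔
      ∃ q ∈ reachSet (fun i => Ls.getD (x i) default) s k,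
        q ∈ (Ls.getD (x (k - 1)) default).finalStates := by
  obtain ⟨hlt, -⟩ := ((isCodeSystem_subsetSystem e).full_iff he hk).1 hx
  have key := run_revPrefix_rel (D := fun i => Ls.getD (x i) default) (s := s)
    (u := fun t => ε (s t)) hx.1 (fun _ X T => ∀ q : Fin w, X.testBit q ↔ q ∈ T) ?_ ?_
    (k - 1) (by omega)
  · rw [show k - 1 + 1 = k by omega] at key
    have hlast : (subsetSystem e).last (revPrefix x k) = x (k - 1) := by
      rcases k with _ | k
      · omega
      · rfl
    rw [DetSystem.Accepts, hlast]
    show (∃ p < e 1, _ ∧ codeFinal e (x (k - 1)) p) ↔ _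
    rw [he.width]
    constructor
    · rintro ⟨p, hp, hpX, hpF⟩
      exact ⟨⟨p, hp⟩, (key ⟨p, hp⟩).1 hpX, (he.final _ (hlt (k - 1) (by omega)) ⟨p, hp⟩).1 hpF⟩
    · rintro ⟨q, hq, hqF⟩
      exact ⟨q, q.2, (key q).2 hq, (he.final _ (hlt (k - 1) (by omega)) q).2 hqF⟩
  · intro _ q
    rw [subsetSystem_start he h4, testBit_ofBitPred q.2, he.initial _ (hlt 0 hk)]
    rfl
  · intro t ht X hX q
    rw [subsetSystem_trans he h4, testBit_ofBitPred q.2]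
    constructor
    · rintro ⟨p, hp, hpX, hpT⟩
      exact ⟨⟨p, hp⟩, (hX ⟨p, hp⟩).1 hpX, (he.trans _ (hlt t ht) ⟨p, hp⟩ (s t) q).1 hpT⟩
    · rintro ⟨p, hp, hpT⟩
      exact ⟨p, p.2, (hX p).2 hp, (he.trans _ (hlt t ht) p (s t) q).2 hpT⟩

end Systems

/-! ## The number of layers -/

section Card

variable {A : Type u} {n w : ℕ} {Ls : List (Layer A w)}

/-- The components of a layer, except for the transitions. -/
abbrev Layer.frame (B : Layer A w) :
    Bool × Bool × Set (Fin w) × Set (Fin w) × Set (Fin w) × Set (Fin w) :=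
  (B.initialFlag, B.finalFlag, B.leftStates, B.rightStates, B.initialStates, B.finalStates)

theorem Layer.eq_of_frame_eq {B B' : Layer A w} (h : B.frame = B'.frame)
    (hT : B.transitions = B'.transitions) : B = B' := by
  simp only [Layer.frame, Prod.mk.injEq] at h
  exact Layer.ext h.2.2.1 h.2.2.2.1 hT h.2.2.2.2.1 h.2.2.2.2.2 h.1 h.2.1

theorem List.Nodup.length_le_card_of_injOn {α β : Type*} [Fintype β] {l : List α} (hl : l.Nodup)
    (f : α → β) (hf : ∀ a ∈ l, ∀ b ∈ l, f a = f b → a = b) : l.length ≤ Fintype.card β := by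
  have := (hl.map_on hf).length_le_card
  simpa using this

/-- A layer is determined by two flags, four sets of states and a set of triples. -/
theorem length_le_of_nodup (ε : A ≃ Fin n) (hLs : Ls.Nodup) :
    Ls.length ≤ 2 ^ (2 + 4 * w + w * (n * w)) := by
  have h := hLs.length_le_card_of_injOn
    (fun B => (B.frame, {x : Fin w × Fin n × Fin w | (x.1, ε.symm x.2.1, x.2.2) ∈ B.transitions}))
    (fun B _ B' _ h => by
      rw [Prod.mk.injEq] at h
      refine Layer.eq_of_frame_eq h.1 (Set.ext fun ⟨p, a, q⟩ => ?_)
      have := Set.ext_iff.1 h.2 (p, ε a, q)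
      simpa using this)
  simp only [Fintype.card_prod, Fintype.card_bool, Fintype.card_set, Fintype.card_fin] at h
  refine h.trans_eq ?_
  rw [pow_add, pow_add, pow_mul]
  ring

-- The transitions of a deterministic layer form a partial function on `w * n` arguments with `w`
-- possible values. This replaces the exponent `w * (n * w)` of the general count by about `w * n *
-- log (w + 1)`, as the second time bound requires.
open Classical in
theorem length_le_of_deterministic (ε : A ≃ Fin n) (hLs : Ls.Nodup)
    (hdet : ∀ B ∈ Ls, B.Deterministic) :
    Ls.length ≤ 2 ^ (2 + 4 * w) * (w + 1) ^ (w * n) := by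
  have key : ∀ B ∈ Ls, ∀ p a q, (p, a, q) ∈ B.transitions ↔
      (if h : ∃ q, (p, a, q) ∈ B.transitions then some h.choose else none) = some q := by
    intro B hB p a q
    constructor
    · intro h
      have hex : ∃ q, (p, a, q) ∈ B.transitions := ⟨q, h⟩
      have hs := B.transitions_subset
      rw [dif_pos hex, (hdet B hB).2 p (hs _ _ _ h).1 a _ (hs _ _ _ hex.choose_spec).2 q
        (hs _ _ _ h).2 hex.choose_spec h]
    · intro h
      split_ifs at h with hex
      cases h
      exact hex.choose_spec
  have h := hLs.length_le_card_of_injOn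
    (fun B => (B.frame, fun x : Fin w × Fin n => if h : ∃ q, (x.1, ε.symm x.2, q) ∈ B.transitions
      then some h.choose else none))
    (fun B hB B' hB' h => by
      rw [Prod.mk.injEq] at h
      refine Layer.eq_of_frame_eq h.1 (Set.ext fun ⟨p, a, q⟩ => ?_)
      have := congrFun h.2 (p, ε a)
      simp only [Equiv.symm_apply_apply] at this
      rw [key B hB, key B' hB', this])
  simp only [Fintype.card_prod, Fintype.card_bool, Fintype.card_set, Fintype.card_fin,
    Fintype.card_fun, Fintype.card_option] at h
  refine h.trans_eq ?_
  rw [pow_add, pow_mul]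
  ring

theorem Layer.finite (ε : A ≃ Fin n) : Finite (Layer A w) := by
  refine Finite.of_injective
    (fun B : Layer A w => (B.frame, {x : Fin w × Fin n × Fin w |
      (x.1, ε.symm x.2.1, x.2.2) ∈ B.transitions})) fun B B' h => ?_
  simp only [Prod.mk.injEq] at h
  refine Layer.eq_of_frame_eq (by simpa using h.1) (Set.ext fun ⟨p, a, q⟩ => ?_)
  have := Set.ext_iff.1 h.2 (p, ε a, q)
  simpa using this

end Card

/-! ## Estimates -/

theorem layerBits_le (n w : ℕ) : layerBits n w ≤ 2 ^ (2 * w + n + 4) := by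
  have hw : w ≤ 2 ^ w := Nat.lt_two_pow_self.le
  have hn : n ≤ 2 ^ n := Nat.lt_two_pow_self.le
  have h1 : w * (n * w) ≤ 2 ^ (2 * w + n) := by
    calc w * (n * w) ≤ 2 ^ w * (2 ^ n * 2 ^ w) :=
          Nat.mul_le_mul hw (Nat.mul_le_mul hn hw)
      _ = _ := by rw [← pow_add, ← pow_add]; congr 1; ring
  have h2 : 2 ^ w ≤ 2 ^ (2 * w + n) := Nat.pow_le_pow_right (by norm_num) (by omega)
  have h3 : 2 ^ (2 * w + n + 4) = 16 * 2 ^ (2 * w + n) := by rw [pow_add]; ring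
  have h4 : 1 ≤ 2 ^ (2 * w + n) := Nat.one_le_two_pow
  rw [layerBits, h3]
  omega

/-- Each of the four summands in the base of `codeBound` is at most `2 ^ (18 * E)`, so the base is
at most `2 ^ (20 * E)`; the power `16` then yields `320 * E`, and the factor `c` is absorbed by `c ≤
2 ^ c`. -/
theorem mul_codeBound_le {e : ℕ → ℕ} {n w a b x E : ℕ} (h0 : e 0 = n) (h1 : e 1 = w)
    (ha : e 5 ≤ 2 ^ a) (hb : e 2 ≤ 2 ^ b) (hE : 1 ≤ E) (hnE : n ≤ E) (hwE : w ≤ E)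
    (haE : a ≤ 2 * E) (hbE : b ≤ 8 * E) (c : ℕ) (hx : x = c + 320) :
    c * codeBound e ≤ 2 ^ (x * E) := by
  have hL := layerBits_le n w
  have hsum : e 5 + e 2 + layerBits n w + 2 ≤ 2 ^ (20 * E) := by
    have k1 : 2 ^ a ≤ 2 ^ (18 * E) := Nat.pow_le_pow_right (by norm_num) (by omega)
    have k2 : 2 ^ b ≤ 2 ^ (18 * E) := Nat.pow_le_pow_right (by norm_num) (by omega)
    have k3 : 2 ^ (2 * w + n + 4) ≤ 2 ^ (18 * E) := Nat.pow_le_pow_right (by norm_num) (by omega)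
    have k4 : 2 ^ 1 ≤ 2 ^ (18 * E) := Nat.pow_le_pow_right (by norm_num) (by omega)
    have k5 : 2 ^ (18 * E + 2) ≤ 2 ^ (20 * E) := Nat.pow_le_pow_right (by norm_num) (by omega)
    rw [pow_add] at k5
    omega
  calc c * codeBound e ≤ 2 ^ c * (2 ^ (20 * E)) ^ 16 := by
        rw [codeBound, h0, h1]
        exact Nat.mul_le_mul Nat.lt_two_pow_self.le (Nat.pow_le_pow_left hsum _)
    _ = 2 ^ (c + 320 * E) := by rw [← pow_mul, ← pow_add]; congr 1; ring
    _ ≤ 2 ^ (x * E) := Nat.pow_le_pow_right (by norm_num) (by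
        rw [hx, Nat.add_mul]
        exact Nat.add_le_add_right (Nat.le_mul_of_pos_right _ hE) _)

/-! ## The algorithms -/

theorem countingInput_reg_eq_zero {A : Type u} {n w : ℕ} (ε : A ≃ Fin n) (Ls : List (Layer A w))
    (k : ℕ) {j : ℕ} (hj : 4 ≤ j) : (countingInput ε Ls k).reg j = 0 :=
  List.getD_eq_default _ _ hj

/-- The subset construction has `2 ^ w` states with labels of `w + 1` bits, so the logarithm of the
number of labellings is at most twice `E = n * w * 2 ^ w`. The exponent in the number of layers is
at most `8 * E`, because `w ≤ 2 ^ w`. -/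
theorem exists_program_nondeterministic : ∃ (P : RAMProgram) (c : ℕ), ∀ (A : Type u) [Nonempty A]
    (n : ℕ) (e : A ≃ Fin n) (w : ℕ), 0 < w → ∀ (S : Set (Layer A w)) (Ls : List (Layer A w)),
      Ls.Nodup → (∀ B, B ∈ Ls ↔ B ∈ S) → ∀ k : ℕ, 0 < k →
        RAMOutputsWithin P (countingInput e Ls k) (computableFunctions S k).ncard
          (2 ^ 2 ^ (c * (n * w * 2 ^ w)) * k ^ 2) := by
  have hwid : ∃ P c, ∀ (s : RAMState) (U : ℕ), 2 ≤ U → (∀ i, s.reg (envReg i) ≤ U) →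
      (∀ a, s.mem a ≤ 1) → 2 ^ s.reg 1 ≤ U → ∃ s', RunsIn P s (U ^ c) s' ∧ s'.mem = s.mem ∧
          (∀ j < 8, j ≠ 5 → s'.reg j = s.reg j) ∧ s'.reg 5 = 2 ^ s.reg 1 := by
    obtain ⟨P, c, h⟩ := exists_assign_two_pow (f := fun _ σ => σ 1) (.var 1) (r := 5) (by norm_num)
    exact ⟨P, c, fun s U hU hs hm hv => h s U 0 hU hs (by simpa using hm) hv⟩
  obtain ⟨P, c, h⟩ := exists_count_program ramSystem_subsetSystem (fun _ => rfl) (fun _ => rfl)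
    (wid := fun w => 2 ^ w) hwid
  refine ⟨P, c + 320, fun A _ n ε w hw S Ls hLs hS k hk => ?_⟩
  have hn : 0 < n := Fin.pos (ε (Classical.arbitrary A))
  obtain ⟨e, h0, h1, h2, h3, h4, h5, hrun⟩ := h n w k Ls.length (countingInput ε Ls k) rfl rfl rfl
    rfl (fun j _ hj => countingInput_reg_eq_zero ε Ls k hj) (countingInput_mem_le ε Ls k)
    (fun a ha => countingInput_mem_eq_zero ε Ls k ha) hw hk
  have he := describes_of_testBit ε Ls k h0 h1 h2 h3
  have hstates : 0 < (subsetSystem e).states := by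
    show 0 < e 4
    rw [h4]
    exact Nat.two_pow_pos w
  obtain ⟨t, s', hr, ht, hv⟩ := hrun (subsetSystem_bounded he h4 h5) hstates _
    ((subsetSystem e).computes n k) (fun D D' => by
      rw [DetSystem.computes_eq_iff, show (subsetSystem e).symbols = n from h0])
  refine ⟨t, s', hr, ht.trans (Nat.mul_le_mul_right _ (Nat.pow_le_pow_right (by norm_num) ?_)), ?_⟩
  · have hsize : (2 ^ w).size = w + 1 := Nat.size_pow
    rw [hsize] at h5
    have hw2 : w < 2 ^ w := Nat.lt_two_pow_self
    have e1 : w * 2 ^ w ≤ n * w * 2 ^ w := by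
      rw [Nat.mul_assoc]
      exact Nat.le_mul_of_pos_left _ hn
    have e2 : 2 ^ w ≤ w * 2 ^ w := Nat.le_mul_of_pos_left _ hw
    have e3 : n * w ≤ n * w * 2 ^ w := Nat.le_mul_of_pos_right _ (by positivity)
    have e4 : n ≤ n * w := Nat.le_mul_of_pos_right _ hw
    have e5 : w * (n * w) ≤ n * w * 2 ^ w := by
      rw [Nat.mul_comm]
      exact Nat.mul_le_mul_left _ hw2.le
    refine mul_codeBound_le h0 h1 h5.le (h2.trans_le (length_le_of_nodup ε hLs)) (by omega)
      (by omega) (by omega) ?_ (by omega) c rfl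
    have : 2 ^ w * (w + 1) = w * 2 ^ w + 2 ^ w := by ring
    omega
  · rw [hv, ncard_computableFunctions_eq hk (isCodeSystem_subsetSystem e) he hS
      (fun x hx s => subsetSystem_accepts he h4 hk hx s)]

/-- The layers act on `w` states, whose labels have at most `g + 1` bits for `g = Nat.log 2 (w +
1)`. As `g ≥ 1`, all lower terms are absorbed by `E = n * w * g`. -/
theorem exists_program_deterministic : ∃ (P : RAMProgram) (c : ℕ), ∀ (A : Type u) [Nonempty A]
    (n : ℕ) (e : A ≃ Fin n) (w : ℕ), 0 < w → ∀ (S : Set (Layer A w)) (Ls : List (Layer A w)),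
      Ls.Nodup → (∀ B, B ∈ Ls ↔ B ∈ S) → (∀ B ∈ S, B.Deterministic ∧ B.Complete) →
      ∀ k : ℕ, 0 < k →
        RAMOutputsWithin P (countingInput e Ls k) (computableFunctions S k).ncard
          (2 ^ 2 ^ (c * (n * w * Nat.log 2 (w + 1))) * k ^ 2) := by
  have hwid : ∃ P c, ∀ (s : RAMState) (U : ℕ), 2 ≤ U → (∀ i, s.reg (envReg i) ≤ U) →
      (∀ a, s.mem a ≤ 1) → s.reg 1 ≤ U → ∃ s', RunsIn P s (U ^ c) s' ∧ s'.mem = s.mem ∧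
          (∀ j < 8, j ≠ 5 → s'.reg j = s.reg j) ∧ s'.reg 5 = s.reg 1 := by
    obtain ⟨P, c, h⟩ := exists_assign (κ := 0) (f := fun _ σ => σ 1) (.var 1) 5
    refine ⟨P, c, fun s U hU hs hm _ => ?_⟩
    obtain ⟨s', hr, h'⟩ := h s U 0 hU hs (by simpa using hm)
    exact ⟨s', by simpa using hr, h'⟩
  obtain ⟨P, c, h⟩ := exists_count_program ramSystem_detSystem (fun _ => rfl) (fun _ => rfl)
    (wid := fun w => w) hwid
  refine ⟨P, c + 320, fun A _ n ε w hw S Ls hLs hS hdet k hk => ?_⟩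
  have hn : 0 < n := Fin.pos (ε (Classical.arbitrary A))
  have hdet' : ∀ B ∈ Ls, B.Deterministic ∧ B.Complete := fun B hB => hdet B ((hS B).1 hB)
  obtain ⟨e, h0, h1, h2, h3, h4, h5, hrun⟩ := h n w k Ls.length (countingInput ε Ls k) rfl rfl rfl
    rfl (fun j _ hj => countingInput_reg_eq_zero ε Ls k hj) (countingInput_mem_le ε Ls k)
    (fun a ha => countingInput_mem_eq_zero ε Ls k ha) hw hk
  have he := describes_of_testBit ε Ls k h0 h1 h2 h3
  have hstates : 0 < (detSystem e).states := by
    show 0 < e 4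
    omega
  obtain ⟨t, s', hr, ht, hv⟩ := hrun
    (detSystem_bounded he hw h4 h5 fun B hB => (hdet' B hB).1) hstates _
    ((detSystem e).computes n k) (fun D D' => by
      rw [DetSystem.computes_eq_iff, show (detSystem e).symbols = n from h0])
  refine ⟨t, s', hr, ht.trans (Nat.mul_le_mul_right _ (Nat.pow_le_pow_right (by norm_num) ?_)), ?_⟩
  · set g := Nat.log 2 (w + 1) with hg
    have hg1 : 1 ≤ g := Nat.log_pos (by norm_num) (by omega)
    have hwg : w + 1 < 2 ^ (g + 1) := Nat.lt_pow_succ_log_self (by norm_num) _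
    have hsize : w.size ≤ g + 1 := Nat.size_le.2 (by omega)
    have e1 : w * g ≤ n * w * g := by
      rw [Nat.mul_assoc]
      exact Nat.le_mul_of_pos_left _ hn
    have e2 : w ≤ w * g := Nat.le_mul_of_pos_right _ hg1
    have e3 : n * w ≤ n * w * g := Nat.le_mul_of_pos_right _ hg1
    have e4 : n ≤ n * w := Nat.le_mul_of_pos_right _ hw
    have e5 : w * w.size ≤ w * g + w := (Nat.mul_le_mul_left _ hsize).trans_eq (by ring)
    refine mul_codeBound_le (b := 2 + 4 * w + (g + 1) * (w * n)) h0 h1 h5.le ?_ (by omega)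
      (by omega) (by omega) (by omega) ?_ c rfl
    · rw [h2]
      refine (length_le_of_deterministic ε hLs fun B hB => (hdet' B hB).1).trans ?_
      rw [pow_add _ (2 + 4 * w), pow_mul _ (g + 1)]
      exact Nat.mul_le_mul_left _ (Nat.pow_le_pow_left hwg.le _)
    · have : (g + 1) * (w * n) = n * w * g + n * w := by ring
      omega
  · rw [hv, ncard_computableFunctions_eq hk (isCodeSystem_detSystem e) he hS
      (fun x hx s => detSystem_accepts he h4 hdet' hk hx s)]

/-! ## Fixed sets of layers -/

theorem exists_write_program (l : List ℕ) (b : ℕ) : ∃ (P : RAMProgram) (T : ℕ), ∀ s : RAMState,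
    ∃ s', RunsIn P s T s' ∧ (∀ j, j ≠ 4 → j ≠ 5 → s'.reg j = s.reg j) ∧
      ∀ a, s'.mem a = if b ≤ a ∧ a < b + l.length then l.getD (a - b) 0 else s.mem a := by
  induction l generalizing b with
  | nil =>
    refine ⟨.const 4 0, _, fun s => ⟨_, RunsIn.const _ _ _, fun j h4 _ => by simp [h4], fun a => ?_⟩⟩
    rw [if_neg (by simp)]
    rfl
  | cons v l ih =>
    obtain ⟨P, T, h⟩ := ih (b + 1)
    refine ⟨.seq (.const 4 b) (.seq (.const 5 v) (.seq (.store 4 5) P)),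
      (1 + b.size) + ((1 + v.size) + ((1 + b.size + v.size) + T)), fun s => ?_⟩
    obtain ⟨s', hr, hj, hm⟩ := h ((((s.setReg 4 b).setReg 5 v)).setMem b v)
    refine ⟨s', (RunsIn.const _ _ _).seq ((RunsIn.const _ _ _).seq (RunsIn.seq ?_ hr)),
      fun j h4 h5 => by rw [hj j h4 h5]; simp [h4, h5], fun a => ?_⟩
    · have := RunsIn.store 4 5 ((s.setReg 4 b).setReg 5 v)
      simpa using this
    · rw [hm a]
      by_cases ha : a = b
      · subst ha
        simp
      · by_cases hab : b + 1 ≤ a ∧ a < b + 1 + l.length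
        · rw [if_pos hab, if_pos (by simp; omega), show a - b = a - (b + 1) + 1 by omega,
            List.getD_cons_succ]
        · rw [if_neg hab, if_neg (by simp; omega)]
          simp [ha]

/-- There are finitely many layers, so the list of those in `S` can be hardwired: the program writes
the input table at constant cost and then runs the uniform program. The general bound suffices for
every `S`, since the constant may depend on `w` in any way. -/
theorem exists_program_of_fixed {A : Type u} [Nonempty A] [Finite A] {w : ℕ} (hw : 0 < w)
    (S : Set (Layer A w)) : ∃ (P : RAMProgram) (C : ℕ), ∀ k : ℕ, 0 < k →
      RAMOutputsWithin P (numberInput k) (computableFunctions S k).ncard (C * k ^ 2) := by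
  obtain ⟨n, ⟨ε⟩⟩ := Finite.exists_equiv_fin A
  have := Layer.finite (w := w) ε
  obtain ⟨P, c, hP⟩ := exists_program_nondeterministic.{u}
  set Ls := S.toFinite.toFinset.toList with hLs
  have hS : ∀ B, B ∈ Ls ↔ B ∈ S := fun B => by simp [hLs]
  have hnd : Ls.Nodup := Finset.nodup_toList _
  obtain ⟨Q, T, hQ⟩ := exists_write_program (Ls.flatMap (Layer.encode ε)) 0
  set C := 2 ^ 2 ^ (c * (n * w * 2 ^ w)) with hC
  -- The number `k` is saved to register `2` before register `0` is overwritten. Registers `4` and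
  -- `5`, used for writing the table, are cleared afterwards to reach exactly the expected input
  -- state.
  refine ⟨.seq (.copy 2 0) (.seq (.const 0 n) (.seq (.const 1 w) (.seq (.const 3 Ls.length)
    (.seq Q (.seq (.const 4 0) (.seq (.const 5 0) P)))))),
    n.size + w.size + Ls.length.size + T + 7 + C, fun k hk => ?_⟩
  set s₀ := ((((numberInput k).setReg 2 k).setReg 0 n).setReg 1 w).setReg 3 Ls.length with hs₀
  obtain ⟨s₁, hr₁, hj₁, hm₁⟩ := hQ s₀
  have hfinal : (s₁.setReg 4 0).setReg 5 0 = countingInput ε Ls k := by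
    have hreg : ((s₁.setReg 4 0).setReg 5 0).reg = (countingInput ε Ls k).reg := by
      funext j
      by_cases h5 : j = 5
      · subst h5; simp [countingInput]
      by_cases h4 : j = 4
      · subst h4; simp [countingInput]
      have e : ((s₁.setReg 4 0).setReg 5 0).reg j = s₀.reg j := by
        simp [h4, h5, hj₁ j h4 h5]
      rw [e]
      match j with
      | 0 => simp [hs₀, countingInput]
      | 1 => simp [hs₀, countingInput]
      | 2 => simp [hs₀, countingInput]
      | 3 => simp [hs₀, countingInput]
      | j + 4 => simp [hs₀, countingInput, numberInput]
    have hmem : ((s₁.setReg 4 0).setReg 5 0).mem = (countingInput ε Ls k).mem := by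
      funext a
      show s₁.mem a = (Ls.flatMap (Layer.encode ε)).getD a 0
      rw [hm₁]
      by_cases ha : a < (Ls.flatMap (Layer.encode ε)).length
      · rw [if_pos (by omega), Nat.sub_zero]
      · rw [if_neg (by omega), List.getD_eq_default _ _ (by omega)]
        rfl
    calc (s₁.setReg 4 0).setReg 5 0
        = ⟨((s₁.setReg 4 0).setReg 5 0).reg, ((s₁.setReg 4 0).setReg 5 0).mem⟩ := rfl
      _ = ⟨(countingInput ε Ls k).reg, (countingInput ε Ls k).mem⟩ := by rw [hreg, hmem]
      _ = _ := rfl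
  obtain ⟨t, s', hr, ht, hv⟩ := hP A n ε w hw S Ls hnd hS k hk
  rw [← hfinal] at hr
  rw [← hC] at ht
  obtain ⟨t', hr', ht'⟩ := (RunsIn.copy 2 0 (numberInput k)).seq ((RunsIn.const 0 n _).seq
    ((RunsIn.const 1 w _).seq ((RunsIn.const 3 Ls.length _).seq (hr₁.seq ((RunsIn.const 4 0 _).seq
    ((RunsIn.const 5 0 _).seq ⟨t, hr, ht⟩))))))
  refine ⟨t', s', hr', ht'.trans ?_, hv⟩
  have hk2 : k ≤ k ^ 2 := Nat.le_self_pow (by norm_num) _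
  have hks : k.size ≤ k := Nat.size_le.2 Nat.lt_two_pow_self
  have h1 : (n.size + w.size + Ls.length.size + T + 7 + C) * k ^ 2 =
      (n.size + w.size + Ls.length.size + T + 6) * k ^ 2 + k ^ 2 + C * k ^ 2 := by ring
  have h2 : n.size + w.size + Ls.length.size + T + 6 ≤
      (n.size + w.size + Ls.length.size + T + 6) * k ^ 2 := Nat.le_mul_of_pos_right _ (by omega)
  have h3 : (numberInput k).reg 0 = k := rfl
  rw [h1, h3, Nat.size_zero]
  omega

/-- Counting the functions computed by ODDs over a given set of layers. In the first two parts, one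
program serves all alphabets, widths, sets of layers and lengths, and the set `S` is given by a
list `Ls` of its elements without repetitions. In the second part, `Nat.log 2 (w + 1)` is
`⌊log₂ (w + 1)⌋`, which is positive also for `w = 1`. The last part is about the ODDs (and the
deterministic, complete ODDs) of width at most `w` over a fixed alphabet. -/
theorem corollary5p8 :
    (∃ (P : RAMProgram) (c : ℕ), ∀ (A : Type u) [Nonempty A] (n : ℕ) (e : A ≃ Fin n) (w : ℕ),
      0 < w → ∀ (S : Set (Layer A w)) (Ls : List (Layer A w)), Ls.Nodup → (∀ B, B ∈ Ls ↔ B ∈ S) →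
        ∀ k : ℕ, 0 < k →
          RAMOutputsWithin P (countingInput e Ls k) (computableFunctions S k).ncard
            (2 ^ 2 ^ (c * (n * w * 2 ^ w)) * k ^ 2)) ∧
    (∃ (P : RAMProgram) (c : ℕ), ∀ (A : Type u) [Nonempty A] (n : ℕ) (e : A ≃ Fin n) (w : ℕ),
      0 < w → ∀ (S : Set (Layer A w)) (Ls : List (Layer A w)), Ls.Nodup → (∀ B, B ∈ Ls ↔ B ∈ S) →
        (∀ B ∈ S, B.Deterministic ∧ B.Complete) →
        ∀ k : ℕ, 0 < k →
          RAMOutputsWithin P (countingInput e Ls k) (computableFunctions S k).ncard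
            (2 ^ 2 ^ (c * (n * w * Nat.log 2 (w + 1))) * k ^ 2)) ∧
    (∀ (A : Type u) [Nonempty A] [Finite A] (w : ℕ), 0 < w →
      (∃ (P : RAMProgram) (C : ℕ), ∀ k : ℕ, 0 < k →
        RAMOutputsWithin P (numberInput k)
          (computableFunctions (Set.univ : Set (Layer A w)) k).ncard (C * k ^ 2)) ∧
      (∃ (P : RAMProgram) (C : ℕ), ∀ k : ℕ, 0 < k →
        RAMOutputsWithin P (numberInput k)
          (computableFunctions {B : Layer A w | B.Deterministic ∧ B.Complete} k).ncard
          (C * k ^ 2))) := by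
  exact ⟨exists_program_nondeterministic, exists_program_deterministic, fun A _ _ w hw =>
    ⟨exists_program_of_fixed hw _, exists_program_of_fixed hw _⟩⟩
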